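/- Let $M$ be a connected finite-dimensional Riemannian manifold (without boundary, with Riemannian distance $\mathrm{dist}$), let $f:M\to M$ be a $C^1$ map, and let $\mathcal C$ be its critical set, i.e. the set of points at which $f$ is not a local $C^1$ diffeomorphism. Assume that $f$ is non-flat, that is, $\mathcal C$ is empty or there are $\beta, B, K, C>0$ such that for all $x,y\in M\setminus\mathcal C$ and $0\ne v\in T_xM$: 1. $\frac1B\,\mathrm{dist}(x,\mathcal C)^{\beta}\le \frac{\|Df(x)v\|}{\|v\|}\le B\,\mathrm{dist}(x,\mathcal C)^{-\beta}$; 2. if $\mathrm{dist}(x,y)<\mathrm{dist}(x,\mathcal C)/2$ then $\bigl|\log\|Df(x)^{-1}\|-\log\|Df(y)^{-1}\|\bigr|\le \frac{B}{\mathrm{dist}(x,\mathcal C)^{\beta}}\,\mathrm{dist}(x,y)$; 3. $|\det Df(x)|<K\,\mathrm{dist}(x,\mathcal C)^{\beta}$; 4. $\|Df(x)\|<C$. Let $\mu$ be an expanding measure of $f$, that is, an ergodic $f$-invariant Borel probability such that for $\mu$-almost every $x$ all Lyapunov exponents $\lambda(x,v)=\limsup_{n\to\infty}\frac1n\log\|Df^n(x)v\|$,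 $0\ne v\in T_xM$, are positive (the upper limit is a limit for $\mu$-almost every $x$, by Oseledets' theorem), and such that $f$ is strongly transitive on $\operatorname{supp}\mu$: for every open $U\subset M$ with $U\cap\operatorname{supp}\mu\neq\emptyset$ there is $n\in\mathbb N$ with $\operatorname{supp}\mu\subset\bigcup_{j=0}^n f^j(U)$. For $g:M\to M$ and $c,\delta>0$, call $n$ a $(c,\delta)$-hyperbolic time of $x$ for $g$ if $x$ has a neighbourhood $V_n(x)$ such that $g^n$ maps $V_n(x)$ homeomorphically onto the ball $B_\delta(g^n(x))$ and $$\mathrm{dist}(g^k(x_1),g^k(x_2))\le e^{-2c(n-k)}\,\mathrm{dist}(g^n(x_1),g^n(x_2))\quad\text{for all } x_1,x_2\in V_n(x),\ 0\le k\le n.$$ For $0<\theta<1$ let $H^\theta(c,\delta,g)$ be the set of points $x$ that have infinitely many $(c,\delta)$-hyperbolic times for $g$ and satisfy $$\limsup_{n\to\infty}\frac1n\,\#\{1\le k\le n:\ k\text{ is a }(c,\delta)\text{-hyperbolic time of }x\text{ for }g\}\ \ge\ \theta .$$ Then there exist an integer $\ell\ge1$ and real numbers $c>0$, $\delta>0$,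 $0<\theta<1$ such that $\mu$-almost every point of $M$ belongs to $H^\theta(c,\delta,f^\ell)$, i.e. $\mu(H^\theta(c,\delta,f^\ell))=1$. -/

import Mathlib

open MeasureTheory Filter Bundle
open scoped Manifold ContDiff Topology

namespace HyperbolicTimes

noncomputable section

/-- Absolute value of the determinant of a linear map between Euclidean spaces of the same
dimension, computed in orthonormal bases: `|det A| = √(det (A* A))`. -/
def absDet {V W : Type*} [NormedAddCommGroup V] [InnerProductSpace ℝ V] [FiniteDimensional ℝ V]
    [NormedAddCommGroup W] [InnerProductSpace ℝ W] [FiniteDimensional ℝ W]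
    (A : V →L[ℝ] W) : ℝ :=
  Real.sqrt (LinearMap.det (LinearMap.adjoint (A : V →ₗ[ℝ] W) ∘ₗ (A : V →ₗ[ℝ] W)))

section Smooth

variable {E : Type*} [NormedAddCommGroup E] [NormedSpace ℝ E]
  {M : Type*} [MetricSpace M] [ChartedSpace E M] [IsManifold 𝓘(ℝ, E) ∞ M]
  [RiemannianBundle (fun x : M => TangentSpace 𝓘(ℝ, E) x)]

/-- The derivative `Df(x) : T_x M → T_{f x} M`. The tangent spaces carry the norms of the
Riemannian metric. -/
abbrev D (E : Type*) [NormedAddCommGroup E] [NormedSpace ℝ E]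
    {M : Type*} [MetricSpace M] [ChartedSpace E M] (f : M → M) (x : M) :
    TangentSpace 𝓘(ℝ, E) x →L[ℝ] TangentSpace 𝓘(ℝ, E) (f x) :=
  mfderiv 𝓘(ℝ, E) 𝓘(ℝ, E) f x

/-- `C` is a `β`-non-degenerate critical set for `f`. -/
structure IsNonDegenerateCriticalSet [FiniteDimensional ℝ E] (f : M → M) (C : Set M) (β : ℝ) :
    Prop where
  /-- `dist(x, C)^β / B ≤ ‖Df(x) v‖ / ‖v‖ ≤ B dist(x, C)^(-β)`, and the logarithm of
  `‖Df⁻¹‖` is locally Lipschitz with constant `B / dist(x, C)^β`. -/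
  exists_bound : ∃ B : ℝ, 0 < B ∧
    (∀ x ∉ C, ∀ v : TangentSpace 𝓘(ℝ, E) x, v ≠ 0 →
      1 / B * Metric.infDist x C ^ β ≤ ‖D E f x v‖ / ‖v‖ ∧
      ‖D E f x v‖ / ‖v‖ ≤ B * Metric.infDist x C ^ (-β)) ∧
    (∀ x ∉ C, ∀ y ∉ C, dist x y < Metric.infDist x C / 2 →
      |Real.log ‖(D E f x).inverse‖ - Real.log ‖(D E f y).inverse‖|
        ≤ B / Metric.infDist x C ^ β * dist x y)
  exists_det_lt : ∃ K : ℝ, 0 < K ∧ ∀ x ∉ C,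
    haveI : FiniteDimensional ℝ (TangentSpace 𝓘(ℝ, E) x) := inferInstanceAs (FiniteDimensional ℝ E)
    haveI : FiniteDimensional ℝ (TangentSpace 𝓘(ℝ, E) (f x)) :=
      inferInstanceAs (FiniteDimensional ℝ E)
    absDet (D E f x) < K * Metric.infDist x C ^ β
  exists_norm_lt : ∃ C₁ : ℝ, 0 < C₁ ∧ ∀ x ∉ C, ‖D E f x‖ < C₁

/-- The critical set of `f`: the points at which `f` is not a local `C^1` diffeomorphism. -/
def criticalSet (E : Type*) [NormedAddCommGroup E] [NormedSpace ℝ E]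
    {M : Type*} [MetricSpace M] [ChartedSpace E M] (f : M → M) : Set M :=
  {x | ¬ IsLocalDiffeomorphAt 𝓘(ℝ, E) 𝓘(ℝ, E) 1 f x}

/-- `f` is non-flat: it is a local `C^1` diffeomorphism except in a critical set that is
`β`-non-degenerate for some `β > 0`. If there are no critical points (`f` is a local
diffeomorphism), the conditions, which are in terms of the distance to the critical set,
are void. -/
def IsNonFlat (E : Type*) [NormedAddCommGroup E] [NormedSpace ℝ E] [FiniteDimensional ℝ E]
    {M : Type*} [MetricSpace M] [ChartedSpace E M] [IsManifold 𝓘(ℝ, E) ∞ M]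
    [RiemannianBundle (fun x : M => TangentSpace 𝓘(ℝ, E) x)] (f : M → M) : Prop :=
  (criticalSet E f).Nonempty →
    ∃ β : ℝ, 0 < β ∧ IsNonDegenerateCriticalSet (E := E) f (criticalSet E f) β

/-- The Lyapunov exponent of `f` at `x` in the direction `v`, i.e. the growth rate
`lim (1/n) log ‖Df^n(x) v‖`, with `log 0 = -∞`. It is defined as an upper limit so that it makes
sense at all points; almost everywhere the limit exists, by Oseledets' theorem. -/
def lyapunovExponent (f : M → M) (x : M) (v : TangentSpace 𝓘(ℝ, E) x) : EReal :=
  limsup (fun n : ℕ => ENNReal.log ‖D E (f^[n]) x v‖ₑ / (n : EReal)) atTop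

end Smooth

/-- `f` is strongly transitive on `X`. -/
def StronglyTransitiveOn {M : Type*} [TopologicalSpace M] (f : M → M) (X : Set M) : Prop :=
  ∀ U : Set M, IsOpen U → (U ∩ X).Nonempty → ∃ n : ℕ, X ⊆ ⋃ j ≤ n, f^[j] '' U

/-- `μ` is an expanding measure of `f`: an ergodic invariant probability all of whose Lyapunov
exponents are positive, such that `f` is strongly transitive on the support of `μ`. -/
structure IsExpandingMeasure (E : Type*) [NormedAddCommGroup E] [NormedSpace ℝ E]
    {M : Type*} [MetricSpace M] [ChartedSpace E M] [IsManifold 𝓘(ℝ, E) ∞ M]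
    [RiemannianBundle (fun x : M => TangentSpace 𝓘(ℝ, E) x)] [MeasurableSpace M]
    (f : M → M) (μ : Measure M) : Prop where
  isProbabilityMeasure : IsProbabilityMeasure μ
  ergodic : Ergodic f μ
  lyapunov_pos : ∀ᵐ x ∂μ, ∀ v : TangentSpace 𝓘(ℝ, E) x, v ≠ 0 → 0 < lyapunovExponent f x v
  stronglyTransitive : StronglyTransitiveOn f μ.support

section Metric

variable {M : Type*} [MetricSpace M]

/-- `n` is a `(c, δ)`-hyperbolic time of `f` for `x`: some neighbourhood `V` of `x` is mapped
homeomorphically by `f^n` onto the ball `B_δ(f^n x)`, with uniform backward contraction. -/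
def IsHyperbolicTime (c δ : ℝ) (f : M → M) (n : ℕ) (x : M) : Prop :=
  ∃ V ∈ 𝓝 x,
    (∃ e : V ≃ₜ Metric.ball (f^[n] x) δ, ∀ y : V, (e y : M) = f^[n] y) ∧
    ∀ x₁ ∈ V, ∀ x₂ ∈ V, ∀ k ≤ n,
      dist (f^[k] x₁) (f^[k] x₂)
        ≤ Real.exp (-2 * c * ((n : ℝ) - (k : ℝ))) * dist (f^[n] x₁) (f^[n] x₂)

/-- `H_n(c, δ, f)`. -/
def hypTimeSet (c δ : ℝ) (f : M → M) (n : ℕ) : Set M := {x | IsHyperbolicTime c δ f n x}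

/-- `H(c, δ, f)`: the points with infinitely many `(c, δ)`-hyperbolic times. -/
def infHypTimeSet (c δ : ℝ) (f : M → M) : Set M :=
  ⋂ m ≥ 1, ⋃ n ≥ m, hypTimeSet c δ f n

/-- `H^θ(c, δ, f)`: the points of `H(c, δ, f)` at which the upper frequency of `(c, δ)`-hyperbolic
times is at least `θ`. -/
def freqHypTimeSet (θ c δ : ℝ) (f : M → M) : Set M :=
  {x ∈ infHypTimeSet c δ f | θ ≤ limsup
    (fun n : ℕ => (({k : ℕ | 1 ≤ k ∧ k ≤ n ∧ x ∈ hypTimeSet c δ f k}.ncard : ℝ) / (n : ℝ))) atTop}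

end Metric

end

end HyperbolicTimes

/-! Positive Lyapunov exponents give expansion only asymptotically and at each point separately. A
hyperbolic time needs an inverse branch of `f^[ℓ]` along an orbit segment, contracting at a definite
rate, on a ball of definite radius. So two quantities must be controlled on average along orbits:
the expansion over blocks of length `ℓ`, and the logarithm of the radius on which that expansion
persists.

Strong transitivity makes the support compact, so the derivative can be read as a bounded measurable
cocycle on a fixed space (`exists_boundedFrame`). All the ergodic theory rests on one greedy
inequality, `superadditive_lower_bound`: if most points gain a fixed rate within a bounded time,
jumping from gain to gain along an orbit gives a linear lower bound. It yields both halves of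
Birkhoff's theorem and, applied to the skew product on vectors, `exists_block_expansion`.

The delicate point is that orbits may approach the critical set. If `log |det Df|` were not
integrable, top-dimensional volumes would decay faster than any exponential. In the least dimension
where such decay occurs, the volumes of one dimension lower decay at most exponentially, and
`exists_bounded_orbit` then builds a nonzero vector with bounded images, contradicting positive
exponents. Hence `log |det Df|` is integrable (`integrable_log_abs_det`), and since the determinant
is at most a multiple of a power of the distance to the critical set, the logarithm of that distance
is integrable as well. Non-flatness turns this into integrable bounds for the expansion at a point
and for the scale on which it is nearly constant (`exists_integrable_regularity`).

Finally, Pliss' lemma selects times with expansion over all preceding windows; deleting the times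
spoiled by an earlier, exceptionally small radius leaves positive frequency
(`exists_freqHypTimeSet_ae`). At each remaining time radial paths are lifted backwards, and the
endpoints of the lifts form the inverse branch (`isHyperbolicTime_of_expansion`). -/

namespace HyperbolicTimes

/-! ### Ergodic averages and superadditive processes by greedy covering. -/

section ErgodicTheory

/-- Greedy covering of an orbit: a superadditive process that gains `β` per unit of time within
time `N` from each point of `G`, and loses at most `K - β` in one step elsewhere. -/
lemma superadditive_lower_bound {Y : Type*} {F : Y → Y} {s : ℕ → Y → ℝ} {S G : Set Y} {K : Y → ℝ}
    {β : ℝ} {N : ℕ} (hS : Set.MapsTo F S S) (hs0 : ∀ y ∈ S, 0 ≤ s 0 y)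
    (hs : ∀ m n, ∀ y ∈ S, s m y + s n (F^[m] y) ≤ s (m + n) y)
    (hK : ∀ y, 0 ≤ K y) (h1 : ∀ y ∈ S, β - K y ≤ s 1 y)
    (hG : ∀ y ∈ S, y ∈ G → ∃ n, 1 ≤ n ∧ n ≤ N ∧ β * n ≤ s n y) (n : ℕ) :
    ∀ y ∈ S, β * n - birkhoffSum F (Gᶜ.indicator K) n y
      - ∑ j ∈ Finset.Ico (n - N) n, K (F^[j] y) ≤ s n y := by
  have hK' : ∀ y, 0 ≤ Gᶜ.indicator K y := fun y => Set.indicator_nonneg (fun y _ => hK y) y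
  induction n using Nat.strong_induction_on with
  | _ n ih =>
  intro y hy
  rcases Nat.eq_zero_or_pos n with rfl | hn
  · simpa using hs0 y hy
  -- the crude bound, used for short times
  have crude : ∀ m, ∀ y ∈ S, β * m - ∑ j ∈ Finset.range m, K (F^[j] y) ≤ s m y := by
    intro m
    induction m with
    | zero => intro y hy; simpa using hs0 y hy
    | succ m ihm =>
      intro y hy
      have h := hs 1 m y hy
      have h' := ihm (F y) (hS hy)
      have h'' := h1 y hy
      rw [Finset.sum_range_succ', add_comm m 1]
      simp only [Function.iterate_succ, Function.comp_apply, Function.iterate_zero, id] at *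
      push_cast
      linarith
  -- For short segments the window of the last `N` indices is the whole segment, so the tail sum
  -- pays for every step.
  by_cases hnN : n ≤ N
  · refine le_trans ?_ (crude n y hy)
    rw [Nat.sub_eq_zero_of_le hnN, ← Finset.range_eq_Ico]
    have : 0 ≤ birkhoffSum F (Gᶜ.indicator K) n y := Finset.sum_nonneg fun j _ => hK' _
    linarith
  push Not at hnN
  -- a jump of length `m` followed by the induction hypothesis
  have jump : ∀ m, 1 ≤ m → m ≤ n →
      β * m - birkhoffSum F (Gᶜ.indicator K) m y ≤ s m y →
      β * n - birkhoffSum F (Gᶜ.indicator K) n y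
        - ∑ j ∈ Finset.Ico (n - N) n, K (F^[j] y) ≤ s n y := by
    intro m hm hmn hsm
    have h := hs m (n - m) y hy
    have h' := ih (n - m) (by omega) (F^[m] y) (hS.iterate m hy)
    have e : m + (n - m) = n := by omega
    have hb := birkhoffSum_add F (Gᶜ.indicator K) m (n - m) y
    rw [e] at h hb
    -- After the shift by `m` the remaining window ends at `n` and has length at most `N`, so it
    -- lies inside the last `N` indices.
    have hw : ∑ j ∈ Finset.Ico (n - m - N) (n - m), K (F^[j] (F^[m] y))
        ≤ ∑ j ∈ Finset.Ico (n - N) n, K (F^[j] y) := by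
      have : ∑ j ∈ Finset.Ico (n - m - N) (n - m), K (F^[j] (F^[m] y))
          = ∑ j ∈ Finset.Ico (n - m - N + m) (n - m + m), K (F^[j] y) := by
        rw [← Finset.sum_Ico_add']
        apply Finset.sum_congr rfl
        intro j hj
        rw [← Function.iterate_add_apply]
      rw [this]
      apply Finset.sum_le_sum_of_subset_of_nonneg
      · apply Finset.Ico_subset_Ico <;> omega
      · intros; exact hK _
    have e2 : ((n - m : ℕ) : ℝ) = n - m := by push_cast [hmn]; ring
    rw [e2] at h'
    rw [hb]
    linarith
  by_cases hyG : y ∈ G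
  · obtain ⟨m, hm1, hmN, hsm⟩ := hG y hy hyG
    refine jump m hm1 (by omega) (le_trans ?_ hsm)
    have : 0 ≤ birkhoffSum F (Gᶜ.indicator K) m y := Finset.sum_nonneg fun j _ => hK' _
    linarith
  · refine jump 1 le_rfl hn ?_
    rw [birkhoffSum_one, Set.indicator_of_mem (by exact hyG)]
    simpa using h1 y hy

variable {X : Type*} [MeasurableSpace X] {μ : Measure X} {T : X → X}

/-- The set of points that ever visit `Z` contains its own preimage, so ergodicity makes it null or
of full measure; it contains `Z`. -/
lemma ae_exists_iterate_mem [IsFiniteMeasure μ] (hT : Ergodic T μ) {Z : Set X} (hZ : MeasurableSet Z) (h0 : μ Z ≠ 0) :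
    ∀ᵐ x ∂μ, ∃ j, T^[j] x ∈ Z := by
  set W : Set X := ⋃ j, T^[j] ⁻¹' Z with hW
  have hWm : MeasurableSet W := MeasurableSet.iUnion fun j => hT.measurable.iterate j hZ
  have hsub : T ⁻¹' W ⊆ W := by
    intro x hx
    simp only [hW, Set.mem_preimage, Set.mem_iUnion] at hx ⊢
    obtain ⟨j, hj⟩ := hx
    exact ⟨j + 1, by simpa using hj⟩
  rcases hT.ae_empty_or_univ_of_preimage_ae_le hWm.nullMeasurableSet
    (Eventually.of_forall hsub) with h | h
  · exfalso
    apply h0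
    have : μ W = 0 := by rw [measure_congr h]; simp
    exact measure_mono_null (fun x hx => Set.mem_iUnion.2 ⟨0, hx⟩) this
  · filter_upwards [h.mem_iff] with x hx
    simpa [hW] using hx

lemma measurableSet_frequently_atTop {p : ℕ → X → Prop} (hp : ∀ n, MeasurableSet {x | p n x}) :
    MeasurableSet {x | ∃ᶠ n in atTop, p n x} := by
  have : {x | ∃ᶠ n in atTop, p n x} = ⋂ N, ⋃ n ≥ N, {x | p n x} := by
    ext x
    simp [frequently_atTop]
  rw [this]
  exact MeasurableSet.iInter fun N => MeasurableSet.biUnion (Set.to_countable _) fun n _ => hp n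

lemma measurable_birkhoffSum (hT : Measurable T) {φ : X → ℝ} (hφ : Measurable φ) (n : ℕ) :
    Measurable (birkhoffSum T φ n) := by
  unfold birkhoffSum
  exact Finset.measurable_sum _ fun j _ => hφ.comp (hT.iterate j)

lemma integrable_comp_iterate (hT : MeasurePreserving T μ μ) {φ : X → ℝ} (hφ : Integrable φ μ)
    (j : ℕ) : Integrable (fun x => φ (T^[j] x)) μ :=
  (hT.iterate j).integrable_comp_of_integrable hφ

lemma integral_comp_iterate (hT : MeasurePreserving T μ μ) {φ : X → ℝ} (hφ : Integrable φ μ)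
    (j : ℕ) : ∫ x, φ (T^[j] x) ∂μ = ∫ x, φ x ∂μ := by
  have h := (hT.iterate j)
  conv_rhs => rw [← h.map_eq]
  rw [integral_map h.measurable.aemeasurable (by rw [h.map_eq]; exact hφ.1)]

lemma integrable_birkhoffSum (hT : MeasurePreserving T μ μ) {φ : X → ℝ} (hφ : Integrable φ μ)
    (n : ℕ) : Integrable (birkhoffSum T φ n) μ := by
  unfold birkhoffSum
  exact integrable_finsetSum _ fun j _ => integrable_comp_iterate hT hφ j

lemma integral_birkhoffSum (hT : MeasurePreserving T μ μ) {φ : X → ℝ} (hφ : Integrable φ μ)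
    (n : ℕ) : ∫ x, birkhoffSum T φ n x ∂μ = n * ∫ x, φ x ∂μ := by
  unfold birkhoffSum
  rw [integral_finsetSum _ fun j _ => integrable_comp_iterate hT hφ j]
  simp [integral_comp_iterate hT hφ]

/-- Integrals over the complements of an exhausting sequence tend to zero. -/
lemma tendsto_integral_compl_indicator {K : X → ℝ} (hK : Integrable K μ)
    {G : ℕ → Set X} (hGm : ∀ N, MeasurableSet (G N)) (hG : Monotone G)
    (hfull : ∀ᵐ x ∂μ, ∃ N, x ∈ G N) :
    Tendsto (fun N => ∫ x, (G N)ᶜ.indicator K x ∂μ) atTop (𝓝 0) := by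
  have : Tendsto (fun N => ∫ x, (G N)ᶜ.indicator K x ∂μ) atTop (𝓝 (∫ x, (0 : X → ℝ) x ∂μ)) := by
    apply tendsto_integral_of_dominated_convergence (fun x => ‖K x‖)
    · intro N; exact hK.1.indicator (hGm N).compl
    · exact hK.norm
    · intro N; exact Eventually.of_forall fun x => norm_indicator_le_norm_self _ _
    · filter_upwards [hfull] with x ⟨N, hN⟩
      apply tendsto_const_nhds.congr'
      filter_upwards [eventually_ge_atTop N] with n hn
      rw [Set.indicator_of_notMem]
      · rfl
      · simpa using hG hn hN
  simpa using this

/-- The points at which the process `s` gains `β` per unit of time within time `N`. -/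
def gainSet {Y : Type*} (s : ℕ → Y → ℝ) (β : ℝ) (N : ℕ) : Set Y :=
  ⋃ n ∈ Finset.Icc 1 N, {x | β * n ≤ s n x}

lemma mem_gainSet {Y : Type*} {s : ℕ → Y → ℝ} {β : ℝ} {N : ℕ} {x : Y} :
    x ∈ gainSet s β N ↔ ∃ n : ℕ, 1 ≤ n ∧ n ≤ N ∧ β * n ≤ s n x := by
  simp [gainSet, and_assoc]

lemma measurableSet_gainSet {s : ℕ → X → ℝ} (hs : ∀ n, Measurable (s n)) (β : ℝ) (N : ℕ) :
    MeasurableSet (gainSet s β N) :=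
  Finset.measurableSet_biUnion _ fun n _ => measurableSet_le measurable_const (hs n)

lemma monotone_gainSet {Y : Type*} (s : ℕ → Y → ℝ) (β : ℝ) : Monotone (gainSet s β) := by
  intro a b hab x hx
  rw [mem_gainSet] at hx ⊢
  obtain ⟨n, h1, h2, h3⟩ := hx
  exact ⟨n, h1, h2.trans hab, h3⟩

variable [IsProbabilityMeasure μ]

/-- Rate `β` is reached infinitely often on a set of positive measure, which almost every orbit
enters. The cost of the time `j` before entry does not depend on the length of the later gain, and
the drop from `β` to `β'` absorbs it. -/
lemma ae_exists_mem_gainSet (hT : Ergodic T μ) {s : ℕ → X → ℝ} (hsm : ∀ n, Measurable (s n))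
    {S : Set X} (hS : ∀ᵐ x ∂μ, x ∈ S)
    (hs : ∀ m n, ∀ x ∈ S, s m x + s n (T^[m] x) ≤ s (m + n) x) {β β' : ℝ} (hβ : β' < β)
    (h : ¬ ∀ᵐ x ∂μ, ∀ᶠ n : ℕ in atTop, s n x < β * n) :
    ∀ᵐ x ∂μ, ∃ N, x ∈ gainSet s β' N := by
  set Z : Set X := {x | ∃ᶠ n : ℕ in atTop, β * n ≤ s n x} with hZ
  have hZm : MeasurableSet Z :=
    measurableSet_frequently_atTop fun n => measurableSet_le measurable_const (hsm n)
  have hZ0 : μ Z ≠ 0 := by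
    intro h0
    apply h
    rw [ae_iff]
    convert h0 using 2
    ext x
    simp [hZ, Filter.Frequently]
  filter_upwards [ae_exists_iterate_mem hT hZm hZ0, hS] with x ⟨j, hj⟩ hxS
  have hev : ∀ᶠ n : ℕ in atTop, β' * j - s j x ≤ (β - β') * n :=
    (tendsto_natCast_atTop_atTop.const_mul_atTop (sub_pos.2 hβ)).eventually_ge_atTop _
  obtain ⟨n, hn, hn', hn1⟩ :=
    (Frequently.and_eventually hj (hev.and (eventually_ge_atTop 1))).exists
  refine ⟨j + n, mem_gainSet.2 ⟨j + n, by omega, le_rfl, ?_⟩⟩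
  have := hs j n x hxS
  push_cast
  linarith

/-- The upper half of Birkhoff's theorem. If it fails, almost every point gains an intermediate rate
`β'` in finite time; integrating the greedy bound gives `β' ≤ ∫ φ` in the limit, which is false. -/
lemma ae_eventually_birkhoffSum_lt (hT : Ergodic T μ) {φ : X → ℝ} (hφm : Measurable φ)
    (hφ : Integrable φ μ) {β : ℝ} (hβ : ∫ x, φ x ∂μ < β) :
    ∀ᵐ x ∂μ, ∀ᶠ n : ℕ in atTop, birkhoffSum T φ n x < β * n := by
  have hTm := hT.measurable
  obtain ⟨β', hβ', hβ'β⟩ := exists_between hβ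
  by_contra hcon
  have hsm := measurable_birkhoffSum hTm hφm
  set G : ℕ → Set X := gainSet (birkhoffSum T φ) β' with hG
  have hGm : ∀ N, MeasurableSet (G N) := measurableSet_gainSet hsm β'
  have hfull : ∀ᵐ x ∂μ, ∃ N, x ∈ G N :=
    ae_exists_mem_gainSet hT hsm (S := Set.univ) (by simp)
      (fun m n x _ => (birkhoffSum_add T φ m n x).ge) hβ'β hcon
  set K : X → ℝ := fun x => |β'| + |φ x| with hKdef
  have hKi : Integrable K μ := (integrable_const _).add hφ.abs
  have key : ∀ N, β' - ∫ x, (G N)ᶜ.indicator K x ∂μ ≤ ∫ x, φ x ∂μ := by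
    intro N
    have hlow := superadditive_lower_bound (F := T) (s := birkhoffSum T φ) (S := Set.univ)
      (G := G N) (K := K) (β := β') (N := N) (Set.mapsTo_univ _ _) (by simp)
      (fun m n y _ => (birkhoffSum_add T φ m n y).ge) (fun y => by positivity)
      (fun y _ => by
        rw [birkhoffSum_one]
        have := neg_abs_le (φ y)
        have := le_abs_self β'
        simp only [hKdef]; linarith)
      (fun y _ hy => mem_gainSet.1 hy)
    have hint : ∀ n : ℕ, N ≤ n → β' * n - n * ∫ x, (G N)ᶜ.indicator K x ∂μ - N * ∫ x, K x ∂μ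
        ≤ n * ∫ x, φ x ∂μ := by
      intro n hn
      have hi1 := integrable_birkhoffSum hT.toMeasurePreserving (hKi.indicator (hGm N).compl) n
      have hi2 : Integrable (fun x => ∑ j ∈ Finset.Ico (n - N) n, K (T^[j] x)) μ :=
        integrable_finsetSum _ fun j _ => integrable_comp_iterate hT.toMeasurePreserving hKi j
      have h := integral_mono (((integrable_const (β' * n)).sub hi1).sub hi2)
        (integrable_birkhoffSum hT.toMeasurePreserving hφ n) (fun x => hlow n x trivial)
      have e1 := integral_sub ((integrable_const (μ := μ) (β' * n)).sub hi1) hi2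
      have e2 := integral_sub (integrable_const (μ := μ) (β' * n)) hi1
      simp only [Pi.sub_apply] at h e1 e2
      rw [e1, e2,
        integral_birkhoffSum hT.toMeasurePreserving hφ,
        integral_birkhoffSum hT.toMeasurePreserving (hKi.indicator (hGm N).compl),
        integral_finsetSum _ fun j _ => integrable_comp_iterate hT.toMeasurePreserving hKi j] at h
      simp only [integral_comp_iterate hT.toMeasurePreserving hKi] at h
      simp only [integral_const, probReal_univ, one_smul, Finset.sum_const, Nat.card_Ico,
        nsmul_eq_mul] at h
      rwa [Nat.sub_sub_self hn] at h
    -- The terminal window costs `N * ∫ K` whatever `n` is, so it disappears after division by `n`.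
    by_contra hlt
    push Not at hlt
    have hev : ∀ᶠ n : ℕ in atTop, N * ∫ x, K x ∂μ
        < (β' - ∫ x, (G N)ᶜ.indicator K x ∂μ - ∫ x, φ x ∂μ) * n :=
      (tendsto_natCast_atTop_atTop.const_mul_atTop (sub_pos.2 hlt)).eventually_gt_atTop _
    obtain ⟨n, hn, hn'⟩ := (hev.and (eventually_ge_atTop N)).exists
    have := hint n hn'
    linarith
  have hlim := (tendsto_integral_compl_indicator hKi hGm (monotone_gainSet _ _) hfull).const_sub β'
  rw [sub_zero] at hlim
  have := le_of_tendsto' hlim key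
  linarith

lemma ae_eventually_lt_birkhoffSum (hT : Ergodic T μ) {φ : X → ℝ} (hφm : Measurable φ)
    (hφ : Integrable φ μ) {β : ℝ} (hβ : β < ∫ x, φ x ∂μ) :
    ∀ᵐ x ∂μ, ∀ᶠ n : ℕ in atTop, β * n < birkhoffSum T φ n x := by
  have := ae_eventually_birkhoffSum_lt hT hφm.neg hφ.neg (β := -β)
    (by simp only [Pi.neg_apply]; rw [integral_neg]; linarith)
  filter_upwards [this] with x hx
  filter_upwards [hx] with n hn
  have : birkhoffSum T (-φ) n x = - birkhoffSum T φ n x := by simp [birkhoffSum]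
  rw [this] at hn
  linarith

/-- For a function that is bounded below and not integrable, Birkhoff averages tend to infinity. -/
lemma ae_eventually_lt_birkhoffSum_of_not_integrable (hT : Ergodic T μ) {φ : X → ℝ}
    (hφm : Measurable φ) {c : ℝ} (hc : ∀ x, c ≤ φ x) (hφ : ¬ Integrable φ μ) (β : ℝ) :
    ∀ᵐ x ∂μ, ∀ᶠ n : ℕ in atTop, β * n < birkhoffSum T φ n x := by
  have hi : ∀ R : ℕ, Integrable (fun x => min (φ x) (R : ℝ)) μ := by
    intro R
    refine Integrable.of_bound (hφm.min measurable_const).aestronglyMeasurable (|c| + R) ?_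
    refine Eventually.of_forall fun x => ?_
    rw [Real.norm_eq_abs, abs_le]
    have h1 := neg_abs_le c
    have h2 := abs_nonneg c
    have h3 : (0 : ℝ) ≤ R := R.cast_nonneg
    exact ⟨le_min (by linarith [hc x]) (by linarith), (min_le_right _ _).trans (by linarith)⟩
  -- If every truncation had integral at most `β`, Fatou's lemma would make `φ - c` integrable.
  obtain ⟨R, hR⟩ : ∃ R : ℕ, β < ∫ x, min (φ x) R ∂μ := by
    by_contra hcon
    push Not at hcon
    apply hφ
    have hi' : Integrable (fun x => φ x - c) μ := by
      have hlim : ∀ᵐ x ∂μ, Tendsto (fun R : ℕ => min (φ x) R - c) atTop (𝓝 (φ x - c)) := by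
        refine Eventually.of_forall fun x => tendsto_const_nhds.congr' ?_
        filter_upwards [eventually_ge_atTop ⌈φ x⌉₊] with R hR
        rw [min_eq_left (Nat.ceil_le.1 hR)]
      refine ⟨(hφm.sub_const c).aestronglyMeasurable, lt_of_le_of_lt
        (b := liminf (fun R : ℕ => ∫⁻ x, ‖min (φ x) R - c‖ₑ ∂μ) atTop) ?_ (lt_top_iff_ne_top.2 ?_)⟩
      · rw [lintegral_congr_ae (by filter_upwards [hlim] with x hx using hx.enorm.liminf_eq.symm)]
        exact lintegral_liminf_le fun R =>
          ((hφm.min measurable_const).sub_const c).enorm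
      · refine ne_top_of_le_ne_top (ENNReal.ofReal_ne_top (r := β - c)) ?_
        refine (liminf_le_of_frequently_le' ?_)
        refine (eventually_ge_atTop ⌈c⌉₊).frequently.mono fun R hR => ?_
        have h0 : ∀ x, 0 ≤ min (φ x) R - c := fun x =>
          sub_nonneg.2 (le_min (hc x) (Nat.ceil_le.1 hR))
        simp_rw [fun x => Real.enorm_of_nonneg (h0 x)]
        have e := ofReal_integral_eq_lintegral_ofReal ((hi R).sub (integrable_const c))
          (Eventually.of_forall h0)
        simp only [Pi.sub_apply] at e
        rw [← e, integral_sub (hi R) (integrable_const c)]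
        apply ENNReal.ofReal_le_ofReal
        simpa using hcon R
    exact (hi'.add (integrable_const c)).congr (Eventually.of_forall fun x => by simp)
  filter_upwards [ae_eventually_lt_birkhoffSum hT (hφm.min measurable_const) (hi R) hR] with x hx
  filter_upwards [hx] with n hn
  exact hn.trans_le (Finset.sum_le_sum fun j _ => min_le_left _ _)

/-- A superadditive process with increments bounded below either grows faster than linearly or
grows at most linearly. -/
lemma superadditive_dichotomy (hT : Ergodic T μ) {s : ℕ → X → ℝ} (hsm : ∀ n, Measurable (s n))
    {S : Set X} (hST : Set.MapsTo T S S) (hS : ∀ᵐ x ∂μ, x ∈ S) (hs0 : ∀ x ∈ S, 0 ≤ s 0 x)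
    (hs : ∀ m n, ∀ x ∈ S, s m x + s n (T^[m] x) ≤ s (m + n) x)
    {c : ℝ} (hc : ∀ x ∈ S, -c ≤ s 1 x) :
    (∀ α : ℝ, ∀ᵐ x ∂μ, ∀ᶠ n : ℕ in atTop, α * n ≤ s n x) ∨
      ∃ α : ℝ, ∀ᵐ x ∂μ, ∀ᶠ n : ℕ in atTop, s n x ≤ α * n := by
  by_cases hα : ∃ α : ℝ, ∀ᵐ x ∂μ, ∀ᶠ n : ℕ in atTop, s n x < α * n
  · obtain ⟨α, hα⟩ := hα
    exact Or.inr ⟨α, hα.mono fun x hx => hx.mono fun n hn => hn.le⟩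
  rw [not_exists] at hα
  left
  intro α
  -- One unit of rate is lost in passing to gains reached in finite time. Half of another pays for
  -- the points outside the gain set, the other half for the terminal window, which leaves `α`.
  have hfull := ae_exists_mem_gainSet hT hsm hS hs (β := α + 2) (β' := α + 1) (by linarith)
    (hα (α + 2))
  have hGm := measurableSet_gainSet hsm (α + 1)
  set K : X → ℝ := fun _ => |α + 1| + |c| with hK
  have hKi : Integrable K μ := integrable_const _
  obtain ⟨N, hN⟩ := ((tendsto_integral_compl_indicator hKi hGm (monotone_gainSet _ _)
    hfull).eventually_lt_const (u := 1 / 2) (by norm_num)).exists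
  have hbir := ae_eventually_birkhoffSum_lt hT (measurable_const.indicator (hGm N).compl)
    (hKi.indicator (hGm N).compl) hN
  filter_upwards [hbir, hS] with x hx hxS
  have hev : ∀ᶠ n : ℕ in atTop, N * (|α + 1| + |c|) ≤ (1 / 2 : ℝ) * n :=
    (tendsto_natCast_atTop_atTop.const_mul_atTop (by norm_num)).eventually_ge_atTop _
  filter_upwards [hx, hev] with n hn hn'
  have hlow := superadditive_lower_bound (F := T) (s := s) (S := S) (G := gainSet s (α + 1) N)
    (K := K) (β := α + 1) (N := N) hST hs0 hs (fun y => by positivity)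
    (fun y hy => by
      have h1 := hc y hy
      have := le_abs_self (α + 1)
      have := le_abs_self c
      simp only [hK]
      linarith)
    (fun y _ hy => mem_gainSet.1 hy) n x hxS
  have hcard : ∑ j ∈ Finset.Ico (n - N) n, K (T^[j] x) ≤ N * (|α + 1| + |c|) := by
    simp only [hK, Finset.sum_const, Nat.card_Ico, nsmul_eq_mul]
    apply mul_le_mul_of_nonneg_right _ (by positivity)
    exact_mod_cast (by omega : n - (n - N) ≤ N)
  linarith

end ErgodicTheory


/-! ### Growth of `k`-dimensional volumes and slowly growing vectors. -/

section VolumeGrowth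

open ContinuousAlternatingMap

variable {E : Type*} [NormedAddCommGroup E] [NormedSpace ℝ E]

/-- The largest expansion rate of `k`-dimensional volumes under `A`, measured by the norm of the
pullback of alternating `k`-forms. -/
noncomputable def volGrowth (k : ℕ) (A : E →L[ℝ] E) : ℝ :=
  ‖(compContinuousLinearMapCLM A : (E [⋀^Fin k]→L[ℝ] ℝ) →L[ℝ] (E [⋀^Fin k]→L[ℝ] ℝ))‖

lemma volGrowth_nonneg (k : ℕ) (A : E →L[ℝ] E) : 0 ≤ volGrowth k A := by
  unfold volGrowth
  exact ContinuousLinearMap.opNorm_nonneg _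

lemma continuous_volGrowth (k : ℕ) : Continuous (volGrowth k : (E →L[ℝ] E) → ℝ) := by
  unfold volGrowth
  exact (continuous_compContinuousLinearMapCLM (𝕜 := ℝ) (E := E) (F := E) (G := ℝ)
    (ι := Fin k)).norm

lemma volGrowth_comp_le (k : ℕ) (A B : E →L[ℝ] E) :
    volGrowth k (A.comp B) ≤ volGrowth k A * volGrowth k B := by
  rw [mul_comm]
  refine ContinuousLinearMap.opNorm_le_bound _
    (mul_nonneg (volGrowth_nonneg _ _) (volGrowth_nonneg _ _)) fun η => ?_
  have : (compContinuousLinearMapCLM (A.comp B) : (E [⋀^Fin k]→L[ℝ] ℝ) →L[ℝ] _) η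
      = (compContinuousLinearMapCLM B : (E [⋀^Fin k]→L[ℝ] ℝ) →L[ℝ] _)
        ((compContinuousLinearMapCLM A : (E [⋀^Fin k]→L[ℝ] ℝ) →L[ℝ] _) η) := by
    ext v
    rfl
  rw [this, mul_assoc]
  exact (ContinuousLinearMap.le_opNorm _ _).trans
    (mul_le_mul_of_nonneg_left (ContinuousLinearMap.le_opNorm _ _) (norm_nonneg _))

lemma volGrowth_le_norm_pow (k : ℕ) (A : E →L[ℝ] E) : volGrowth k A ≤ ‖A‖ ^ k := by
  refine ContinuousLinearMap.opNorm_le_bound _ (by positivity) fun η => ?_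
  have := norm_compContinuousLinearMap_le η A
  rw [Fintype.card_fin, mul_comm] at this
  exact this

lemma volGrowth_zero (A : E →L[ℝ] E) : volGrowth 0 A = 1 := by
  have h1 : (compContinuousLinearMapCLM A : (E [⋀^Fin 0]→L[ℝ] ℝ) →L[ℝ] (E [⋀^Fin 0]→L[ℝ] ℝ))
      = ContinuousLinearMap.id ℝ _ := by
    ext η v
    change η (A ∘ v) = η v
    congr 1
    exact Subsingleton.elim _ _
  have : Nontrivial (E [⋀^Fin 0]→L[ℝ] ℝ) := by
    refine ⟨constOfIsEmpty ℝ E (Fin 0) (1 : ℝ), 0, fun h => ?_⟩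
    have := DFunLike.congr_fun h 0
    simp at this
  rw [volGrowth, h1, ContinuousLinearMap.norm_id]

/-- Start from the determinant in top degree; contracting a nonzero form with a suitable vector
lowers the degree and keeps it nonzero. -/
lemma exists_alternating_ne_zero [FiniteDimensional ℝ E] {k : ℕ} (hk : k ≤ Module.finrank ℝ E) :
    ∃ η : E [⋀^Fin k]→L[ℝ] ℝ, η ≠ 0 := by
  induction hk using Nat.decreasingInduction with
  | self =>
    let b := Module.finBasis ℝ E
    have hc : Continuous fun v : Fin (Module.finrank ℝ E) → E => b.det v := by
      simp only [Module.Basis.det_apply]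
      refine Continuous.matrix_det (continuous_matrix fun i j => ?_)
      exact (b.coord i).continuous_of_finiteDimensional.comp (continuous_apply j)
    refine ⟨⟨⟨b.det.toMultilinearMap, hc⟩, b.det.map_eq_zero_of_eq'⟩, fun h => ?_⟩
    have h1 := DFunLike.congr_fun h (b : Fin _ → E)
    change b.det b = 0 at h1
    rw [b.det_self] at h1
    exact one_ne_zero h1
  | of_succ k hk ih =>
    obtain ⟨η, hη⟩ := ih
    obtain ⟨v, hv⟩ : ∃ v, η v ≠ 0 := by
      by_contra hcon
      push Not at hcon
      exact hη (by ext v; simpa using hcon v)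
    refine ⟨η.curryLeft (v 0), fun h => hv ?_⟩
    have := DFunLike.congr_fun h (Matrix.vecTail v)
    rw [curryLeft_apply_apply] at this
    rw [← Matrix.cons_head_tail v]
    exact this

lemma compContinuousLinearMap_finrank [FiniteDimensional ℝ E] (A : E →L[ℝ] E)
    (η : E [⋀^Fin (Module.finrank ℝ E)]→L[ℝ] ℝ) :
    η.compContinuousLinearMap A = LinearMap.det (A : E →ₗ[ℝ] E) • η := by
  ext v
  change η (A ∘ v) = LinearMap.det (A : E →ₗ[ℝ] E) • η v
  let b := Module.finBasis ℝ E
  have h := AlternatingMap.eq_smul_basis_det (e := b) η.toAlternatingMap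
  have h' : ∀ v, η v = η b * b.det v := fun v => by
    have := DFunLike.congr_fun h v
    simpa using this
  rw [h' (A ∘ v), h' v]
  have := b.det_comp (A : E →ₗ[ℝ] E) v
  simp only [ContinuousLinearMap.coe_coe] at this
  rw [this, smul_eq_mul]
  ring

lemma volGrowth_finrank [FiniteDimensional ℝ E] (A : E →L[ℝ] E) :
    volGrowth (Module.finrank ℝ E) A = |LinearMap.det (A : E →ₗ[ℝ] E)| := by
  have hA : ∀ η : E [⋀^Fin (Module.finrank ℝ E)]→L[ℝ] ℝ,
      ‖(compContinuousLinearMapCLM A : (E [⋀^Fin (Module.finrank ℝ E)]→L[ℝ] ℝ) →L[ℝ] _) η‖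
        = |LinearMap.det (A : E →ₗ[ℝ] E)| * ‖η‖ := fun η => by
    change ‖η.compContinuousLinearMap A‖ = _
    rw [compContinuousLinearMap_finrank, norm_smul, Real.norm_eq_abs]
  apply le_antisymm
  · exact ContinuousLinearMap.opNorm_le_bound _ (abs_nonneg _) fun η => (hA η).le
  · obtain ⟨η, hη⟩ := exists_alternating_ne_zero (E := E) le_rfl
    refine le_of_mul_le_mul_right ?_ (norm_pos_iff.2 hη)
    rw [← hA]
    exact ContinuousLinearMap.le_opNorm _ _

lemma volGrowth_pos [FiniteDimensional ℝ E] {k : ℕ} (hk : k ≤ Module.finrank ℝ E)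
    {A : E →L[ℝ] E} (hA : Function.Surjective A) : 0 < volGrowth k A := by
  obtain ⟨η, hη⟩ := exists_alternating_ne_zero (E := E) hk
  refine lt_of_le_of_ne (volGrowth_nonneg _ _) fun h => hη ?_
  ext v
  choose w hw using fun i => hA (v i)
  have h0 := (compContinuousLinearMapCLM A :
    (E [⋀^Fin k]→L[ℝ] ℝ) →L[ℝ] (E [⋀^Fin k]→L[ℝ] ℝ)).le_opNorm η
  change _ ≤ volGrowth k A * _ at h0
  rw [← h, zero_mul, norm_le_zero_iff] at h0
  have e : v = A ∘ w := by ext i; simp [hw]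
  rw [e]
  exact DFunLike.congr_fun h0 w

/-- The norm of an alternating map is almost attained at unit vectors. -/
lemma exists_lt_alternating_apply {k : ℕ} (η : E [⋀^Fin k]→L[ℝ] ℝ) {r : ℝ} (hr0 : 0 ≤ r)
    (hr : r < ‖η‖) : ∃ w : Fin k → E, (∀ i, ‖w i‖ ≤ 1) ∧ r < |η w| := by
  obtain ⟨m, hm⟩ : ∃ m, r * ∏ i, ‖m i‖ < ‖η m‖ := by
    by_contra hcon
    push Not at hcon
    exact absurd (η.opNorm_le_bound hr0 hcon) (not_le.2 hr)
  have hne : ∀ i, m i ≠ 0 := by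
    intro i hi
    rw [η.map_coord_zero i hi, norm_zero] at hm
    exact absurd hm (not_lt.2 (by positivity))
  refine ⟨fun i => ‖m i‖⁻¹ • m i, fun i => ?_, ?_⟩
  · rw [norm_smul, norm_inv, norm_norm, inv_mul_cancel₀ (norm_ne_zero_iff.2 (hne i))]
  · have hp : 0 < ∏ i, ‖m i‖ := Finset.prod_pos fun i _ => norm_pos_iff.2 (hne i)
    have := η.toContinuousMultilinearMap.map_smul_univ (fun i => ‖m i‖⁻¹) m
    change η _ = _ • η m at this
    rw [this, smul_eq_mul, abs_mul, Finset.prod_inv_distrib, abs_of_pos (inv_pos.2 hp),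
      inv_mul_eq_div, lt_div_iff₀ hp]
    exact hm

/-- Both tuples have the same entries up to order: `x` together with `y` deprived of its `i`-th
entry. An alternating form therefore vanishes on both or on neither. -/
lemma map_removeNth_cons_eq_zero {j : ℕ} (η : E [⋀^Fin j]→L[ℝ] ℝ) (x : E) (y : Fin j → E)
    (i : Fin j) (h : η (Function.update y i x) = 0) :
    η (Fin.removeNth i.succ (Fin.cons x y : Fin (j + 1) → E)) = 0 := by
  cases j with
  | zero => exact i.elim0
  | succ j =>
    have h1 : Fin.removeNth i.succ (Fin.cons x y : Fin (j + 2) → E)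
        = Fin.cons x (Fin.removeNth i y) := by
      ext k
      refine Fin.cases ?_ (fun k => ?_) k
      · simp [Fin.removeNth]
      · simp [Fin.removeNth]
    rw [h1]
    rw [← Fin.insertNth_removeNth, map_insertNth] at h
    exact (smul_eq_zero.1 h).resolve_left (by simp)

/-- If `(j + 1)`-volumes grow much less than `j`-volumes under `B`, then `B` is small on a
subspace `U` of codimension at most `j`, and vectors with small images are close to `U`. -/
lemma exists_slow_subspace [FiniteDimensional ℝ E] {j : ℕ} (B : E →L[ℝ] E)
    (hV : 0 < volGrowth j B) {C : ℝ} (hC1 : 1 ≤ C) (hC : ‖B‖ ≤ C) :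
    ∃ U : Submodule ℝ E,
      (∀ u ∈ U, ‖B u‖ ≤ 2 * (j + 1) * volGrowth (j + 1) B / volGrowth j B * ‖u‖) ∧
      (∀ v, ∃ u ∈ U, ‖u - v‖ ≤ 2 * j * C ^ j / volGrowth j B * ‖B v‖) ∧
      (j < Module.finrank ℝ E → ∃ u ∈ U, u ≠ 0) := by
  obtain ⟨η, hη1, hη⟩ := ContinuousLinearMap.exists_lt_apply_of_lt_opNorm
    (compContinuousLinearMapCLM B : (E [⋀^Fin j]→L[ℝ] ℝ) →L[ℝ] _) (half_lt_self hV)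
  obtain ⟨w, hw1, hw⟩ := exists_lt_alternating_apply _ (half_pos hV).le hη
  replace hw : volGrowth j B / 2 < |η (B ∘ w)| := hw
  have hη0 : η (B ∘ w) ≠ 0 := fun h => by
    rw [h, abs_zero] at hw; linarith
  -- The unit vectors `w` nearly realize the growth of `j`-volumes. The subspace is cut out by `j`
  -- functionals: the `i`-th one replaces `B (w i)` by `B u` inside `η`.
  let Φ : E →ₗ[ℝ] (Fin j → ℝ) := LinearMap.pi fun i =>
    (η.toAlternatingMap.toMultilinearMap.toLinearMap (B ∘ w) i) ∘ₗ (B : E →ₗ[ℝ] E)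
  have hΦ : ∀ u i, Φ u i = η (Function.update (B ∘ w) i (B u)) := fun u i => rfl
  refine ⟨LinearMap.ker Φ, fun u hu => ?_, fun v => ?_, fun hj => ?_⟩
  · have hu' : ∀ i, η (Function.update (B ∘ w) i (B u)) = 0 := fun i => by
      rw [← hΦ, LinearMap.mem_ker.1 hu]; rfl
    obtain ⟨ξ, hξ1, hξ⟩ := exists_dual_vector'' ℝ (B u)
    -- The wedge of `η` with a norming functional of `B u`. On `(B u, B w)` the membership of `u` in
    -- the kernel kills every term but the first, so its value is `‖B u‖ * η (B ∘ w)`; the growth of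
    -- `(j + 1)`-volumes bounds this.
    let Ω := alternatizeUncurryFin (ξ.smulRight η)
    have hΩn : ‖Ω‖ ≤ j + 1 := by
      refine (norm_alternatizeUncurryFin_le _).trans ?_
      rw [ContinuousLinearMap.norm_smulRight_apply]
      have : ‖ξ‖ * ‖η‖ ≤ 1 := mul_le_one₀ hξ1 (norm_nonneg _) hη1.le
      have hj : (0 : ℝ) ≤ j + 1 := by positivity
      nlinarith
    have hΩ : Ω (Fin.cons (B u) (B ∘ w)) = ‖B u‖ * η (B ∘ w) := by
      rw [alternatizeUncurryFin_apply, Fin.sum_univ_succ]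
      rw [Finset.sum_eq_zero]
      · simp [hξ]
      · intro i _
        simp only [Fin.cons_succ, ContinuousLinearMap.smulRight_apply,
          ContinuousAlternatingMap.smul_apply]
        rw [map_removeNth_cons_eq_zero η _ _ _ (hu' i)]
        simp
    have hcons : (Fin.cons (B u) (B ∘ w) : Fin (j + 1) → E) = B ∘ (Fin.cons u w : Fin (j + 1) → E) := by
      ext i
      refine Fin.cases ?_ (fun k => ?_) i <;> simp
    have hle : ‖B u‖ * |η (B ∘ w)| ≤ volGrowth (j + 1) B * (j + 1) * ‖u‖ := by
      have h1 := ((compContinuousLinearMapCLM B : (E [⋀^Fin (j + 1)]→L[ℝ] ℝ) →L[ℝ] _) Ω).le_opNorm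
        (Fin.cons u w)
      change ‖Ω (B ∘ (Fin.cons u w : Fin (j + 1) → E))‖ ≤ _ at h1
      rw [← hcons, hΩ, norm_mul, norm_norm, Real.norm_eq_abs] at h1
      refine h1.trans ?_
      have h2 : ∏ i, ‖(Fin.cons u w : Fin (j + 1) → E) i‖ ≤ ‖u‖ := by
        rw [Fin.prod_univ_succ]
        simp only [Fin.cons_zero, Fin.cons_succ]
        exact mul_le_of_le_one_right (norm_nonneg _)
          (Finset.prod_le_one (fun _ _ => norm_nonneg _) fun i _ => hw1 i)
      have h3 := (compContinuousLinearMapCLM B :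
        (E [⋀^Fin (j + 1)]→L[ℝ] ℝ) →L[ℝ] (E [⋀^Fin (j + 1)]→L[ℝ] ℝ)).le_opNorm Ω
      have h4 : ‖(compContinuousLinearMapCLM B : (E [⋀^Fin (j + 1)]→L[ℝ] ℝ) →L[ℝ]
        (E [⋀^Fin (j + 1)]→L[ℝ] ℝ)) Ω‖ ≤ volGrowth (j + 1) B * (j + 1) :=
        h3.trans (mul_le_mul_of_nonneg_left hΩn (norm_nonneg _))
      exact mul_le_mul h4 h2 (Finset.prod_nonneg fun _ _ => norm_nonneg _)
        (mul_nonneg (volGrowth_nonneg _ _) (by positivity))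
    rw [div_mul_eq_mul_div, le_div_iff₀ hV]
    nlinarith [norm_nonneg (B u)]
  -- Projection onto the kernel along the span of `w`, with coefficients given by Cramer's rule.
  · refine ⟨v - ∑ i, (η (Function.update (B ∘ w) i (B v)) / η (B ∘ w)) • w i, ?_, ?_⟩
    · rw [LinearMap.mem_ker]
      ext k
      rw [_root_.map_sub, _root_.map_sum, Pi.sub_apply, Finset.sum_apply, Finset.sum_eq_single k]
      · rw [_root_.map_smul, Pi.smul_apply, hΦ, hΦ]
        have : Function.update (B ∘ w) k (B (w k)) = B ∘ w := by
          rw [← Function.comp_apply (f := B) (g := w), Function.update_eq_self]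
        rw [this, smul_eq_mul, div_mul_cancel₀ _ hη0]
        simp
      · intro i _ hik
        rw [_root_.map_smul, Pi.smul_apply, hΦ]
        rw [η.map_eq_zero_of_eq (Function.update (B ∘ w) k (B (w i))) (i := i) (j := k) _ hik]
        · simp
        · simp [Function.update_of_ne hik]
      · simp
    · rw [sub_right_comm, sub_self, zero_sub, norm_neg]
      have hb : ∀ i ∈ Finset.univ, ‖(η (Function.update (B ∘ w) i (B v)) / η (B ∘ w)) • w i‖
          ≤ 2 * C ^ j / volGrowth j B * ‖B v‖ := by
        intro i _
        rw [norm_smul]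
        refine (mul_le_of_le_one_right (norm_nonneg _) (hw1 i)).trans ?_
        have h1 : ‖η (Function.update (B ∘ w) i (B v))‖ ≤ C ^ j * ‖B v‖ := by
          refine (η.le_opNorm _).trans ?_
          refine (mul_le_of_le_one_left (Finset.prod_nonneg fun _ _ => norm_nonneg _) hη1.le).trans ?_
          rw [← Finset.mul_prod_erase _ _ (Finset.mem_univ i), Function.update_self, mul_comm]
          refine mul_le_mul_of_nonneg_right ?_ (norm_nonneg _)
          calc ∏ k ∈ Finset.univ.erase i, ‖Function.update (B ∘ w) i (B v) k‖
              ≤ ∏ k ∈ Finset.univ.erase i, C := by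
                refine Finset.prod_le_prod (fun _ _ => norm_nonneg _) fun k hk => ?_
                rw [Function.update_of_ne (Finset.ne_of_mem_erase hk)]
                refine (B.le_opNorm _).trans ?_
                exact (mul_le_of_le_one_right (norm_nonneg _) (hw1 k)).trans hC
            _ ≤ C ^ j := by
                rw [Finset.prod_const, Finset.card_erase_of_mem (Finset.mem_univ i),
                  Finset.card_univ, Fintype.card_fin]
                exact pow_le_pow_right₀ hC1 (Nat.sub_le _ _)
        rw [norm_div, Real.norm_eq_abs (η (B ∘ w)), div_le_iff₀ (abs_pos.2 hη0)]
        refine h1.trans ?_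
        have h5 : 0 ≤ C ^ j * ‖B v‖ := by positivity
        have : 2 * C ^ j / volGrowth j B * ‖B v‖ * |η (B ∘ w)|
            = C ^ j * ‖B v‖ * (|η (B ∘ w)| / (volGrowth j B / 2)) := by
          field_simp
        rw [this]
        apply le_mul_of_one_le_right h5
        rw [one_le_div (half_pos hV)]
        exact hw.le
      refine (norm_sum_le_of_le _ hb).trans (le_of_eq ?_)
      simp
      ring
  · by_contra hcon
    push Not at hcon
    have hker : LinearMap.ker Φ = ⊥ := (Submodule.eq_bot_iff _).2 hcon
    have := LinearMap.finrank_le_finrank_of_injective (LinearMap.ker_eq_bot.1 hker)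
    simp at this
    omega

/-- If `(j + 1)`-volumes decay superexponentially along a sequence of linear maps and `j`-volumes
do not, then there is a vector whose images remain bounded. -/
lemma exists_bounded_orbit [FiniteDimensional ℝ E] {j : ℕ} (hj : j < Module.finrank ℝ E)
    {B : ℕ → E →L[ℝ] E} {C : ℝ} (hC1 : 1 ≤ C) (hBn : ∀ n, ‖B n‖ ≤ C ^ n)
    (hB : ∀ n v, ‖B (n + 1) v‖ ≤ C * ‖B n v‖) {a : ℝ} (ha : 0 < a)
    (hV : ∀ᶠ n in atTop, a ^ n ≤ volGrowth j (B n))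
    (hW : ∀ ρ : ℝ, 0 < ρ → ∀ᶠ n in atTop, volGrowth (j + 1) (B n) ≤ ρ ^ n) :
    ∃ v ≠ 0, ∀ᶠ n in atTop, ‖B n v‖ ≤ 1 := by
  have hC0 : 0 < C := by linarith
  -- `q ^ n` bounds the cost of projecting onto the slow subspace at time `n`; `ρ` is chosen so that
  -- contraction by `ρ ^ n` beats two such costs, the norm growth `C` and a further factor `8 * C`.
  set q : ℝ := max 1 (2 * C ^ j / a) with hq
  have hq1 : 1 ≤ q := le_max_left _ _
  have hq0 : 0 < q := by linarith
  set ρ : ℝ := (8 * C * q ^ 2 * C)⁻¹ with hρ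
  have hρ0 : 0 < ρ := by positivity
  have hpoly : ∀ c : ℝ, ∀ᶠ n : ℕ in atTop, c ≤ 2 ^ n := fun c =>
    (tendsto_pow_atTop_atTop_of_one_lt (by norm_num : (1 : ℝ) < 2)).eventually_ge_atTop c
  obtain ⟨n₀, hn₀⟩ := eventually_atTop.1 (hV.and ((hW (a * ρ / 2) (by positivity)).and
    ((hpoly (2 * j)).and ((hpoly (2 * (j + 1))).and (eventually_ge_atTop 1)))))
  have hU : ∀ n, n₀ ≤ n → ∃ U : Submodule ℝ E, (∀ u ∈ U, ‖B n u‖ ≤ ρ ^ n * ‖u‖) ∧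
      (∀ v, ∃ u ∈ U, ‖u - v‖ ≤ q ^ n * ‖B n v‖) ∧ ∃ u ∈ U, u ≠ 0 := by
    intro n hn
    obtain ⟨h1, h2, h3, h4, h5⟩ := hn₀ n hn
    have han : 0 < a ^ n := by positivity
    have hVp : 0 < volGrowth j (B n) := han.trans_le h1
    obtain ⟨U, hU1, hU2, hU3⟩ := exists_slow_subspace (B n) hVp (one_le_pow₀ hC1) (hBn n)
    refine ⟨U, fun u hu => (hU1 u hu).trans ?_, fun v => ?_, hU3 hj⟩
    · refine mul_le_mul_of_nonneg_right ?_ (norm_nonneg _)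
      rw [div_le_iff₀ hVp]
      calc 2 * (j + 1) * volGrowth (j + 1) (B n) ≤ 2 ^ n * (a * ρ / 2) ^ n :=
            mul_le_mul h4 h2 (volGrowth_nonneg _ _) (by positivity)
        _ = ρ ^ n * a ^ n := by rw [← mul_pow, ← mul_pow]; congr 1; ring
        _ ≤ ρ ^ n * volGrowth j (B n) := mul_le_mul_of_nonneg_left h1 (by positivity)
    · obtain ⟨u, hu, huv⟩ := hU2 v
      refine ⟨u, hu, huv.trans (mul_le_mul_of_nonneg_right ?_ (norm_nonneg _))⟩
      rw [div_le_iff₀ hVp]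
      calc 2 * j * (C ^ n) ^ j ≤ 2 ^ n * (C ^ n) ^ j :=
            mul_le_mul_of_nonneg_right h3 (by positivity)
        _ = (2 * C ^ j / a) ^ n * a ^ n := by
            rw [← mul_pow, div_mul_cancel₀ _ ha.ne', mul_pow, ← pow_mul, ← pow_mul, mul_comm n j]
        _ ≤ q ^ n * volGrowth j (B n) := by
            refine mul_le_mul ?_ h1 han.le (by positivity)
            exact pow_le_pow_left₀ (by positivity) (le_max_right _ _) n
  choose! U hU1 hU2 hU3 using hU
  -- the successive approximations of the slow vector
  obtain ⟨u₀, hu₀U, hu₀⟩ := hU3 n₀ le_rfl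
  have hstep : ∀ m v, ∃ u ∈ U (n₀ + (m + 1)),
      ‖u - v‖ ≤ q ^ (n₀ + (m + 1)) * ‖B (n₀ + (m + 1)) v‖ := fun m v => hU2 _ (by omega) v
  choose nxt hnxtU hnxt using hstep
  let w : ℕ → E := fun m => Nat.rec (‖u₀‖⁻¹ • u₀) (fun m v => nxt m v) m
  have hw0 : ‖w 0‖ = 1 := by
    change ‖‖u₀‖⁻¹ • u₀‖ = 1
    rw [norm_smul, norm_inv, norm_norm, inv_mul_cancel₀ (norm_ne_zero_iff.2 hu₀)]
  have hwU : ∀ m, w m ∈ U (n₀ + m) := by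
    intro m
    cases m with
    | zero => exact Submodule.smul_mem _ _ hu₀U
    | succ m => exact hnxtU m _
  have hn1 : 1 ≤ n₀ := (hn₀ n₀ le_rfl).2.2.2.2
  -- The vector `w m` is contracted by `ρ ^ (n₀ + m)`, and one more step multiplies by at most `C`;
  -- so it is already extremely close to the next slow subspace.
  have hδ : ∀ m, ‖w (m + 1) - w m‖ ≤ ((8 * C)⁻¹) ^ (n₀ + m) * ‖w m‖ := by
    intro m
    refine (hnxt m (w m)).trans ?_
    have h1 : ‖B (n₀ + (m + 1)) (w m)‖ ≤ C * (ρ ^ (n₀ + m) * ‖w m‖) :=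
      (hB (n₀ + m) (w m)).trans
        (mul_le_mul_of_nonneg_left (hU1 _ (by omega) _ (hwU m)) hC0.le)
    have h2 : q ^ (n₀ + (m + 1)) ≤ (q ^ 2) ^ (n₀ + m) := by
      rw [← pow_mul]; exact pow_le_pow_right₀ hq1 (by omega)
    have h3 : C ≤ C ^ (n₀ + m) := le_self_pow₀ hC1 (by omega)
    calc q ^ (n₀ + (m + 1)) * ‖B (n₀ + (m + 1)) (w m)‖
        ≤ (q ^ 2) ^ (n₀ + m) * (C ^ (n₀ + m) * (ρ ^ (n₀ + m) * ‖w m‖)) := by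
          refine mul_le_mul h2 (h1.trans ?_) (norm_nonneg _) (by positivity)
          exact mul_le_mul_of_nonneg_right h3 (by positivity)
      _ = (q ^ 2 * C * ρ) ^ (n₀ + m) * ‖w m‖ := by rw [mul_pow, mul_pow]; ring
      _ = ((8 * C)⁻¹) ^ (n₀ + m) * ‖w m‖ := by
          congr 2
          rw [hρ]
          field_simp
  have h8 : (8 * C)⁻¹ ≤ 1 := inv_le_one_of_one_le₀ (by linarith)
  have hwn : ∀ m, ‖w m‖ ≤ 2 ^ m := by
    intro m
    induction m with
    | zero => rw [hw0, pow_zero]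
    | succ m ih =>
      have h1 := hδ m
      have h2 : ((8 * C)⁻¹) ^ (n₀ + m) ≤ 1 := pow_le_one₀ (by positivity) h8
      have h3 : ‖w (m + 1)‖ ≤ ‖w (m + 1) - w m‖ + ‖w m‖ := by
        simpa using norm_add_le (w (m + 1) - w m) (w m)
      have h4 := mul_le_of_le_one_left (norm_nonneg (w m)) h2
      rw [pow_succ]
      linarith
  have hr : (4 * C)⁻¹ < 1 := inv_lt_one_of_one_lt₀ (by linarith)
  have hr4 : (4 * C)⁻¹ ≤ 1 / 4 := by
    rw [mul_inv, one_div]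
    exact mul_le_of_le_one_right (by norm_num) (inv_le_one_of_one_le₀ hC1)
  have hdist : ∀ m, dist (w m) (w (m + 1)) ≤ ((4 * C)⁻¹) ^ n₀ * ((4 * C)⁻¹) ^ m := by
    intro m
    rw [dist_comm, dist_eq_norm, ← pow_add]
    refine (hδ m).trans ?_
    calc ((8 * C)⁻¹) ^ (n₀ + m) * ‖w m‖ ≤ ((8 * C)⁻¹) ^ (n₀ + m) * 2 ^ (n₀ + m) := by
          refine mul_le_mul_of_nonneg_left ((hwn m).trans ?_) (by positivity)
          exact pow_le_pow_right₀ (by norm_num) (by omega)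
      _ = ((4 * C)⁻¹) ^ (n₀ + m) := by
          rw [← mul_pow]; congr 1; field_simp; norm_num
  have : CompleteSpace E := FiniteDimensional.complete ℝ E
  obtain ⟨v, hv⟩ := cauchySeq_tendsto_of_complete (cauchySeq_of_le_geometric _ _ hr hdist)
  have hvd : ∀ m, ‖v - w m‖ ≤ ((4 * C)⁻¹) ^ (n₀ + m) * (4 / 3) := by
    intro m
    have h := dist_le_of_le_geometric_of_tendsto _ _ hr hdist hv m
    rw [dist_comm, dist_eq_norm, ← pow_add] at h
    refine h.trans ?_
    rw [div_eq_mul_inv]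
    refine mul_le_mul_of_nonneg_left ?_ (by positivity)
    rw [inv_le_comm₀ (by linarith) (by norm_num)]
    norm_num at hr4 ⊢
    linarith
  refine ⟨v, fun h0 => ?_, ?_⟩
  -- The limit is nonzero because it stays within `1 / 3` of the unit vector `w 0`.
  · have h := hvd 0
    rw [h0, zero_sub, norm_neg, hw0] at h
    have : ((4 * C)⁻¹) ^ (n₀ + 0) ≤ 1 / 4 :=
      (pow_le_of_le_one (by positivity) hr.le (by omega)).trans hr4
    linarith
  -- Split `v` into `w m`, which is slow at this very time, and an error of order `(4 * C)⁻¹ ^ n`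
  -- that the growth `C ^ n` cannot restore.
  · filter_upwards [eventually_ge_atTop n₀] with n hn
    obtain ⟨m, rfl⟩ := Nat.exists_eq_add_of_le hn
    have h1 : ‖B (n₀ + m) v‖ ≤ ‖B (n₀ + m) (v - w m)‖ + ‖B (n₀ + m) (w m)‖ := by
      rw [map_sub]
      simpa using norm_add_le (B (n₀ + m) v - B (n₀ + m) (w m)) (B (n₀ + m) (w m))
    have h2 : ‖B (n₀ + m) (v - w m)‖ ≤ 1 / 3 := by
      calc ‖B (n₀ + m) (v - w m)‖ ≤ C ^ (n₀ + m) * (((4 * C)⁻¹) ^ (n₀ + m) * (4 / 3)) :=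
            ((B (n₀ + m)).le_opNorm _).trans
              (mul_le_mul (hBn _) (hvd m) (norm_nonneg _) (by positivity))
        _ = (1 / 4) ^ (n₀ + m) * (4 / 3) := by
            rw [← mul_assoc, ← mul_pow]; congr 2; field_simp
        _ ≤ 1 / 4 * (4 / 3) := by
            refine mul_le_mul_of_nonneg_right ?_ (by norm_num)
            exact pow_le_of_le_one (by norm_num) (by norm_num) (by omega)
        _ = 1 / 3 := by norm_num
    have h3 : ‖B (n₀ + m) (w m)‖ ≤ 1 / 4 := by
      calc ‖B (n₀ + m) (w m)‖ ≤ ρ ^ (n₀ + m) * 2 ^ (n₀ + m) := by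
            refine (hU1 _ (by omega) _ (hwU m)).trans ?_
            refine mul_le_mul_of_nonneg_left ((hwn m).trans ?_) (by positivity)
            exact pow_le_pow_right₀ (by norm_num) (by omega)
        _ = (ρ * 2) ^ (n₀ + m) := by rw [mul_pow]
        _ ≤ (1 / 4) ^ (n₀ + m) := by
            refine pow_le_pow_left₀ (by positivity) ?_ _
            have : ρ ≤ 8⁻¹ := by
              rw [hρ]
              apply inv_anti₀ (by norm_num)
              have : 1 ≤ C * (q ^ 2 * C) :=
                one_le_mul_of_one_le_of_one_le hC1
                  (one_le_mul_of_one_le_of_one_le (one_le_pow₀ hq1) hC1)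
              linarith
            linarith
        _ ≤ 1 / 4 := pow_le_of_le_one (by norm_num) (by norm_num) (by omega)
    linarith

end VolumeGrowth


/-! ### Linear cocycles whose nonzero vectors grow exponentially. -/

section Cocycle

lemma ae_forall_iterate {X : Type*} [MeasurableSpace X] {μ : Measure X} {T : X → X}
    (hT : MeasurePreserving T μ μ) {p : X → Prop}
    (hp : ∀ᵐ x ∂μ, p x) : ∀ᵐ x ∂μ, ∀ n, p (T^[n] x) :=
  ae_all_iff.2 fun n => (hT.iterate n).quasiMeasurePreserving.ae hp

variable {E : Type*} [NormedAddCommGroup E] [NormedSpace ℝ E]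
  {X : Type*}

/-- The linear cocycle generated by `A` over `T`: `A (T^(n-1) x) ∘ ⋯ ∘ A (T x) ∘ A x`. -/
noncomputable def cocycle (A : X → E →L[ℝ] E) (T : X → X) : ℕ → X → E →L[ℝ] E
  | 0, _ => ContinuousLinearMap.id ℝ E
  | n + 1, x => (cocycle A T n (T x)).comp (A x)

lemma cocycle_add (A : X → E →L[ℝ] E) (T : X → X) (m n : ℕ) (x : X) :
    cocycle A T (m + n) x = (cocycle A T n (T^[m] x)).comp (cocycle A T m x) := by
  induction m generalizing x with
  | zero => rw [Nat.zero_add]; rfl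
  | succ m ih =>
    have : m + 1 + n = (m + n) + 1 := by omega
    rw [this]
    change (cocycle A T (m + n) (T x)).comp (A x) = _
    rw [ih]
    rfl

lemma cocycle_one (A : X → E →L[ℝ] E) (T : X → X) (x : X) : cocycle A T 1 x = A x := rfl

lemma cocycle_succ (A : X → E →L[ℝ] E) (T : X → X) (n : ℕ) (x : X) :
    cocycle A T (n + 1) x = (A (T^[n] x)).comp (cocycle A T n x) := by
  rw [cocycle_add, cocycle_one]

lemma norm_cocycle_le {A : X → E →L[ℝ] E} {C : ℝ} (hC : ∀ x, ‖A x‖ ≤ C) (hC1 : 1 ≤ C)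
    (T : X → X) (n : ℕ) (x : X) : ‖cocycle A T n x‖ ≤ C ^ n := by
  induction n generalizing x with
  | zero => rw [pow_zero]; exact ContinuousLinearMap.norm_id_le
  | succ n ih =>
    rw [pow_succ]
    refine (ContinuousLinearMap.opNorm_comp_le _ _).trans ?_
    exact mul_le_mul (ih _) (hC x) (norm_nonneg _) (by positivity)

lemma norm_cocycle_succ_le {A : X → E →L[ℝ] E} {C : ℝ} (hC : ∀ x, ‖A x‖ ≤ C) (T : X → X)
    (n : ℕ) (x : X) (v : E) : ‖cocycle A T (n + 1) x v‖ ≤ C * ‖cocycle A T n x v‖ := by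
  rw [cocycle_succ, ContinuousLinearMap.comp_apply]
  have h := (A (T^[n] x)).le_opNorm (cocycle A T n x v)
  have h' := hC (T^[n] x)
  have := norm_nonneg (cocycle A T n x v)
  nlinarith

lemma cocycle_injective {A : X → E →L[ℝ] E} {T : X → X} {x : X}
    (h : ∀ n, Function.Injective (A (T^[n] x))) (n : ℕ) :
    Function.Injective (cocycle A T n x) := by
  induction n with
  | zero => exact Function.injective_id
  | succ n ih =>
    rw [cocycle_succ]
    exact (h n).comp ih

/-- Every nonzero vector grows exponentially along a subsequence of times. -/
def GrowsExponentially (A : X → E →L[ℝ] E) (T : X → X) (x : X) : Prop :=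
  ∀ v : E, v ≠ 0 → ∃ a : ℝ, 0 < a ∧ ∃ᶠ n : ℕ in atTop, Real.exp (a * n) < ‖cocycle A T n x v‖

lemma GrowsExponentially.injective {A : X → E →L[ℝ] E} {T : X → X} {x : X}
    (h : GrowsExponentially A T x) : Function.Injective (A x) := by
  rw [injective_iff_map_eq_zero]
  intro v hv
  by_contra hne
  obtain ⟨a, -, hf⟩ := h v hne
  obtain ⟨n, hn, hn1⟩ := (hf.and_eventually (eventually_ge_atTop 1)).exists
  obtain ⟨m, rfl⟩ := Nat.exists_eq_add_of_le hn1
  rw [cocycle_add, cocycle_one, ContinuousLinearMap.comp_apply, hv, map_zero, norm_zero] at hn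
  exact absurd hn (not_lt.2 (Real.exp_pos _).le)

lemma GrowsExponentially.not_bounded {A : X → E →L[ℝ] E} {T : X → X} {x : X}
    (h : GrowsExponentially A T x) {v : E} (hv : v ≠ 0)
    (hb : ∀ᶠ n in atTop, ‖cocycle A T n x v‖ ≤ 1) : False := by
  obtain ⟨a, ha, hf⟩ := h v hv
  obtain ⟨n, hn, hn1⟩ := (hf.and_eventually hb).exists
  have : 1 ≤ Real.exp (a * n) := Real.one_le_exp (by positivity)
  linarith

/-- The vectors that grow at most like `exp (a n)`. -/
noncomputable def slowSpace (A : X → E →L[ℝ] E) (T : X → X) (a : ℝ) (x : X) : Submodule ℝ E where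
  carrier := {v | ∃ K : ℝ, ∀ n : ℕ, ‖cocycle A T n x v‖ ≤ K * Real.exp (a * n)}
  zero_mem' := ⟨0, fun n => by simp⟩
  add_mem' := by
    rintro v w ⟨K, hK⟩ ⟨K', hK'⟩
    refine ⟨K + K', fun n => ?_⟩
    rw [map_add, add_mul]
    exact (norm_add_le _ _).trans (add_le_add (hK n) (hK' n))
  smul_mem' := by
    rintro c v ⟨K, hK⟩
    refine ⟨‖c‖ * K, fun n => ?_⟩
    rw [map_smul, norm_smul, mul_assoc]
    exact mul_le_mul_of_nonneg_left (hK n) (norm_nonneg _)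

lemma slowSpace_mono (A : X → E →L[ℝ] E) (T : X → X) {a b : ℝ} (hab : a ≤ b) (x : X) :
    slowSpace A T a x ≤ slowSpace A T b x := by
  rintro v ⟨K, hK⟩
  have hK0 : 0 ≤ K := by
    have := (norm_nonneg _).trans (hK 0)
    simpa using this
  refine ⟨K, fun n => (hK n).trans (mul_le_mul_of_nonneg_left ?_ hK0)⟩
  exact Real.exp_le_exp.2 (by gcongr)

/-- The cocycle sends the slow space at `x` injectively into the slow space at `T^[j] x`. -/
lemma slowSpace_eq_bot_of_iterate {A : X → E →L[ℝ] E} {T : X → X} {a : ℝ} {x : X}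
    (hinj : ∀ n, Function.Injective (A (T^[n] x))) {j : ℕ}
    (h : slowSpace A T a (T^[j] x) = ⊥) : slowSpace A T a x = ⊥ := by
  rw [Submodule.eq_bot_iff] at h ⊢
  rintro v ⟨K, hK⟩
  have : cocycle A T j x v ∈ slowSpace A T a (T^[j] x) := by
    refine ⟨K * Real.exp (a * j), fun n => ?_⟩
    have h1 := hK (j + n)
    rw [cocycle_add, ContinuousLinearMap.comp_apply] at h1
    refine h1.trans (le_of_eq ?_)
    rw [mul_assoc, ← Real.exp_add]
    push_cast
    ring_nf
  have h0 := h _ this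
  exact cocycle_injective hinj j (h0.trans (map_zero _).symm)

/-- The slow spaces of rates `1 / (k + 1)` decrease, hence stabilize in finite dimension. A nonzero
vector of the stable space would grow more slowly than every exponential. -/
lemma GrowsExponentially.exists_slowSpace_eq_bot [FiniteDimensional ℝ E] {A : X → E →L[ℝ] E}
    {T : X → X} {x : X} (h : GrowsExponentially A T x) :
    ∃ k : ℕ, slowSpace A T (1 / (k + 1)) x = ⊥ := by
  let W : ℕ →o (Submodule ℝ E)ᵒᵈ :=
    { toFun := fun k => OrderDual.toDual (slowSpace A T (1 / (k + 1)) x)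
      monotone' := fun i j hij => OrderDual.toDual_le_toDual.2 (slowSpace_mono A T (by
        apply one_div_le_one_div_of_le (by positivity)
        have : (i : ℝ) ≤ j := by exact_mod_cast hij
        linarith) x) }
  obtain ⟨k, hk⟩ := IsArtinian.monotone_stabilizes W
  refine ⟨k, (Submodule.eq_bot_iff _).2 fun v hv => ?_⟩
  by_contra hv0
  obtain ⟨a, ha, hf⟩ := h v hv0
  obtain ⟨m, hm⟩ := exists_nat_one_div_lt ha
  have hmem : v ∈ slowSpace A T (1 / ((max k m : ℕ) + 1 : ℝ)) x := by
    have := hk (max k m) (le_max_left _ _)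
    have h' : slowSpace A T (1 / (k + 1)) x = slowSpace A T (1 / ((max k m : ℕ) + 1 : ℝ)) x := this
    rwa [← h']
  obtain ⟨K, hK⟩ := slowSpace_mono A T (b := 1 / ((m : ℝ) + 1)) (by
    apply one_div_le_one_div_of_le (by positivity)
    have : (m : ℝ) ≤ (max k m : ℕ) := by exact_mod_cast le_max_right _ _
    linarith) x hmem
  have hlim : ∀ᶠ n : ℕ in atTop, K ≤ Real.exp ((a - 1 / (m + 1)) * n) :=
    (Real.tendsto_exp_atTop.comp (tendsto_natCast_atTop_atTop.const_mul_atTop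
      (sub_pos.2 hm))).eventually_ge_atTop K
  obtain ⟨n, hn, hn'⟩ := (hf.and_eventually hlim).exists
  have h1 := hK n
  have h2 : K * Real.exp (1 / (m + 1) * n) ≤ Real.exp (a * n) := by
    calc K * Real.exp (1 / (m + 1) * n)
        ≤ Real.exp ((a - 1 / (m + 1)) * n) * Real.exp (1 / (m + 1) * n) :=
          mul_le_mul_of_nonneg_right hn' (Real.exp_pos _).le
      _ = Real.exp (a * n) := by rw [← Real.exp_add]; ring_nf
  linarith

lemma forall_ne_zero_iff_sphere {b : ℕ → E →L[ℝ] E} {t : ℕ → ℝ} {F : Set ℕ} :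
    (∀ v : E, v ≠ 0 → ∃ n ∈ F, t n * ‖v‖ < ‖b n v‖) ↔
      ∀ v ∈ Metric.sphere (0 : E) 1, ∃ n ∈ F, t n < ‖b n v‖ := by
  constructor
  · intro h v hv
    rw [mem_sphere_zero_iff_norm] at hv
    obtain ⟨n, hn, hlt⟩ := h v (norm_ne_zero_iff.1 (by rw [hv]; exact one_ne_zero))
    exact ⟨n, hn, by simpa [hv] using hlt⟩
  · intro h v hv
    have hv' := norm_pos_iff.2 hv
    obtain ⟨n, hn, hlt⟩ := h (‖v‖⁻¹ • v) (by
      rw [mem_sphere_zero_iff_norm, norm_smul, norm_inv, norm_norm, inv_mul_cancel₀ hv'.ne'])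
    refine ⟨n, hn, ?_⟩
    rwa [map_smul, norm_smul, norm_inv, norm_norm, lt_inv_mul_iff₀ hv', mul_comm] at hlt

/-- Constants in `ℕ` and vectors in the compact unit sphere: in this form the condition is visibly
measurable. -/
lemma slowSpace_eq_bot_iff {A : X → E →L[ℝ] E} {T : X → X} {a : ℝ} {x : X} :
    slowSpace A T a x = ⊥ ↔ ∀ K : ℕ, ∀ v ∈ Metric.sphere (0 : E) 1, ∃ n ∈ (Set.univ : Set ℕ),
      K * Real.exp (a * n) < ‖cocycle A T n x v‖ := by
  rw [Submodule.eq_bot_iff]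
  constructor
  · intro h K v hv
    by_contra hcon
    push Not at hcon
    have := h v ⟨K, fun n => hcon n trivial⟩
    rw [mem_sphere_zero_iff_norm, this, norm_zero] at hv
    exact zero_ne_one hv
  · rintro h v ⟨K, hK⟩
    by_contra hv
    obtain ⟨m, hm⟩ := exists_nat_ge (K / ‖v‖)
    obtain ⟨n, -, hn⟩ := (forall_ne_zero_iff_sphere
      (t := fun n => m * Real.exp (a * n))).2 (h m) v hv
    have h1 := hK n
    rw [div_le_iff₀ (norm_pos_iff.2 hv)] at hm
    have := Real.exp_pos (a * n)
    nlinarith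

variable [FiniteDimensional ℝ E]

/-- Compactness of the sphere turns the uncountable quantifier over vectors into an open condition
on the family of maps; this is the source of all measurability of uniform growth. -/
lemma isOpen_forall_sphere_exists {ι : Type*} (t : ι → ℝ) :
    IsOpen {b : ι → E →L[ℝ] E | ∀ v ∈ Metric.sphere (0 : E) 1, ∃ i, t i < ‖b i v‖} := by
  have : ProperSpace E := FiniteDimensional.proper ℝ E
  rw [isOpen_iff_eventually]
  intro b hb
  refine (isCompact_sphere (0 : E) 1).eventually_forall_of_forall_eventually fun v hv => ?_
  obtain ⟨i, hi⟩ := hb v hv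
  have hc : Continuous fun z : (ι → E →L[ℝ] E) × E => ‖z.1 i z.2‖ := by fun_prop
  exact ((hc.tendsto (b, v)).eventually_const_lt hi).mono fun z hz => ⟨i, hz⟩

variable [MeasurableSpace X]

lemma measurableSet_forall_sphere_exists {B : ℕ → X → E →L[ℝ] E} (hB : ∀ n, Measurable (B n))
    (t : ℕ → ℝ) (F : Set ℕ) :
    MeasurableSet {x | ∀ v ∈ Metric.sphere (0 : E) 1, ∃ n ∈ F, t n < ‖B n x v‖} := by
  have hm : Measurable fun x (n : F) => B n x := measurable_pi_lambda _ fun n => hB n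
  convert (isOpen_forall_sphere_exists (E := E) fun n : F => t n).measurableSet.preimage hm using 1
  ext x
  simp

lemma measurable_cocycle {A : X → E →L[ℝ] E} {T : X → X} (hA : Measurable A) (hT : Measurable T)
    (n : ℕ) : Measurable (cocycle A T n) := by
  induction n with
  | zero => exact measurable_const
  | succ n ih =>
    have hc : Continuous fun p : (E →L[ℝ] E) × (E →L[ℝ] E) => p.1.comp p.2 := by fun_prop
    exact hc.measurable.comp ((ih.comp hT).prodMk hA)

lemma exists_uniform_time {b : ℕ → E →L[ℝ] E} {t : ℕ → ℝ}
    (h : ∀ v ∈ Metric.sphere (0 : E) 1, ∃ n, t n < ‖b n v‖) :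
    ∃ N, ∀ v ∈ Metric.sphere (0 : E) 1, ∃ n ∈ Set.Iic N, t n < ‖b n v‖ := by
  have : ProperSpace E := FiniteDimensional.proper ℝ E
  obtain ⟨s, hs⟩ := (isCompact_sphere (0 : E) 1).elim_finite_subcover
    (fun n => {v | t n < ‖b n v‖})
    (fun n => isOpen_lt continuous_const (b n).continuous.norm)
    (fun v hv => Set.mem_iUnion.2 (h v hv))
  refine ⟨s.sup id, fun v hv => ?_⟩
  obtain ⟨n, hn, hv'⟩ := Set.mem_iUnion₂.1 (hs hv)
  exact ⟨n, Finset.le_sup (f := id) hn, hv'⟩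

lemma measurableSet_slowSpace_eq_bot {A : X → E →L[ℝ] E} {T : X → X} (hA : Measurable A)
    (hT : Measurable T) (a : ℝ) : MeasurableSet {x | slowSpace A T a x = ⊥} := by
  simp_rw [slowSpace_eq_bot_iff]
  rw [Set.ofPred_forall]
  exact MeasurableSet.iInter fun K =>
    measurableSet_forall_sphere_exists (measurable_cocycle hA hT) _ _


variable {μ : Measure X} [IsProbabilityMeasure μ] {T : X → X} {A : X → E →L[ℝ] E}

/-- The growth rate of nonzero vectors is uniform. -/
lemma exists_uniform_rate (hT : Ergodic T μ) (hA : Measurable A)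
    (hexp : ∀ᵐ x ∂μ, GrowsExponentially A T x) :
    ∃ ε : ℝ, 0 < ε ∧ ∀ᵐ x ∂μ, ∀ v : E, v ≠ 0 →
      ∃ n ∈ (Set.Ici 1 : Set ℕ), Real.exp (ε * n) * ‖v‖ < ‖cocycle A T n x v‖ := by
  -- Countably many rates exhaust almost every point, so one rate works on a set of positive
  -- measure; almost every orbit enters that set.
  obtain ⟨k, hk⟩ : ∃ k : ℕ, μ {x | slowSpace A T (1 / (k + 1)) x = ⊥} ≠ 0 := by
    by_contra hcon
    push Not at hcon
    have h0 : ∀ᵐ x ∂μ, ∀ k : ℕ, ¬ slowSpace A T (1 / (k + 1)) x = ⊥ :=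
      ae_all_iff.2 fun k => by rw [ae_iff]; simpa using hcon k
    obtain ⟨x, hx, hx'⟩ := (hexp.and h0).exists
    obtain ⟨k, hk⟩ := hx.exists_slowSpace_eq_bot
    exact hx' k hk
  refine ⟨1 / (k + 1), by positivity, ?_⟩
  filter_upwards [ae_exists_iterate_mem hT (measurableSet_slowSpace_eq_bot hA hT.measurable _) hk,
    ae_forall_iterate hT.toMeasurePreserving (hexp.mono fun x hx => hx.injective)]
    with x ⟨j, hj⟩ hinj v hv
  have hbot := slowSpace_eq_bot_of_iterate hinj hj
  by_contra hcon
  push Not at hcon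
  refine hv ((Submodule.eq_bot_iff _).1 hbot v ⟨‖v‖, fun n => ?_⟩)
  rcases Nat.eq_zero_or_pos n with rfl | hn
  · simp [cocycle]
  · rw [mul_comm]
    exact hcon n hn

/-- If nonzero vectors grow exponentially, the logarithm of the determinant is integrable. -/
lemma integrable_log_abs_det (hT : Ergodic T μ) (hA : Measurable A) {C : ℝ} (hC1 : 1 ≤ C)
    (hC : ∀ x, ‖A x‖ ≤ C) (hexp : ∀ᵐ x ∂μ, GrowsExponentially A T x) :
    Integrable (fun x => Real.log |LinearMap.det (A x : E →ₗ[ℝ] E)|) μ := by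
  by_contra hni
  set d := Module.finrank ℝ E with hd
  set S : Set X := {x | ∀ n, Function.Injective (A (T^[n] x))} with hS
  have hST : Set.MapsTo T S S := fun x hx n => hx (n + 1)
  have hSae : ∀ᵐ x ∂μ, x ∈ S :=
    ae_forall_iterate hT.toMeasurePreserving (hexp.mono fun x hx => hx.injective)
  -- Volume growth is submultiplicative, so minus its logarithm is superadditive; large values mean
  -- collapsing volumes.
  set s : ℕ → ℕ → X → ℝ := fun k n x => - Real.log (volGrowth k (cocycle A T n x)) with hs
  have hsm : ∀ k n, Measurable (s k n) := fun k n =>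
    (Real.measurable_log.comp ((continuous_volGrowth k).measurable.comp
      (measurable_cocycle hA hT.measurable n))).neg
  have hpos : ∀ k ≤ d, ∀ n, ∀ x ∈ S, 0 < volGrowth k (cocycle A T n x) := fun k hk n x hx =>
    volGrowth_pos hk (LinearMap.injective_iff_surjective.1 (cocycle_injective hx n))
  have hsup : ∀ k ≤ d, ∀ m n, ∀ x ∈ S, s k m x + s k n (T^[m] x) ≤ s k (m + n) x := by
    intro k hk m n x hx
    have h1 := hpos k hk m x hx
    have h2 := hpos k hk n _ (hST.iterate m hx)
    have h3 := hpos k hk (m + n) x hx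
    have h4 := volGrowth_comp_le k (cocycle A T n (T^[m] x)) (cocycle A T m x)
    rw [← cocycle_add] at h4
    have := Real.log_le_log h3 h4
    rw [Real.log_mul h2.ne' h1.ne'] at this
    simp only [hs]
    linarith
  have hs0 : ∀ k, ∀ x ∈ S, 0 ≤ s k 0 x := by
    intro k x _
    have h1 := volGrowth_le_norm_pow k (cocycle A T 0 x)
    have h2 : ‖cocycle A T 0 x‖ ≤ 1 := ContinuousLinearMap.norm_id_le
    have h3 := Real.log_nonpos (volGrowth_nonneg _ _)
      (h1.trans (pow_le_one₀ (norm_nonneg _) h2))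
    simp only [hs]
    linarith
  have hlogV : ∀ k x, Real.log (volGrowth k (A x)) ≤ k * Real.log C := by
    intro k x
    have h1 := (volGrowth_le_norm_pow k (A x)).trans
      (pow_le_pow_left₀ (norm_nonneg _) (hC x) k)
    rcases (volGrowth_nonneg k (A x)).eq_or_lt with h0 | h0
    · rw [← h0, Real.log_zero]
      have := Real.log_nonneg hC1
      positivity
    · rw [← Real.log_pow]
      exact Real.log_le_log h0 h1
  have hs1 : ∀ k, ∀ x ∈ S, -(k * Real.log C) ≤ s k 1 x := fun k x _ =>
    neg_le_neg (hlogV k x)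
  -- Superexponential collapse occurs in top degree: `-log |det|` is bounded below and not
  -- integrable, so its Birkhoff averages tend to infinity.
  have hex : ∃ k, k ≤ d ∧ ∀ α : ℝ, ∀ᵐ x ∂μ, ∀ᶠ n : ℕ in atTop, α * n ≤ s k n x := by
    refine ⟨d, le_rfl, fun α => ?_⟩
    have hni' : ¬ Integrable (s d 1) μ := by
      intro h
      apply hni
      refine h.neg.congr (Eventually.of_forall fun x => ?_)
      simp [hs, cocycle_one, hd, volGrowth_finrank]
    have := ae_eventually_lt_birkhoffSum_of_not_integrable hT (hsm d 1)
      (c := -(d * Real.log C)) (fun x => neg_le_neg (hlogV d x)) hni' α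
    filter_upwards [this, hSae] with x hx hxS
    filter_upwards [hx] with n hn
    refine hn.le.trans ?_
    clear hn hx
    induction n with
    | zero => simpa using hs0 d x hxS
    | succ n ih =>
      rw [birkhoffSum_succ]
      have := hsup d le_rfl n 1 x hxS
      linarith
  -- The least collapsing dimension is positive, since `0`-volumes are constantly `1`.
  obtain ⟨k, ⟨hkd, hkα⟩, hkmin⟩ : ∃ k, (k ≤ d ∧ ∀ α : ℝ, ∀ᵐ x ∂μ, ∀ᶠ n : ℕ in atTop,
      α * n ≤ s k n x) ∧ ∀ m < k, ¬ (m ≤ d ∧ ∀ α : ℝ, ∀ᵐ x ∂μ, ∀ᶠ n : ℕ in atTop,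
      α * n ≤ s m n x) := by
    classical
    exact ⟨Nat.find hex, Nat.find_spec hex, fun m hm => Nat.find_min hex hm⟩
  have hk0 : k ≠ 0 := by
    intro h0
    rw [h0] at hkα
    obtain ⟨x, hx⟩ := (hkα 1).exists
    obtain ⟨n, hn, hn1⟩ := (hx.and (eventually_ge_atTop 1)).exists
    simp only [hs, volGrowth_zero, Real.log_one, neg_zero, one_mul] at hn
    have : (1 : ℝ) ≤ n := by exact_mod_cast hn1
    linarith
  obtain ⟨j, hj⟩ := Nat.exists_eq_succ_of_ne_zero hk0
  have hjd : j ≤ d := by omega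
  -- By minimality `j`-volumes decay at most exponentially while `(j + 1)`-volumes collapse; that is
  -- the situation in which a bounded orbit exists.
  rcases superadditive_dichotomy hT (hsm j) hST hSae (hs0 j) (hsup j hjd) (hs1 j) with h | ⟨α, h⟩
  · exact hkmin j (by omega) ⟨hjd, h⟩
  have hkα' : ∀ᵐ x ∂μ, ∀ R : ℕ, ∀ᶠ n : ℕ in atTop, (R : ℝ) * n ≤ s k n x :=
    ae_all_iff.2 fun R => hkα R
  obtain ⟨x, hxS, hxe, hxj, hxk⟩ := (hSae.and (hexp.and (h.and hkα'))).exists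
  have hB := fun n v => norm_cocycle_succ_le hC T n x v
  have hV : ∀ᶠ n in atTop, Real.exp (-α) ^ n ≤ volGrowth j (cocycle A T n x) := by
    filter_upwards [hxj] with n hn
    rw [← Real.exp_nat_mul, ← Real.le_log_iff_exp_le (hpos j hjd n x hxS)]
    simp only [hs] at hn
    linarith
  have hW : ∀ ρ : ℝ, 0 < ρ → ∀ᶠ n in atTop, volGrowth (j + 1) (cocycle A T n x) ≤ ρ ^ n := by
    intro ρ hρ
    obtain ⟨R, hR⟩ := exists_nat_ge (-Real.log ρ)
    filter_upwards [hxk R] with n hn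
    have hp := hpos k hkd n x hxS
    rw [hj] at hn hp
    rw [← Real.log_le_log_iff hp (by positivity), Real.log_pow]
    simp only [hs, Nat.succ_eq_add_one] at hn ⊢
    have h1 : (0 : ℝ) ≤ n := n.cast_nonneg
    nlinarith
  obtain ⟨v, hv, hb⟩ := exists_bounded_orbit (E := E) (j := j) (by omega)
    hC1 (fun n => norm_cocycle_le hC hC1 T n x) hB (Real.exp_pos (-α)) hV hW
  exact hxe.not_bounded hv hb

/-- Over blocks of a suitable length `ℓ`, the cocycle expands all vectors by a definite amount, up
to Birkhoff sums of a function of small integral. -/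
lemma exists_block_expansion (hT : Ergodic T μ) (hA : Measurable A)
    (hexp : ∀ᵐ x ∂μ, GrowsExponentially A T x) {L : X → ℝ} (hLm : Measurable L)
    (hLi : Integrable L μ) (hL0 : ∀ x, 0 ≤ L x)
    (hL : ∀ᵐ x ∂μ, ∀ v, Real.exp (-L x) * ‖v‖ ≤ ‖A x v‖) (κ : ℝ) :
    ∃ ℓ : ℕ, 1 ≤ ℓ ∧ ∃ (p : X → ℝ) (b : ℝ), Measurable p ∧ Integrable p μ ∧ (∀ x, 0 ≤ p x) ∧
      ℓ * ∫ x, p x ∂μ + 1 < b ∧ ∀ᵐ x ∂μ, ∀ v,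
        Real.exp (b + κ - birkhoffSum T p ℓ x) * ‖v‖ ≤ ‖cocycle A T ℓ x v‖ := by
  obtain ⟨ε, hε, hrate⟩ := exists_uniform_rate hT hA hexp
  set G : ℕ → Set X := fun N => {x | ∀ v ∈ Metric.sphere (0 : E) 1, ∃ n ∈ Set.Ici 1 ∩ Set.Iic N,
    Real.exp (ε * n) < ‖cocycle A T n x v‖} with hG
  have hGm : ∀ N, MeasurableSet (G N) := fun N =>
    measurableSet_forall_sphere_exists (measurable_cocycle hA hT.measurable) _ _
  have hGmono : Monotone G := by
    intro a b hab x hx v hv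
    obtain ⟨n, ⟨hn1, hn2⟩, hn⟩ := hx v hv
    exact ⟨n, ⟨hn1, le_trans hn2 hab⟩, hn⟩
  have hfull : ∀ᵐ x ∂μ, ∃ N, x ∈ G N := by
    filter_upwards [hrate] with x hx
    rw [forall_ne_zero_iff_sphere (b := fun n => cocycle A T n x)] at hx
    -- At time `0` the threshold is the operator norm, which no unit vector exceeds; this excludes
    -- `n = 0`.
    obtain ⟨N, hN⟩ := exists_uniform_time (b := fun n => cocycle A T n x)
      (t := fun n => if 1 ≤ n then Real.exp (ε * n) else ‖cocycle A T n x‖) (fun v hv => by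
        obtain ⟨n, hn, h⟩ := hx v hv
        exact ⟨n, by rwa [if_pos (by exact hn)]⟩)
    refine ⟨N, fun v hv => ?_⟩
    obtain ⟨n, hn, h⟩ := hN v hv
    by_cases h1 : 1 ≤ n
    · exact ⟨n, ⟨h1, hn⟩, by rwa [if_pos h1] at h⟩
    · rw [if_neg h1] at h
      have := (cocycle A T n x).le_opNorm v
      rw [mem_sphere_zero_iff_norm.1 hv, mul_one] at this
      linarith
  set K : X → ℝ := fun x => L x + ε with hK
  have hKm : Measurable K := hLm.add_const _
  have hKi : Integrable K μ := hLi.add (integrable_const _)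
  have hK0 : ∀ x, 0 ≤ K x := fun x => by have := hL0 x; simp only [hK]; linarith
  obtain ⟨N, hN⟩ := ((tendsto_integral_compl_indicator hKi hGm hGmono hfull).eventually_lt_const
    (u := ε / 4) (by positivity)).exists
  -- truncation of `K`
  have hHm : ∀ R : ℕ, MeasurableSet {x | K x ≤ R} := fun R => measurableSet_le hKm measurable_const
  obtain ⟨R, hR⟩ := ((tendsto_integral_compl_indicator hKi hHm
    (fun a b hab x (hx : K x ≤ a) => hx.trans (by exact_mod_cast hab))
    (Eventually.of_forall fun x => exists_nat_ge (K x))).eventually_lt_const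
    (u := ε / 4) (by positivity)).exists
  -- The first term pays for the steps outside `G N`, the second for the excess of `K` over `R` in
  -- the terminal window. Each has integral below `ε / 4`.
  set p : X → ℝ := fun x => (G N)ᶜ.indicator K x + {x | K x ≤ R}ᶜ.indicator K x with hp
  have hp1 := hKi.indicator (hGm N).compl
  have hp2 := hKi.indicator (hHm R).compl
  have hpi : Integrable p μ := hp1.add hp2
  have hpint : ∫ x, p x ∂μ < ε / 2 := by
    rw [hp, integral_add hp1 hp2]; linarith
  -- The gain `ε * ℓ` loses at most half to `p`; the other half must exceed the fixed costs `N * R +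
  -- κ + 1`.
  obtain ⟨ℓ, hℓ⟩ := exists_nat_gt ((N * R + κ + 1) / (ε / 2))
  refine ⟨ℓ + 1, by omega, p, ε * (ℓ + 1 : ℕ) - N * R - κ, ?_, hpi, ?_, ?_, ?_⟩
  · exact (hKm.indicator (hGm N).compl).add (hKm.indicator (hHm R).compl)
  · intro x
    exact add_nonneg (Set.indicator_nonneg (fun y _ => hK0 y) x)
      (Set.indicator_nonneg (fun y _ => hK0 y) x)
  · rw [div_lt_iff₀ (by positivity)] at hℓ
    have h1 : ((ℓ + 1 : ℕ) : ℝ) * ∫ x, p x ∂μ ≤ (ℓ + 1 : ℕ) * (ε / 2) := by gcongr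
    push_cast at h1 ⊢
    nlinarith
  · have hinj := hexp.mono fun x hx => hx.injective
    filter_upwards [ae_forall_iterate hT.toMeasurePreserving (hL.and hinj)] with x hx v
    by_cases hv : v = 0
    · simp [hv]
    -- On the skew product the logarithmic growth of a vector is an additive process, so the greedy
    -- bound applies to each vector, with gain times allowed to depend on it.
    set F : X × E → X × E := fun y => (T y.1, A y.1 y.2) with hF
    have hFit : ∀ n y, F^[n] y = (T^[n] y.1, cocycle A T n y.1 y.2) := by
      intro n
      induction n with
      | zero => intro y; rfl
      | succ n ih => intro y; rw [Function.iterate_succ_apply, ih]; rfl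
    set S : Set (X × E) := {y | y.2 ≠ 0 ∧
      ∀ n, (∀ v, Real.exp (-L (T^[n] y.1)) * ‖v‖ ≤ ‖A (T^[n] y.1) v‖) ∧
        Function.Injective (A (T^[n] y.1))} with hS
    have hlow := superadditive_lower_bound (F := F)
      (s := fun n y => Real.log ‖cocycle A T n y.1 y.2‖ - Real.log ‖y.2‖) (S := S)
      (G := {y | y.1 ∈ G N}) (K := fun y => K y.1) (β := ε) (N := N)
      (fun y hy => ⟨fun h => hy.1 ((hy.2 0).2 (h.trans (map_zero _).symm)), fun n => hy.2 (n + 1)⟩)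
      (fun y _ => by simp [cocycle])
      (fun m n y _ => by
        rw [hFit, cocycle_add]
        simp)
      (fun y => hK0 y.1)
      (fun y hy => by
        have h1 := (hy.2 0).1 y.2
        have hy2 := norm_pos_iff.2 hy.1
        have h2 := Real.log_le_log (by positivity) h1
        rw [Real.log_mul (Real.exp_pos _).ne' hy2.ne', Real.log_exp] at h2
        simp only [hK, cocycle_one, Function.iterate_zero, id] at h2 ⊢
        linarith)
      (fun y hy hyG => by
        obtain ⟨n, ⟨hn1, hnN⟩, hn⟩ := (forall_ne_zero_iff_sphere
          (b := fun n => cocycle A T n y.1)).2 hyG y.2 hy.1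
        refine ⟨n, hn1, hnN, ?_⟩
        have hy2 := norm_pos_iff.2 hy.1
        have h2 := Real.log_le_log (by positivity) hn.le
        rw [Real.log_mul (Real.exp_pos _).ne' hy2.ne', Real.log_exp] at h2
        linarith)
      (ℓ + 1) (x, v) ⟨hv, fun n => hx n⟩
    have hvn := norm_pos_iff.2 hv
    have hcv : 0 < ‖cocycle A T (ℓ + 1) x v‖ := by
      rw [norm_pos_iff]
      exact fun h => hv (cocycle_injective (fun n => (hx n).2) _ (h.trans (map_zero _).symm))
    rw [← Real.log_le_log_iff (by positivity) hcv, Real.log_mul (Real.exp_pos _).ne' hvn.ne',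
      Real.log_exp]
    have hb1 : birkhoffSum F ({y : X × E | y.1 ∈ G N}ᶜ.indicator fun y => K y.1) (ℓ + 1) (x, v)
        = birkhoffSum T ((G N)ᶜ.indicator K) (ℓ + 1) x := by
      refine Finset.sum_congr rfl fun j _ => ?_
      rw [hFit]
      by_cases h : T^[j] x ∈ G N
      · rw [Set.indicator_of_notMem (by simpa using h), Set.indicator_of_notMem (by simpa using h)]
      · rw [Set.indicator_of_mem (by simpa using h), Set.indicator_of_mem (by simpa using h)]
    have hb2 : ∑ j ∈ Finset.Ico (ℓ + 1 - N) (ℓ + 1), K (F^[j] (x, v)).1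
        ≤ N * R + birkhoffSum T ({x | K x ≤ R}ᶜ.indicator K) (ℓ + 1) x := by
      have hle : ∀ y, K y ≤ R + {x | K x ≤ R}ᶜ.indicator K y := by
        intro y
        by_cases hy : K y ≤ R
        · rw [Set.indicator_of_notMem (by simpa using hy)]; simpa using hy
        · rw [Set.indicator_of_mem (by simpa using hy)]
          have : (0 : ℝ) ≤ R := R.cast_nonneg
          linarith
      calc ∑ j ∈ Finset.Ico (ℓ + 1 - N) (ℓ + 1), K (F^[j] (x, v)).1
          ≤ ∑ j ∈ Finset.Ico (ℓ + 1 - N) (ℓ + 1),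
              (R + {x | K x ≤ R}ᶜ.indicator K (T^[j] x)) := by
            refine Finset.sum_le_sum fun j _ => ?_
            rw [hFit]
            exact hle _
        _ = ((ℓ + 1 - (ℓ + 1 - N) : ℕ) : ℝ) * R + ∑ j ∈ Finset.Ico (ℓ + 1 - N) (ℓ + 1),
              {x | K x ≤ R}ᶜ.indicator K (T^[j] x) := by
            rw [Finset.sum_add_distrib, Finset.sum_const, Nat.card_Ico, nsmul_eq_mul]
        _ ≤ _ := by
            refine add_le_add ?_ ?_
            · refine mul_le_mul_of_nonneg_right ?_ R.cast_nonneg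
              exact_mod_cast (by omega : ℓ + 1 - (ℓ + 1 - N) ≤ N)
            · refine Finset.sum_le_sum_of_subset_of_nonneg ?_ fun j _ _ =>
                Set.indicator_nonneg (fun y _ => hK0 y) _
              rw [Finset.range_eq_Ico]
              exact Finset.Ico_subset_Ico (Nat.zero_le _) le_rfl
    have hb3 : birkhoffSum T p (ℓ + 1) x = birkhoffSum T ((G N)ᶜ.indicator K) (ℓ + 1) x
        + birkhoffSum T ({x | K x ≤ R}ᶜ.indicator K) (ℓ + 1) x := by
      simp only [birkhoffSum, hp, Finset.sum_add_distrib]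
    rw [hb1] at hlow
    simp only at hlow
    linarith

end Cocycle


/-! ### Lifting paths and constructing contracting inverse branches. -/

section InverseBranches

variable {M : Type*} [MetricSpace M]

/-- `Λ` bounds the lengths of the arcs of the path `γ` on `[0, 1]`. -/
structure ControlledPath (γ : ℝ → M) (Λ : ℝ → ℝ) : Prop where
  continuousOn : ContinuousOn Λ (Set.Icc 0 1)
  dist_le : ∀ a b, 0 ≤ a → a ≤ b → b ≤ 1 → dist (γ a) (γ b) ≤ Λ b - Λ a

lemma ControlledPath.mono {γ : ℝ → M} {Λ : ℝ → ℝ} (h : ControlledPath γ Λ) {a b : ℝ}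
    (ha : 0 ≤ a) (hab : a ≤ b) (hb : b ≤ 1) : Λ a ≤ Λ b :=
  sub_nonneg.1 (dist_nonneg.trans (h.dist_le a b ha hab hb))

lemma ControlledPath.continuousOn_path {γ : ℝ → M} {Λ : ℝ → ℝ} (h : ControlledPath γ Λ) :
    ContinuousOn γ (Set.Icc 0 1) := by
  intro a ha
  have h1 := h.continuousOn a ha
  rw [ContinuousWithinAt, tendsto_iff_dist_tendsto_zero] at h1 ⊢
  refine squeeze_zero' (Eventually.of_forall fun _ => dist_nonneg) ?_ h1
  filter_upwards [self_mem_nhdsWithin] with b hb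
  rw [Real.dist_eq]
  rcases le_total a b with hab | hab
  · rw [dist_comm]
    exact (h.dist_le a b ha.1 hab hb.2).trans (le_abs_self _)
  · rw [abs_sub_comm]
    exact (h.dist_le b a hb.1 hab ha.2).trans (le_abs_self _)

/-- Distances are realized, up to arbitrarily small errors, by the lengths of paths. -/
def HasNearGeodesics (M : Type*) [MetricSpace M] : Prop :=
  ∀ (p q : M) (ε : ℝ), 0 < ε → ∃ (γ : ℝ → M) (Λ : ℝ → ℝ), ControlledPath γ Λ ∧ γ 0 = p ∧ γ 1 = q ∧
    Λ 1 - Λ 0 ≤ dist p q + ε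

/-- `g` expands distances by the factor `κ` near `z`. -/
def ExpandsNear (g : M → M) (κ : ℝ) (z : M) : Prop :=
  ∃ O ∈ 𝓝 z, ∀ z₁ ∈ O, ∀ z₂ ∈ O, κ * dist z₁ z₂ ≤ dist (g z₁) (g z₂)

/-- The set of points near which `g` is a local homeomorphism. -/
def localHomeoSet (g : M → M) : Set M := {z | ∃ e : OpenPartialHomeomorph M M, z ∈ e.source ∧ g = e}

lemma isOpen_localHomeoSet (g : M → M) : IsOpen (localHomeoSet g) := by
  rw [isOpen_iff_mem_nhds]
  rintro z ⟨e, hz, he⟩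
  filter_upwards [e.open_source.mem_nhds hz] with z' hz'
  exact ⟨e, hz', he⟩

/-- Local sections of `g` over balls of radius `r`, contracting by the factor `κ`. -/
def HasContractingSection (g : M → M) (κ r : ℝ) (z : M) : Prop :=
  ∃ s : M → M, s (g z) = z ∧ (∀ q ∈ Metric.ball (g z) r, g (s q) = q) ∧
    ∀ q ∈ Metric.ball (g z) r, ∀ q' ∈ Metric.ball (g z) r, κ * dist (s q) (s q') ≤ dist q q'

lemma HasContractingSection.anti {g : M → M} {κ r r' : ℝ} {z : M} (hr : r' ≤ r)
    (h : HasContractingSection g κ r z) : HasContractingSection g κ r' z := by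
  obtain ⟨s, h1, h2, h3⟩ := h
  have hs := Metric.ball_subset_ball (x := g z) hr
  exact ⟨s, h1, fun q hq => h2 q (hs hq), fun q hq q' hq' => h3 q (hs hq) q' (hs hq')⟩

/-- A single local inverse serves all nearby points, at the price of halving the radius. -/
lemma eventually_hasContractingSection {g : M → M} {κ : ℝ} {z : M} (hz : z ∈ localHomeoSet g)
    (hexp : ExpandsNear g κ z) : ∃ r > 0, ∀ᶠ z' in 𝓝 z, HasContractingSection g κ r z' := by
  obtain ⟨e, hze, rfl⟩ := hz
  obtain ⟨O, hO, hexp⟩ := hexp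
  have hsymm : Tendsto e.symm (𝓝 (e z)) (𝓝 z) := by
    have := e.continuousAt_symm (e.map_source hze)
    rwa [ContinuousAt, e.left_inv hze] at this
  have hev : ∀ᶠ q in 𝓝 (e z), q ∈ e.target ∧ e.symm q ∈ O :=
    Filter.Eventually.and (e.open_target.mem_nhds (e.map_source hze)) (hsymm hO)
  obtain ⟨r, hr, hball⟩ := Metric.eventually_nhds_iff_ball.1 hev
  refine ⟨r / 2, half_pos hr, ?_⟩
  have hc : Tendsto e (𝓝 z) (𝓝 (e z)) := e.continuousAt hze
  filter_upwards [e.open_source.mem_nhds hze, hc (Metric.ball_mem_nhds _ (half_pos hr))]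
    with z' hz' hz'r
  have hsub : Metric.ball (e z') (r / 2) ⊆ Metric.ball (e z) r := by
    apply Metric.ball_subset_ball'
    have : dist (e z') (e z) < r / 2 := hz'r
    linarith
  refine ⟨e.symm, e.left_inv hz', fun q hq => e.right_inv (hball q (hsub hq)).1,
    fun q hq q' hq' => ?_⟩
  have := hexp _ (hball q (hsub hq)).2 _ (hball q' (hsub hq')).2
  rwa [e.right_inv (hball q (hsub hq)).1, e.right_inv (hball q' (hsub hq')).1] at this

lemma exists_uniform_contractingSection {g : M → M} {κ : ℝ} {K : Set M} (hK : IsCompact K)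
    (hloc : ∀ z ∈ K, z ∈ localHomeoSet g ∧ ExpandsNear g κ z) :
    ∃ r > 0, ∀ z ∈ K, HasContractingSection g κ r z := by
  refine hK.induction_on (p := fun K => ∃ r > 0, ∀ z ∈ K, HasContractingSection g κ r z)
    ⟨1, one_pos, by simp⟩ ?_ ?_ ?_
  · rintro s t hst ⟨r, hr, h⟩
    exact ⟨r, hr, fun z hz => h z (hst hz)⟩
  · rintro s t ⟨r, hr, h⟩ ⟨r', hr', h'⟩
    refine ⟨min r r', lt_min hr hr', ?_⟩
    rintro z (hz | hz)
    · exact (h z hz).anti (min_le_left _ _)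
    · exact (h' z hz).anti (min_le_right _ _)
  · intro z hz
    obtain ⟨r, hr, h⟩ := eventually_hasContractingSection (hloc z hz).1 (hloc z hz).2
    exact ⟨_, mem_nhdsWithin_of_mem_nhds h, r, hr, fun z' hz' => hz'⟩

/-- Lifting of paths through a map that is a local homeomorphism expanding by `κ` on a compact
ball. -/
lemma exists_path_lift {g : M → M} {κ t : ℝ} {y : M} (hκ : 0 < κ)
    (hcomp : IsCompact (Metric.closedBall y t))
    (hloc : ∀ z ∈ Metric.closedBall y t, z ∈ localHomeoSet g ∧ ExpandsNear g κ z)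
    {γ : ℝ → M} {Λ : ℝ → ℝ} (hγ : ControlledPath γ Λ) (h0 : γ 0 = g y)
    (ht : Λ 1 - Λ 0 ≤ κ * t) :
    ∃ σ : ℝ → M, σ 0 = y ∧ (∀ s ∈ Set.Icc (0 : ℝ) 1, g (σ s) = γ s) ∧
      ControlledPath σ (fun s => Λ s / κ) := by
  obtain ⟨r, hr, hsec⟩ := exists_uniform_contractingSection hcomp hloc
  have huc := isCompact_Icc.uniformContinuousOn_of_continuous hγ.continuousOn
  rw [Metric.uniformContinuousOn_iff] at huc
  obtain ⟨η, hη, huc⟩ := huc r hr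
  obtain ⟨n, hn⟩ := exists_nat_one_div_lt hη
  set N : ℕ := n + 1 with hN
  have hN0 : (0 : ℝ) < N := by positivity
  -- On each of the `N` pieces `Λ` varies by less than `r`, so the piece stays in the domain of one
  -- local section, and the lift is extended piece by piece.
  have hstep : ∀ k ≤ N, ∃ σ : ℝ → M, σ 0 = y ∧ (∀ s : ℝ, 0 ≤ s → s ≤ k / N → g (σ s) = γ s) ∧
      ∀ a b : ℝ, 0 ≤ a → a ≤ b → b ≤ k / N → κ * dist (σ a) (σ b) ≤ Λ b - Λ a := by
    intro k
    induction k with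
    | zero =>
      intro _
      refine ⟨fun _ => y, rfl, fun s hs0 hs => ?_, fun a b ha hab hb => ?_⟩
      · have : s = 0 := le_antisymm (by simpa using hs) hs0
        rw [this, h0]
      · have hb0 : b = 0 := le_antisymm (by simpa using hb) (ha.trans hab)
        have ha0 : a = 0 := le_antisymm (by simpa [hb0] using hab) ha
        simp [ha0, hb0]
    | succ k ih =>
      intro hk
      obtain ⟨σ, hσ0, hσg, hσd⟩ := ih (by omega)
      set τ : ℝ := k / N with hτ
      have hτ0 : 0 ≤ τ := by positivity
      have hτ1 : τ ≤ 1 := by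
        rw [hτ, div_le_one hN0]; exact_mod_cast (by omega : k ≤ N)
      have hτ' : ((k + 1 : ℕ) : ℝ) / N = τ + 1 / N := by rw [hτ]; push_cast; ring
      have hτ'1 : τ + 1 / N ≤ 1 := by
        rw [← hτ', div_le_one hN0]; exact_mod_cast hk
      -- The length of the lift built so far is at most `(Λ 1 - Λ 0) / κ ≤ t`, so the lift cannot
      -- leave the ball where `g` is controlled.
      have hmem : σ τ ∈ Metric.closedBall y t := by
        have h1 := hσd 0 τ le_rfl hτ0 le_rfl
        rw [hσ0] at h1
        have h2 := hγ.mono hτ0 hτ1 le_rfl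
        rw [Metric.mem_closedBall, dist_comm]
        exact le_of_mul_le_mul_left (by linarith) hκ
      obtain ⟨sec, hs1, hs2, hs3⟩ := hsec _ hmem
      have hgτ : g (σ τ) = γ τ := hσg τ hτ0 le_rfl
      have hnear : ∀ s, τ ≤ s → s ≤ τ + 1 / N → γ s ∈ Metric.ball (g (σ τ)) r := by
        intro s hs hs'
        have h1 : dist s τ < η := by
          rw [Real.dist_eq, abs_of_nonneg (by linarith)]
          have : (1 : ℝ) / N < η := by simpa [hN] using hn
          linarith
        have h2 := huc s ⟨by linarith, by linarith⟩ τ ⟨hτ0, hτ1⟩ h1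
        rw [hgτ, Metric.mem_ball, dist_comm]
        refine (hγ.dist_le τ s hτ0 hs (by linarith)).trans_lt ?_
        rw [Real.dist_eq] at h2
        exact (le_abs_self _).trans_lt h2
      refine ⟨fun s => if s ≤ τ then σ s else sec (γ s), by simp [hτ0, hσ0], fun s hs0 hs => ?_,
        fun a b ha hab hb => ?_⟩
      · rw [hτ'] at hs
        by_cases h : s ≤ τ
        · simp only [h, if_true]; exact hσg s hs0 h
        · simp only [h, if_false]
          exact hs2 _ (hnear s (le_of_not_ge h) hs)
      · rw [hτ'] at hb
        have hright : ∀ a b, τ ≤ a → a ≤ b → b ≤ τ + 1 / N →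
            κ * dist (sec (γ a)) (sec (γ b)) ≤ Λ b - Λ a := fun a b ha hab hb =>
          (hs3 _ (hnear a ha (hab.trans hb)) _ (hnear b (ha.trans hab) hb)).trans
            (hγ.dist_le a b (hτ0.trans ha) hab (hb.trans hτ'1))
        by_cases hbτ : b ≤ τ
        · simp only [hab.trans hbτ, hbτ, if_true]
          exact hσd a b ha hab hbτ
        · have hbτ' := le_of_not_ge hbτ
          by_cases haτ : a ≤ τ
          · simp only [haτ, hbτ, if_true, if_false]
            have h1 := hσd a τ ha haτ le_rfl
            have h2 := hright τ b le_rfl hbτ' hb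
            rw [← hgτ, hs1] at h2
            have h3 := dist_triangle (σ a) (σ τ) (sec (γ b))
            nlinarith
          · simp only [haτ, hbτ, if_false]
            exact hright a b (le_of_not_ge haτ) hab hb
  obtain ⟨σ, hσ0, hσg, hσd⟩ := hstep N le_rfl
  rw [div_self hN0.ne'] at hσg hσd
  refine ⟨σ, hσ0, fun s hs => hσg s hs.1 hs.2, hγ.continuousOn.div_const κ, fun a b ha hab hb => ?_⟩
  rw [← sub_div, le_div_iff₀ hκ, mul_comm]
  exact hσd a b ha hab hb

/-- The product of the expansion factors between times `k` and `n`. -/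
def expansionProd (κ : ℕ → ℝ) (k n : ℕ) : ℝ := ∏ j ∈ Finset.Ico k n, κ j

lemma expansionProd_pos {κ : ℕ → ℝ} (hκ : ∀ k, 0 < κ k) (k n : ℕ) : 0 < expansionProd κ k n :=
  Finset.prod_pos fun j _ => hκ j

lemma expansionProd_self (κ : ℕ → ℝ) (n : ℕ) : expansionProd κ n n = 1 := by
  simp [expansionProd]

lemma expansionProd_succ_right (κ : ℕ → ℝ) {k n : ℕ} (h : k ≤ n) :
    expansionProd κ k (n + 1) = expansionProd κ k n * κ n :=
  Finset.prod_Ico_succ_top h κ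

lemma expansionProd_succ_left (κ : ℕ → ℝ) {k n : ℕ} (h : k < n) :
    expansionProd κ k n = κ k * expansionProd κ (k + 1) n :=
  Finset.prod_eq_prod_Ico_succ_bot h κ

/-- Lifting of paths through iterates. -/
lemma exists_path_lift_iterate {g : M → M} {κ t : ℕ → ℝ} (hκ : ∀ k, 0 < κ k) {x : M} (n : ℕ)
    (hcomp : ∀ k < n, IsCompact (Metric.closedBall (g^[k] x) (t k)))
    (hloc : ∀ k < n, ∀ z ∈ Metric.closedBall (g^[k] x) (t k),
      z ∈ localHomeoSet g ∧ ExpandsNear g (κ k) z)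
    {γ : ℝ → M} {Λ : ℝ → ℝ} (hγ : ControlledPath γ Λ) (h0 : γ 0 = g^[n] x)
    (ht : ∀ k < n, Λ 1 - Λ 0 ≤ t k * expansionProd κ k n) :
    ∃ σ : ℝ → M, σ 0 = x ∧ (∀ s ∈ Set.Icc (0 : ℝ) 1, g^[n] (σ s) = γ s) ∧
      ∀ k ≤ n, ControlledPath (fun s => g^[k] (σ s)) (fun s => Λ s / expansionProd κ k n) := by
  induction n generalizing γ Λ with
  | zero =>
    refine ⟨γ, h0, fun s _ => rfl, fun k hk => ?_⟩
    obtain rfl : k = 0 := by omega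
    simpa [expansionProd] using hγ
  | succ n ih =>
    -- The last map is undone first; the lifted path is shorter by the factor `κ n`, which is what
    -- the hypothesis at earlier times requires.
    obtain ⟨σ', hσ'0, hσ'g, hσ'c⟩ := exists_path_lift (hκ n) (hcomp n (by omega))
      (hloc n (by omega)) hγ (by rw [h0, Function.iterate_succ_apply'])
      (by
        have := ht n (by omega)
        rw [expansionProd_succ_right κ le_rfl, expansionProd_self, one_mul] at this
        linarith)
    obtain ⟨σ, hσ0, hσg, hσc⟩ := ih (fun k hk => hcomp k (by omega))
      (fun k hk => hloc k (by omega)) hσ'c hσ'0 (fun k hk => by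
        have := ht k (by omega)
        rw [expansionProd_succ_right κ hk.le] at this
        rw [← sub_div, div_le_iff₀ (hκ n)]
        linarith)
    have hsucc : ∀ s ∈ Set.Icc (0 : ℝ) 1, g^[n + 1] (σ s) = γ s := fun s hs => by
      rw [Function.iterate_succ_apply', hσg s hs, hσ'g s hs]
    refine ⟨σ, hσ0, hsucc, fun k hk => ?_⟩
    rcases Nat.lt_or_ge n k with hnk | hkn
    · obtain rfl : k = n + 1 := by omega
      rw [expansionProd_self]
      refine ⟨by simpa using hγ.continuousOn, fun a b ha hab hb => ?_⟩
      simp only [div_one]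
      rw [hsucc a ⟨ha, hab.trans hb⟩, hsucc b ⟨ha.trans hab, hb⟩]
      exact hγ.dist_le a b ha hab hb
    · have h := hσc k hkn
      have e : expansionProd κ k (n + 1) = κ n * expansionProd κ k n := by
        rw [expansionProd_succ_right κ hkn, mul_comm]
      simp only [e]
      simp only [div_div] at h
      exact h

/-- A continuous path whose image under an expanding map is controlled is itself controlled. -/
lemma ControlledPath.of_expandsNear {g : M → M} {κ : ℝ} (hκ : 0 < κ) {σ : ℝ → M} {Λ : ℝ → ℝ}
    (hσ : ContinuousOn σ (Set.Icc 0 1)) (hg : ControlledPath (fun s => g (σ s)) Λ)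
    (hexp : ∀ s ∈ Set.Icc (0 : ℝ) 1, ExpandsNear g κ (σ s)) :
    ControlledPath σ (fun s => Λ s / κ) := by
  refine ⟨hg.continuousOn.div_const κ, fun a b ha hab hb => ?_⟩
  have hsub : Set.Icc a 1 ⊆ Set.Icc (0 : ℝ) 1 := Set.Icc_subset_Icc_left ha
  have hclosed : IsClosed ({s | dist (σ a) (σ s) ≤ Λ s / κ - Λ a / κ} ∩ Set.Icc a 1) := by
    have h1 : ContinuousOn (fun s => dist (σ a) (σ s)) (Set.Icc a 1) :=
      (continuous_const.dist continuous_id).comp_continuousOn (hσ.mono hsub)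
    have h2 : ContinuousOn (fun s => Λ s / κ - Λ a / κ) (Set.Icc a 1) :=
      ((hg.continuousOn.mono hsub).div_const κ).sub continuousOn_const
    have := isClosed_Icc.isClosed_le h1 h2
    convert this using 1
    ext s
    exact and_comm
  -- Continuous induction: the estimate is closed in the parameter, and local expansion pushes it
  -- slightly to the right.
  refine hclosed.Icc_subset_of_forall_exists_gt (by simp) ?_ ⟨hab, hb⟩
  rintro s ⟨hs, hs1, hs2⟩ c (hc : s < c)
  obtain ⟨O, hO, hexp⟩ := hexp s ⟨ha.trans hs1, hs2.le⟩
  have hev : ∀ᶠ u in 𝓝[Set.Icc 0 1] s, σ u ∈ O := hσ s ⟨ha.trans hs1, hs2.le⟩ hO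
  have hev' : ∀ᶠ u in 𝓝[>] s, σ u ∈ O ∧ u < c ∧ u < 1 := by
    have h1 : ∀ᶠ u in 𝓝[Set.Ioo s 1] s, σ u ∈ O :=
      nhdsWithin_mono s (fun u (hu : u ∈ Set.Ioo s 1) =>
        (⟨(ha.trans hs1).trans hu.1.le, hu.2.le⟩ : u ∈ Set.Icc (0 : ℝ) 1)) hev
    rw [nhdsWithin_Ioo_eq_nhdsGT hs2] at h1
    exact h1.and (mem_nhdsWithin_of_mem_nhds
      (Filter.inter_mem (Iio_mem_nhds hc) (Iio_mem_nhds hs2)))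
  obtain ⟨u, ⟨huO, huc, hu1⟩, hus⟩ := (hev'.and self_mem_nhdsWithin).exists
  have hus' : s < u := hus
  refine ⟨u, ?_, hus', huc.le⟩
  have h1 := hexp _ (mem_of_mem_nhds hO) _ huO
  have h2 := hg.dist_le s u (ha.trans hs1) hus'.le hu1.le
  have h3 : dist (σ s) (σ u) ≤ Λ u / κ - Λ s / κ := by
    rw [← sub_div, le_div_iff₀ hκ, mul_comm]
    exact h1.trans h2
  have h4 : dist (σ a) (σ s) ≤ Λ s / κ - Λ a / κ := hs
  have h5 := dist_triangle (σ a) (σ s) (σ u)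
  change dist (σ a) (σ u) ≤ _
  linarith

/-- The ball of radius `r` around `p` is contracted to `p` along paths of length at most `K` times
the distance to `p`. -/
def HasRadialContraction (p : M) (r K : ℝ) : Prop :=
  ∃ H : unitInterval × Metric.ball p r → M, Continuous H ∧ (∀ q, H (0, q) = p) ∧
    (∀ q, H (1, q) = q) ∧ ∀ (q : Metric.ball p r) (a b : unitInterval),
      dist (H (a, q)) (H (b, q)) ≤ K * dist p q * |(b : ℝ) - a|

lemma isOpen_forall_iterate_mem {g : M → M} (hg : Continuous g) {O : Set M} (hO : IsOpen O)
    (n : ℕ) : IsOpen {z | ∀ k < n, g^[k] z ∈ O} := by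
  have : {z | ∀ k < n, g^[k] z ∈ O} = ⋂ k ∈ Finset.range n, g^[k] ⁻¹' O := by
    ext z; simp
  rw [this]
  exact isOpen_biInter_finset fun k _ => hO.preimage (hg.iterate k)

lemma isLocalHomeomorphOn_iterate {g : M → M} (n : ℕ) :
    IsLocalHomeomorphOn g^[n] {z | ∀ k < n, g^[k] z ∈ localHomeoSet g} := by
  induction n with
  | zero => exact (Homeomorph.refl M).isLocalHomeomorph.isLocalHomeomorphOn
  | succ n ih =>
    rw [Function.iterate_succ']
    exact IsLocalHomeomorphOn.comp (t := localHomeoSet g) (fun z hz => hz)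
      (ih.mono fun z hz k hk => hz k (by omega)) fun z hz => hz n (by omega)

/-- An orbit segment along which `g` expands on balls that are not too small compared with the
accumulated expansion has an inverse branch on a ball, which contracts. -/
theorem isHyperbolicTime_of_expansion (hgeo : HasNearGeodesics M) {g : M → M} (hg : Continuous g)
    {κ t : ℕ → ℝ} (hκ : ∀ k, 0 < κ k) {x : M} {n : ℕ}
    (hcomp : ∀ k < n, IsCompact (Metric.closedBall (g^[k] x) (t k)))
    (hloc : ∀ k < n, ∀ z ∈ Metric.closedBall (g^[k] x) (t k),
      z ∈ localHomeoSet g ∧ ExpandsNear g (κ k) z)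
    {δ K : ℝ} (hδ : 0 < δ) (hK : 0 ≤ K) (hrad : HasRadialContraction (g^[n] x) (4 * δ) K)
    (ht : ∀ k < n, K * (4 * δ) ≤ t k * expansionProd κ k n) {c : ℝ}
    (hc : ∀ k ≤ n, Real.exp (2 * c * (n - k)) ≤ expansionProd κ k n) :
    IsHyperbolicTime c δ g n x := by
  set p := g^[n] x with hp
  obtain ⟨H, hHc, hH0, hH1, hHd⟩ := hrad
  set U : Set M := {z | ∀ k < n, g^[k] z ∈ localHomeoSet g} with hU
  have hUo : IsOpen U := isOpen_forall_iterate_mem hg (isOpen_localHomeoSet g) n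
  have hhomeo : IsLocalHomeomorph (fun z : U => g^[n] z) := by
    rw [isLocalHomeomorph_iff_isLocalHomeomorphOn_univ]
    exact IsLocalHomeomorphOn.comp (isLocalHomeomorphOn_iterate n)
      hUo.isOpenEmbedding_subtypeVal.isLocalHomeomorph.isLocalHomeomorphOn fun z _ => z.2
  have hctrl : ∀ q : Metric.ball p (4 * δ), ControlledPath
      (fun s => H (Set.projIcc 0 1 zero_le_one s, q)) (fun s => K * dist p q * s) := by
    intro q
    refine ⟨by fun_prop, fun a b ha hab hb => ?_⟩
    have h := hHd q (Set.projIcc 0 1 zero_le_one a) (Set.projIcc 0 1 zero_le_one b)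
    rw [Set.projIcc_of_mem zero_le_one ⟨ha, hab.trans hb⟩,
      Set.projIcc_of_mem zero_le_one ⟨ha.trans hab, hb⟩, abs_of_nonneg (sub_nonneg.2 hab)] at h
    rw [Set.projIcc_of_mem zero_le_one ⟨ha, hab.trans hb⟩,
      Set.projIcc_of_mem zero_le_one ⟨ha.trans hab, hb⟩]
    linarith
  have hlift := fun q : Metric.ball p (4 * δ) =>
    exists_path_lift_iterate hκ n hcomp hloc (hctrl q) (by simp [hH0, hp]) (fun k hk => by
      refine le_trans ?_ (ht k hk)
      have h1 : dist p q ≤ 4 * δ := by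
        rw [dist_comm]; exact (Metric.mem_ball.1 q.2).le
      have := mul_le_mul_of_nonneg_left h1 hK
      linarith)
  choose σ hσ0 hσg hσc using hlift
  have hσball : ∀ q, ∀ s ∈ Set.Icc (0 : ℝ) 1, ∀ k < n,
      g^[k] (σ q s) ∈ Metric.closedBall (g^[k] x) (t k) := by
    intro q s hs k hk
    have h1 := (hσc q k hk.le).dist_le 0 s le_rfl hs.1 hs.2
    have hP := expansionProd_pos hκ k n
    rw [Metric.mem_closedBall, dist_comm]
    simp only [hσ0] at h1
    refine h1.trans ?_
    rw [← sub_div, div_le_iff₀ hP]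
    refine le_trans ?_ (ht k hk)
    have h2 : dist p q ≤ 4 * δ := by
      rw [dist_comm]; exact (Metric.mem_ball.1 q.2).le
    have h3 : 0 ≤ K * dist p q := by positivity
    have h4 := mul_le_mul_of_nonneg_left h2 hK
    have h5 := mul_le_of_le_one_right h3 hs.2
    linarith
  have hσU : ∀ q, ∀ s ∈ Set.Icc (0 : ℝ) 1, σ q s ∈ U := fun q s hs k hk =>
    (hloc k hk _ (hσball q s hs k hk)).1
  -- the family of lifts is jointly continuous
  have hσcont : ∀ q, ContinuousOn (σ q) (Set.Icc 0 1) := fun q =>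
    (hσc q 0 (Nat.zero_le _)).continuousOn_path
  let Γ : unitInterval × Metric.ball p (4 * δ) → U := fun z => ⟨σ z.2 z.1, hσU z.2 z.1 z.1.2⟩
  -- Each lift is continuous in time and all start at `x`; for a local homeomorphism with separated
  -- fibres this forces joint continuity of the lifted homotopy.
  have hΓ : Continuous Γ := by
    refine hhomeo.continuous_lift (T2Space.isSeparatedMap _) ⟨H, hHc⟩ ?_ ?_ ?_
    · ext ⟨s, q⟩
      change g^[n] (σ q s) = H (s, q)
      rw [hσg q s s.2, Set.projIcc_val]
    · have hx : ∀ q : Metric.ball p (4 * δ), x ∈ U := fun q => by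
        have := hσU q 0 ⟨le_rfl, zero_le_one⟩
        rwa [hσ0] at this
      by_cases hne : Nonempty (Metric.ball p (4 * δ))
      · exact (continuous_const (y := (⟨x, hx hne.some⟩ : U))).congr fun q =>
          Subtype.ext (hσ0 q).symm
      · rw [not_nonempty_iff] at hne
        exact continuous_of_const fun q => hne.elim q
    · intro q
      refine Continuous.subtype_mk ?_ _
      exact (hσcont q).comp_continuous continuous_subtype_val fun s => s.2
  let ι : Metric.ball p (4 * δ) → U := fun q => Γ (1, q)
  have hι : Continuous ι := hΓ.comp (Continuous.prodMk_right 1)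
  have hgι : ∀ q, g^[n] (ι q) = q := fun q => by
    change g^[n] (σ q 1) = q
    rw [hσg q 1 ⟨zero_le_one, le_rfl⟩]
    simp [hH1]
  -- Composed with the local homeomorphism `g^[n]`, the branch becomes the inclusion of a ball, so
  -- it is an open embedding.
  have hιopen : IsOpenMap ι := by
    refine (hhomeo.isOpenEmbedding_of_comp (f := ι) ?_ hι).isOpenMap
    have : (fun z : U => g^[n] z) ∘ ι = Subtype.val := funext hgι
    rw [this]
    exact Metric.isOpen_ball.isOpenEmbedding_subtypeVal
  have hιball : ∀ q, ∀ k < n, g^[k] (ι q) ∈ Metric.closedBall (g^[k] x) (t k) := fun q k hk =>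
    hσball q 1 ⟨zero_le_one, le_rfl⟩ k hk
  have hp4 : p ∈ Metric.ball p (4 * δ) := Metric.mem_ball_self (by linarith)
  have hιp : (ι ⟨p, hp4⟩ : M) = x := by
    have h := (hσc ⟨p, hp4⟩ 0 (Nat.zero_le _)).dist_le 0 1 le_rfl zero_le_one le_rfl
    simp only [dist_self, hσ0, Function.iterate_zero, id] at h
    change σ ⟨p, hp4⟩ 1 = x
    rw [eq_comm, ← dist_le_zero]
    simpa using h
  have hsub : Metric.ball p δ ⊆ Metric.ball p (4 * δ) := Metric.ball_subset_ball (by linarith)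
  -- contraction along the inverse branch
  have hcontr : ∀ q₁ q₂ : Metric.ball p (4 * δ), (q₁ : M) ∈ Metric.ball p δ →
      (q₂ : M) ∈ Metric.ball p δ → ∀ k ≤ n,
      expansionProd κ k n * dist (g^[k] (ι q₁)) (g^[k] (ι q₂)) ≤ dist (q₁ : M) q₂ := by
    intro q₁ q₂ h₁ h₂ k hk
    refine le_of_forall_pos_le_add fun ε' hε' => ?_
    set ε := min ε' δ with hε
    have hε0 : 0 < ε := lt_min hε' hδ
    obtain ⟨γ, Λ, hγ, hγ0, hγ1, hΛ⟩ := hgeo q₁ q₂ ε hε0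
    -- Two points of the `δ`-ball are less than `2 * δ` apart and the path exceeds their distance by
    -- at most `δ`; so it stays within `4 * δ` of `p`. This is why the branch is built on the larger
    -- ball.
    have hγball : Set.MapsTo γ (Set.Icc 0 1) (Metric.ball p (4 * δ)) := by
      intro s hs
      have e1 := hγ.dist_le 0 s le_rfl hs.1 hs.2
      have e2 := hγ.mono hs.1 hs.2 le_rfl
      have e3 := dist_triangle (q₁ : M) p q₂
      have e4 := dist_triangle (γ s) q₁ p
      have e5 : ε ≤ δ := min_le_right _ _
      rw [Metric.mem_ball] at h₁ h₂ ⊢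
      rw [hγ0, dist_comm] at e1
      rw [dist_comm p] at e3
      linarith
    classical
    let ι' : M → M := fun q => if h : q ∈ Metric.ball p (4 * δ) then ι ⟨q, h⟩ else x
    have hι'eq : ∀ q : Metric.ball p (4 * δ), ι' q = ι q := fun q => dif_pos q.2
    have hι' : ContinuousOn ι' (Metric.ball p (4 * δ)) := by
      rw [continuousOn_iff_continuous_domRestrict]
      exact (continuous_subtype_val.comp hι).congr fun q => (hι'eq q).symm
    have hζ : ContinuousOn (fun s => ι' (γ s)) (Set.Icc 0 1) :=
      hι'.comp hγ.continuousOn_path hγball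
    have hζeq : ∀ s (hs : s ∈ Set.Icc (0 : ℝ) 1), ι' (γ s) = ι ⟨γ s, hγball hs⟩ :=
      fun s hs => hι'eq ⟨γ s, hγball hs⟩
    -- Descending from time `n` to time `k`, each step divides the controlled length by one
    -- expansion factor.
    have hind : ∀ m k, k + m = n →
        ControlledPath (fun s => g^[k] (ι' (γ s))) (fun s => Λ s / expansionProd κ k n) := by
      intro m
      induction m with
      | zero =>
        rintro k rfl
        rw [Nat.add_zero, expansionProd_self]
        refine ⟨by simpa using hγ.continuousOn, fun a b ha hab hb => ?_⟩
        have e : ∀ s ∈ Set.Icc (0 : ℝ) 1, g^[k] (ι' (γ s)) = γ s := fun s hs => by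
          rw [hζeq s hs]; exact hgι _
        simp only [div_one]
        rw [e a ⟨ha, hab.trans hb⟩, e b ⟨ha.trans hab, hb⟩]
        exact hγ.dist_le a b ha hab hb
      | succ m ih =>
        intro k hkm
        have h := ih (k + 1) (by omega)
        simp only [Function.iterate_succ_apply'] at h
        have : ControlledPath (fun s => g^[k] (ι' (γ s))) _ :=
          ControlledPath.of_expandsNear (hκ k) ((hg.iterate k).comp_continuousOn hζ) h
          (fun s hs => (hloc k (by omega) _ (by
            rw [hζeq s hs]
            exact hιball _ k (by omega))).2)
        rw [expansionProd_succ_left κ (by omega : k < n)]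
        simpa only [div_div, mul_comm] using this
    have h := (hind (n - k) k (by omega)).dist_le 0 1 le_rfl zero_le_one le_rfl
    simp only [hγ0, hγ1, hι'eq] at h
    rw [← sub_div, le_div_iff₀ (expansionProd_pos hκ k n)] at h
    have : ε ≤ ε' := min_le_left _ _
    linarith
  refine ⟨Subtype.val '' (ι '' {q | (q : M) ∈ Metric.ball p δ}), ?_, ⟨?_, ?_⟩, ?_⟩
  · refine (hUo.isOpenMap_subtype_val _ (hιopen _ ?_)).mem_nhds ?_
    · exact Metric.isOpen_ball.preimage continuous_subtype_val
    · exact ⟨_, ⟨⟨p, hp4⟩, Metric.mem_ball_self hδ, rfl⟩, hιp⟩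
  · have hmaps : ∀ z ∈ Subtype.val '' (ι '' {q | (q : M) ∈ Metric.ball p δ}),
        g^[n] z ∈ Metric.ball p δ := by
      rintro _ ⟨_, ⟨q, hq, rfl⟩, rfl⟩
      rw [hgι]
      exact hq
    exact
      { toFun := fun z => ⟨g^[n] z, hmaps z z.2⟩
        invFun := fun q => ⟨ι ⟨q, hsub q.2⟩, ⟨_, ⟨⟨q, hsub q.2⟩, q.2, rfl⟩, rfl⟩⟩
        left_inv := by
          rintro ⟨_, ⟨_, ⟨q, hq, rfl⟩, rfl⟩⟩
          apply Subtype.ext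
          simp only [hgι]
        right_inv := fun q => Subtype.ext (hgι _)
        continuous_toFun := ((hg.iterate n).comp continuous_subtype_val).subtype_mk _
        continuous_invFun := by
          refine Continuous.subtype_mk ?_ _
          exact continuous_subtype_val.comp
            (hι.comp (continuous_subtype_val.subtype_mk fun q => hsub q.2)) }
  · exact fun _ => rfl
  · rintro _ ⟨_, ⟨q₁, h₁, rfl⟩, rfl⟩ _ ⟨_, ⟨q₂, h₂, rfl⟩, rfl⟩ k hk
    rw [hgι, hgι]
    have h := hcontr q₁ q₂ h₁ h₂ k hk
    have h' := mul_le_mul_of_nonneg_right (hc k hk)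
      (dist_nonneg (x := g^[k] (ι q₁ : M)) (y := g^[k] (ι q₂ : M)))
    have e : Real.exp (-2 * c * ((n : ℝ) - k)) = (Real.exp (2 * c * (n - k)))⁻¹ := by
      rw [← Real.exp_neg]; ring_nf
    rw [e, ← div_eq_inv_mul, le_div_iff₀ (Real.exp_pos _), mul_comm]
    exact h'.trans h

end InverseBranches


/-! ### Pliss times and times spoiled by small radii. -/

section Counting

open Classical in
/-- The times `1 ≤ m ≤ N` at which all the averages of `a` over the windows ending at `m` are at
least `c`. -/
noncomputable def plissTimes (a : ℕ → ℝ) (c : ℝ) (N : ℕ) : Finset ℕ :=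
  {m ∈ Finset.Icc 1 N | ∀ k < m, c * (m - k) ≤ ∑ j ∈ Finset.Ico k m, a j}

open Classical in
lemma mem_plissTimes {a : ℕ → ℝ} {c : ℝ} {N m : ℕ} : m ∈ plissTimes a c N ↔
    (1 ≤ m ∧ m ≤ N) ∧ ∀ k < m, c * (m - k) ≤ ∑ j ∈ Finset.Ico k m, a j := by
  simp [plissTimes]

/-- Pliss times are the times at which the partial sums of `a j - c` reach a weak record. Each
record raises the maximum by at most `A - c`, and other times do not raise it. -/
lemma sum_range_sub_le_card_plissTimes {a : ℕ → ℝ} {c A : ℝ} (ha : ∀ j, a j ≤ A) (hcA : c ≤ A)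
    (N : ℕ) : ∀ m ≤ N, ∑ j ∈ Finset.range m, a j - c * m ≤ (A - c) * (plissTimes a c N).card := by
  induction N with
  | zero =>
    intro m hm
    obtain rfl : m = 0 := by omega
    simp only [Finset.range_zero, Finset.sum_empty, Nat.cast_zero, mul_zero, sub_zero]
    exact mul_nonneg (by linarith) (Nat.cast_nonneg _)
  | succ N ih =>
    have hsub : plissTimes a c N ⊆ plissTimes a c (N + 1) := by
      intro m hm
      rw [mem_plissTimes] at hm ⊢
      exact ⟨⟨hm.1.1, by omega⟩, hm.2⟩
    have hmono : (A - c) * (plissTimes a c N).card ≤ (A - c) * (plissTimes a c (N + 1)).card :=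
      mul_le_mul_of_nonneg_left (Nat.cast_le.2 (Finset.card_le_card hsub)) (by linarith)
    intro m hm
    rcases Nat.lt_or_ge m (N + 1) with h | h
    · exact (ih m (by omega)).trans hmono
    obtain rfl : m = N + 1 := by omega
    by_cases hrec : N + 1 ∈ plissTimes a c (N + 1)
    · have hnot : N + 1 ∉ plissTimes a c N := fun h => by
        rw [mem_plissTimes] at h; omega
      have hcard : (plissTimes a c N).card + 1 ≤ (plissTimes a c (N + 1)).card := by
        rw [← Finset.card_insert_of_notMem hnot]
        exact Finset.card_le_card (Finset.insert_subset hrec hsub)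
      have hcard' : ((plissTimes a c N).card : ℝ) + 1 ≤ (plissTimes a c (N + 1)).card := by
        exact_mod_cast hcard
      have h1 := ih N le_rfl
      have h2 := mul_le_mul_of_nonneg_left hcard' (sub_nonneg.2 hcA)
      rw [Finset.sum_range_succ]
      push_cast
      linarith [ha N]
    · rw [mem_plissTimes] at hrec
      push Not at hrec
      obtain ⟨k, hk, hlt⟩ := hrec ⟨by omega, le_rfl⟩
      have h1 := ih k (by omega)
      rw [Finset.sum_Ico_eq_sub _ hk.le] at hlt
      linarith

/-- Pliss' lemma. -/
lemma mul_le_card_plissTimes {a : ℕ → ℝ} {c c' A : ℝ} (ha : ∀ j, a j ≤ A) (hcA : c < A) {N : ℕ}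
    (hsum : c' * N ≤ ∑ j ∈ Finset.range N, a j) :
    (c' - c) / (A - c) * N ≤ (plissTimes a c N).card := by
  have := sum_range_sub_le_card_plissTimes ha hcA.le N N le_rfl
  rw [div_mul_eq_mul_div, div_le_iff₀ (by linarith)]
  linarith

open Classical in
/-- The times `1 ≤ m ≤ N` for which some earlier value `H k` is large compared with `m - k`. -/
noncomputable def shadowTimes (H : ℕ → ℝ) (c h : ℝ) (N : ℕ) : Finset ℕ :=
  {m ∈ Finset.Icc 1 N | ∃ k < m, h + c * (m - k) < H k}

open Classical in
lemma mem_shadowTimes {H : ℕ → ℝ} {c h : ℝ} {N m : ℕ} : m ∈ shadowTimes H c h N ↔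
    (1 ≤ m ∧ m ≤ N) ∧ ∃ k < m, h + c * (m - k) < H k := by
  simp [shadowTimes]

/-- An index `k` can spoil only the times in an interval of length `max (H k - h) 0 / c` following
it. -/
lemma card_shadowTimes_le {H : ℕ → ℝ} {c h : ℝ} (hc : 0 < c) (N : ℕ) :
    ((shadowTimes H c h N).card : ℝ) ≤ (∑ k ∈ Finset.range N, max (H k - h) 0) / c := by
  have hsub : shadowTimes H c h N ⊆ (Finset.range N).biUnion fun k =>
      Finset.Ioc k (k + ⌊max (H k - h) 0 / c⌋₊) := by
    intro m hm
    rw [mem_shadowTimes] at hm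
    obtain ⟨⟨h1, h2⟩, k, hk, hlt⟩ := hm
    refine Finset.mem_biUnion.2 ⟨k, Finset.mem_range.2 (by omega), Finset.mem_Ioc.2 ⟨hk, ?_⟩⟩
    have : m - k ≤ ⌊max (H k - h) 0 / c⌋₊ := by
      apply Nat.le_floor
      rw [le_div_iff₀ hc, Nat.cast_sub hk.le]
      exact le_max_of_le_left (by linarith)
    omega
  calc ((shadowTimes H c h N).card : ℝ)
      ≤ ((∑ k ∈ Finset.range N, ⌊max (H k - h) 0 / c⌋₊ : ℕ) : ℝ) := by
        refine Nat.cast_le.2 ((Finset.card_le_card hsub).trans (Finset.card_biUnion_le.trans ?_))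
        exact Finset.sum_le_sum fun k _ => by simp
    _ ≤ ∑ k ∈ Finset.range N, max (H k - h) 0 / c := by
        push_cast
        exact Finset.sum_le_sum fun k _ => Nat.floor_le (div_nonneg (le_max_right _ _) hc.le)
    _ = _ := by rw [Finset.sum_div]

end Counting

/-! ### From averaged expansion to a positive frequency of hyperbolic times. -/

section HyperbolicTimes

variable {M : Type*} [MetricSpace M]

/-- Points with a positive lower frequency of hyperbolic times. -/
lemma mem_freqHypTimeSet_of_eventually {θ c δ : ℝ} (hθ : 0 < θ) {g : M → M} {x : M}
    {G : ℕ → Finset ℕ} (hG : ∀ N, ∀ n ∈ G N, (1 ≤ n ∧ n ≤ N) ∧ IsHyperbolicTime c δ g n x)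
    (hcard : ∀ᶠ N : ℕ in atTop, θ * N ≤ (G N).card) : x ∈ freqHypTimeSet θ c δ g := by
  have hfin : ∀ N : ℕ, {k : ℕ | 1 ≤ k ∧ k ≤ N ∧ x ∈ hypTimeSet c δ g k}.Finite := fun N =>
    (Set.finite_Icc 1 N).subset fun k hk => ⟨hk.1, hk.2.1⟩
  have hle : ∀ N : ℕ, (G N).card ≤ {k : ℕ | 1 ≤ k ∧ k ≤ N ∧ x ∈ hypTimeSet c δ g k}.ncard := by
    intro N
    rw [← Set.ncard_coe_finset]
    exact Set.ncard_le_ncard (fun k hk => ⟨(hG N k hk).1.1, (hG N k hk).1.2, (hG N k hk).2⟩) (hfin N)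
  refine ⟨?_, ?_⟩
  · simp only [infHypTimeSet, Set.mem_iInter, Set.mem_iUnion]
    intro m _
    by_contra! hcon
    obtain ⟨N, hN1, hN2⟩ := (hcard.and
      ((tendsto_natCast_atTop_atTop.const_mul_atTop hθ).eventually_gt_atTop (m : ℝ))).exists
    have hsub : G N ⊆ Finset.Ico 1 m := fun n hn => by
      rw [Finset.mem_Ico]
      refine ⟨(hG N n hn).1.1, ?_⟩
      by_contra! h
      exact hcon n h (hG N n hn).2
    have h1 : (G N).card ≤ m := (Finset.card_le_card hsub).trans (by simp)
    have h2 : ((G N).card : ℝ) ≤ m := by exact_mod_cast h1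
    linarith
  · refine le_limsup_of_frequently_le ?_ ?_
    · refine Eventually.frequently ?_
      filter_upwards [hcard, eventually_gt_atTop 0] with N hN hN0
      rw [le_div_iff₀ (by exact_mod_cast hN0)]
      exact hN.trans (by exact_mod_cast hle N)
    · refine isBoundedUnder_of ⟨1, fun N => ?_⟩
      refine div_le_one_of_le₀ ?_ (Nat.cast_nonneg N)
      have : {k : ℕ | 1 ≤ k ∧ k ≤ N ∧ x ∈ hypTimeSet c δ g k}.ncard ≤ (Set.Icc 1 N).ncard :=
        Set.ncard_le_ncard (fun k hk => ⟨hk.1, hk.2.1⟩) (Set.finite_Icc 1 N)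
      have h2 : (Set.Icc 1 N).ncard = N := by
        rw [← Finset.coe_Icc, Set.ncard_coe_finset]; simp
      rw [h2] at this
      exact_mod_cast this

lemma HasRadialContraction.anti {p : M} {r r' K : ℝ} (hr : r' ≤ r)
    (h : HasRadialContraction p r K) : HasRadialContraction p r' K := by
  obtain ⟨H, h1, h2, h3, h4⟩ := h
  have hsub : Metric.ball p r' ⊆ Metric.ball p r := Metric.ball_subset_ball hr
  exact ⟨fun a => H (a.1, Set.inclusion hsub a.2),
    h1.comp (continuous_fst.prodMk ((continuous_inclusion hsub).comp continuous_snd)),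
    fun q => h2 _, fun q => h3 _, fun q a b => h4 (Set.inclusion hsub q) a b⟩

lemma birkhoffSum_mul_period {X : Type*} (f : X → X) (φ : X → ℝ) (ℓ n : ℕ) (x : X) :
    birkhoffSum f φ (ℓ * n) x = ∑ k ∈ Finset.range n, birkhoffSum f φ ℓ ((f^[ℓ])^[k] x) := by
  induction n with
  | zero => simp
  | succ n ih =>
    rw [Nat.mul_succ, birkhoffSum_add, ih, Finset.sum_range_succ, Function.iterate_mul]

lemma tendsto_integral_max_sub {X : Type*} [MeasurableSpace X] {μ : Measure X} {h : X → ℝ}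
    (hm : Measurable h) (hi : Integrable h μ) (h0 : ∀ x, 0 ≤ h x) :
    Tendsto (fun N : ℕ => ∫ x, max (h x - N) 0 ∂μ) atTop (𝓝 0) := by
  have hG : ∀ N : ℕ, MeasurableSet {x | h x ≤ N} := fun N => measurableSet_le hm measurable_const
  have := tendsto_integral_compl_indicator hi (G := fun N : ℕ => {x | h x ≤ N}) hG
    (fun a b hab x (hx : h x ≤ a) => hx.trans (Nat.cast_le.2 hab))
    (Eventually.of_forall fun x => exists_nat_ge (h x))
  refine tendsto_of_tendsto_of_tendsto_of_le_of_le tendsto_const_nhds this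
    (fun N => integral_nonneg fun x => le_max_right _ _) fun N => ?_
  have hle : ∀ x, max (h x - N) 0 ≤ {x | h x ≤ N}ᶜ.indicator h x := by
    intro x
    by_cases hx : h x ≤ N
    · rw [Set.indicator_of_notMem (by simpa using hx)]
      exact max_le (by linarith) le_rfl
    · rw [Set.indicator_of_mem (by simpa using hx)]
      have := Nat.cast_nonneg (α := ℝ) N
      exact max_le (by linarith) (h0 x)
  refine integral_mono_of_nonneg (Eventually.of_forall fun x => le_max_right _ _)
    (hi.indicator (hG N).compl) (Eventually.of_forall hle)

/-- If an iterate of `f` expands, on average along orbits, on balls whose radii are not too small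
on average, then almost every point has a positive frequency of hyperbolic times. -/
theorem exists_freqHypTimeSet_ae [MeasurableSpace M] {μ : Measure M} [IsProbabilityMeasure μ]
    (hgeo : HasNearGeodesics M) {f : M → M} (hf : Continuous f) (hT : Ergodic f μ) {ℓ : ℕ}
    (hℓ : 1 ≤ ℓ) {p h : M → ℝ} (hpm : Measurable p) (hpi : Integrable p μ) (hp0 : ∀ x, 0 ≤ p x)
    (hhm : Measurable h) (hhi : Integrable h μ) (hh0 : ∀ x, 0 ≤ h x) {b : ℝ}
    (hb : ℓ * ∫ x, p x ∂μ < b) {r K : ℝ} (hr : 0 < r) (hK : 0 < K)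
    (hrad : ∀ᵐ x ∂μ, HasRadialContraction x r K)
    (hcomp : ∀ᵐ x ∂μ, IsCompact (Metric.closedBall x (Real.exp (-birkhoffSum f h ℓ x))))
    (hloc : ∀ᵐ x ∂μ, ∀ z ∈ Metric.closedBall x (Real.exp (-birkhoffSum f h ℓ x)),
      z ∈ localHomeoSet f^[ℓ] ∧ ExpandsNear f^[ℓ] (Real.exp (b - birkhoffSum f p ℓ x)) z) :
    ∃ c θ δ : ℝ, 0 < c ∧ 0 < θ ∧ θ < 1 ∧ 0 < δ ∧
      ∀ᵐ x ∂μ, x ∈ freqHypTimeSet θ c δ f^[ℓ] := by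
  have hℓ0 : (0 : ℝ) < ℓ := by exact_mod_cast hℓ
  have hp : 0 ≤ ∫ x, p x ∂μ := integral_nonneg hp0
  set η := b - ℓ * ∫ x, p x ∂μ with hη
  have hη0 : 0 < η := by linarith
  have hηb : η ≤ b := by have := mul_nonneg hℓ0.le hp; linarith
  -- The block averages of `a` eventually reach `η / 2`; demanding only `η / 4` on every window
  -- gives Pliss times of frequency at least `θ`.
  set c := η / 4 with hc
  have hc0 : 0 < c := by positivity
  set θ := (η / 2 - c) / (b - c) with hθ
  have hbc : 0 < b - c := by linarith
  have hθ0 : 0 < θ := div_pos (by linarith) hbc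
  have hθ1 : θ < 1 := (div_lt_one hbc).2 (by linarith)
  -- The truncation level is so high that the spoiled times have frequency at most `θ / 2`.
  obtain ⟨N₀, hN₀⟩ := ((tendsto_integral_max_sub hhm hhi hh0).eventually_lt_const
    (show 0 < θ / 2 * c / ℓ by positivity)).exists
  set h₀ : ℝ := ℓ * N₀ with hh₀
  set δ := min (r / 4) (Real.exp (-h₀) / (4 * K)) with hδ
  have hδ0 : 0 < δ := lt_min (by positivity) (by positivity)
  have hδr : 4 * δ ≤ r := by have := min_le_left (r / 4) (Real.exp (-h₀) / (4 * K)); linarith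
  have hδK : K * (4 * δ) ≤ Real.exp (-h₀) := by
    have := min_le_right (r / 4) (Real.exp (-h₀) / (4 * K))
    rw [← hδ, le_div_iff₀ (by positivity)] at this
    linarith
  -- The rate is halved because the contraction in a hyperbolic time is `exp (-2 c (n - k))`.
  refine ⟨c / 2, θ / 2, δ, by positivity, by positivity, by linarith, hδ0, ?_⟩
  have hmp := hT.toMeasurePreserving
  have hqm : Measurable fun x => max (h x - N₀) 0 := (hhm.sub_const _).max measurable_const
  have hqi : Integrable (fun x => max (h x - N₀) 0) μ :=
    (hhi.sub (integrable_const _)).sup (integrable_zero _ _ _)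
  have hbp : ∫ x, p x ∂μ < (b - η / 2) / ℓ := by
    rw [lt_div_iff₀ hℓ0]; linarith
  filter_upwards [ae_forall_iterate hmp hrad, ae_forall_iterate hmp hcomp,
    ae_forall_iterate hmp hloc, ae_eventually_birkhoffSum_lt hT hpm hpi hbp,
    ae_eventually_birkhoffSum_lt hT hqm hqi hN₀] with x hrad hcomp hloc hpx hqx
  set a : ℕ → ℝ := fun k => b - birkhoffSum f p ℓ ((f^[ℓ])^[k] x) with ha
  set H : ℕ → ℝ := fun k => birkhoffSum f h ℓ ((f^[ℓ])^[k] x) with hH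
  have hit : ∀ k, (f^[ℓ])^[k] x = f^[ℓ * k] x := fun k => by rw [Function.iterate_mul]
  have hab : ∀ k, a k ≤ b := fun k => by
    have : 0 ≤ birkhoffSum f p ℓ ((f^[ℓ])^[k] x) := Finset.sum_nonneg fun i _ => hp0 _
    simp only [ha]; linarith
  have hmul : Tendsto (fun n : ℕ => ℓ * n) atTop atTop :=
    tendsto_id.const_mul_atTop' (by omega)
  refine mem_freqHypTimeSet_of_eventually (by positivity)
    (G := fun N => plissTimes a c N \ shadowTimes H c h₀ N) ?_ ?_
  · intro N n hn
    rw [Finset.mem_sdiff, mem_plissTimes, mem_shadowTimes] at hn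
    obtain ⟨⟨hnN, hpl⟩, hsh⟩ := hn
    refine ⟨hnN, ?_⟩
    have hsh : ∀ k < n, H k ≤ h₀ + c * (n - k) := by
      intro k hk
      by_contra! hcon
      exact hsh ⟨hnN, k, hk, hcon⟩
    have hprod : ∀ k, expansionProd (fun k => Real.exp (a k)) k n =
        Real.exp (∑ j ∈ Finset.Ico k n, a j) := fun k => by
      rw [Real.exp_sum]; rfl
    refine isHyperbolicTime_of_expansion hgeo (hf.iterate ℓ) (κ := fun k => Real.exp (a k))
      (t := fun k => Real.exp (-H k)) (fun k => Real.exp_pos _) ?_ ?_ hδ0 hK.le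
      (K := K) ?_ ?_ ?_
    · intro k _
      have := hcomp (ℓ * k)
      rw [← hit] at this
      exact this
    · intro k _
      have := hloc (ℓ * k)
      rw [← hit] at this
      exact this
    · rw [hit]
      exact (hrad _).anti hδr
    -- The expansion `exp (c * (n - k))` offsets a radius as small as `exp (-(h₀ + c * (n - k)))`,
    -- which is all that an unspoiled time allows; what is left is `exp (-h₀) ≥ K * (4 * δ)`.
    · intro k hk
      refine hδK.trans ?_
      rw [hprod, ← Real.exp_add]
      apply Real.exp_le_exp.2
      have := hsh k hk
      have := hpl k hk
      linarith
    · intro k hk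
      rw [hprod]
      apply Real.exp_le_exp.2
      rcases hk.lt_or_eq with hk | rfl
      · have := hpl k hk
        linarith
      · simp
  · filter_upwards [hmul.eventually hpx, hmul.eventually hqx] with N hpN hqN
    push_cast at hpN hqN
    rw [birkhoffSum_mul_period] at hpN hqN
    have hsum : η / 2 * N ≤ ∑ j ∈ Finset.range N, a j := by
      simp only [ha, Finset.sum_sub_distrib, Finset.sum_const, Finset.card_range, nsmul_eq_mul]
      have : (b - η / 2) / ℓ * (ℓ * N) = (b - η / 2) * N := by field_simp
      linarith
    have h1 := mul_le_card_plissTimes hab (show c < b by linarith) hsum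
    have h2 := card_shadowTimes_le (H := H) (h := h₀) hc0 N
    have h3 : ∑ k ∈ Finset.range N, max (H k - h₀) 0 ≤ θ / 2 * c * N := by
      have e : θ / 2 * c / ℓ * (ℓ * N) = θ / 2 * c * N := by field_simp
      rw [← e]
      refine le_trans (Finset.sum_le_sum fun k _ => ?_) hqN.le
      refine max_le ?_ (Finset.sum_nonneg fun i _ => le_max_right _ _)
      have : H k - h₀ = ∑ i ∈ Finset.range ℓ, (h (f^[i] ((f^[ℓ])^[k] x)) - N₀) := by
        simp [hH, hh₀, birkhoffSum, Finset.sum_sub_distrib]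
      rw [this]
      exact Finset.sum_le_sum fun i _ => le_max_left _ _
    have h4 : (∑ k ∈ Finset.range N, max (H k - h₀) 0) / c ≤ θ / 2 * N := by
      rw [div_le_iff₀ hc0]; linarith
    have h5 : (plissTimes a c N).card ≤
        (plissTimes a c N \ shadowTimes H c h₀ N).card + (shadowTimes H c h₀ N).card := by
      have := Finset.le_card_sdiff (shadowTimes H c h₀ N) (plissTimes a c N)
      omega
    have h6 : ((plissTimes a c N).card : ℝ) ≤
        (plissTimes a c N \ shadowTimes H c h₀ N).card + (shadowTimes H c h₀ N).card := by
      exact_mod_cast h5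
    rw [← hθ] at h1
    linarith

end HyperbolicTimes


/-! ### Paths, lengths and Lipschitz bounds on Riemannian manifolds. -/

section RiemannianLipschitz

open Manifold

variable {E : Type*} [NormedAddCommGroup E] [NormedSpace ℝ E]
  {M : Type*} [MetricSpace M] [ChartedSpace E M] [IsManifold 𝓘(ℝ, E) 1 M]
  [RiemannianBundle (fun x : M => TangentSpace 𝓘(ℝ, E) x)]
  [IsContinuousRiemannianBundle E (fun x : M => TangentSpace 𝓘(ℝ, E) x)]
  {F : Type*} [NormedAddCommGroup F] [NormedSpace ℝ F]
  {N : Type*} [MetricSpace N] [ChartedSpace F N] [IsManifold 𝓘(ℝ, F) 1 N]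
  [RiemannianBundle (fun x : N => TangentSpace 𝓘(ℝ, F) x)]
  [IsContinuousRiemannianBundle F (fun x : N => TangentSpace 𝓘(ℝ, F) x)]

lemma continuous_norm_tangentBundle :
    Continuous (fun p : TangentBundle 𝓘(ℝ, E) M => ‖p.2‖) := by
  have h : Continuous (fun p : TangentBundle 𝓘(ℝ, E) M => inner ℝ p.2 p.2) :=
    Continuous.inner_bundle (F := E) (E := fun x : M => TangentSpace 𝓘(ℝ, E) x)
      (b := fun p : TangentBundle 𝓘(ℝ, E) M => p.1) (v := fun p => p.2) (w := fun p => p.2)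
      continuous_id continuous_id
  have : (fun p : TangentBundle 𝓘(ℝ, E) M => ‖p.2‖) =
      fun p : TangentBundle 𝓘(ℝ, E) M => Real.sqrt (inner ℝ p.2 p.2) := by
    ext p
    rw [real_inner_self_eq_norm_sq, Real.sqrt_sq (norm_nonneg _)]
  rw [this]
  exact h.sqrt

lemma continuous_norm_mfderiv_path {γ : ℝ → M} (hγ : ContMDiff 𝓘(ℝ, ℝ) 𝓘(ℝ, E) 1 γ) :
    Continuous fun t => ‖mfderiv 𝓘(ℝ, ℝ) 𝓘(ℝ, E) γ t (1 : ℝ)‖ := by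
  have h1 := hγ.continuous_tangentMap le_rfl
  have h2 : Continuous fun t : ℝ => (⟨t, (1 : ℝ)⟩ : TangentBundle 𝓘(ℝ, ℝ) ℝ) := by
    have := (tangentBundleModelSpaceHomeomorph 𝓘(ℝ, ℝ)).symm.continuous.comp
      (continuous_id.prodMk (continuous_const (y := (1 : ℝ))))
    exact this
  exact continuous_norm_tangentBundle.comp (h1.comp h2)

section
variable [IsRiemannianManifold 𝓘(ℝ, E) M]

/-- A path realizing the distance up to a small error. -/
lemma exists_path_pathELength_lt (p q : M) {r : ENNReal} (hr : edist p q < r) :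
    ∃ γ : ℝ → M, γ 0 = p ∧ γ 1 = q ∧ ContMDiff 𝓘(ℝ, ℝ) 𝓘(ℝ, E) 1 γ ∧
      pathELength 𝓘(ℝ, E) γ 0 1 < r := by
  rw [IsRiemannianManifold.out (I := 𝓘(ℝ, E)) p q] at hr
  obtain ⟨γ, h0, h1, h2, h3, -⟩ := exists_lt_locally_constant_of_riemannianEDist_lt hr zero_lt_one
  exact ⟨γ, h0, h1, h2, h3⟩

lemma edist_le_pathELength {γ : ℝ → M} {a b : ℝ}
    (hγ : ContMDiffOn 𝓘(ℝ, ℝ) 𝓘(ℝ, E) 1 γ (Set.Icc a b)) (hab : a ≤ b) :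
    edist (γ a) (γ b) ≤ pathELength 𝓘(ℝ, E) γ a b := by
  rw [IsRiemannianManifold.out (I := 𝓘(ℝ, E)) (γ a) (γ b)]
  exact riemannianEDist_le_pathELength hγ rfl rfl hab

/-- Completeness is not assumed, so minimizing geodesics need not exist. Arc length along an almost
minimizing `C^1` path serves as `Λ`. -/
lemma hasNearGeodesics (E : Type*) [NormedAddCommGroup E] [NormedSpace ℝ E]
    (M : Type*) [MetricSpace M] [ChartedSpace E M] [IsManifold 𝓘(ℝ, E) 1 M]
    [RiemannianBundle (fun x : M => TangentSpace 𝓘(ℝ, E) x)]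
    [IsContinuousRiemannianBundle E (fun x : M => TangentSpace 𝓘(ℝ, E) x)]
    [IsRiemannianManifold 𝓘(ℝ, E) M] : HasNearGeodesics M := by
  intro p q ε hε
  have hr : edist p q < ENNReal.ofReal (dist p q + ε) := by
    rw [edist_dist]
    exact (ENNReal.ofReal_lt_ofReal_iff (by positivity)).2 (by linarith)
  obtain ⟨γ, h0, h1, hγ, hlt⟩ := exists_path_pathELength_lt (E := E) p q hr
  set g : ℝ → ℝ := fun t => ‖mfderiv 𝓘(ℝ, ℝ) 𝓘(ℝ, E) γ t (1 : ℝ)‖ with hg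
  have hgc : Continuous g := continuous_norm_mfderiv_path hγ
  have hg0 : ∀ t, 0 ≤ g t := fun t => norm_nonneg _
  have hlen : ∀ a b : ℝ, a ≤ b → pathELength 𝓘(ℝ, E) γ a b = ENNReal.ofReal (∫ t in a..b, g t) := by
    intro a b hab
    rw [pathELength_eq_lintegral_mfderiv_Icc, intervalIntegral.integral_of_le hab,
      ← integral_Icc_eq_integral_Ioc, ofReal_integral_eq_lintegral_ofReal
      hgc.continuousOn.integrableOn_Icc (Eventually.of_forall hg0)]
    refine lintegral_congr fun t => ?_
    exact (ofReal_norm _).symm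
  refine ⟨γ, fun s => ∫ t in (0 : ℝ)..s, g t, ⟨?_, ?_⟩, h0, h1, ?_⟩
  · exact (intervalIntegral.continuous_primitive (fun a b => hgc.intervalIntegrable a b) 0).continuousOn
  · intro a b ha hab hb
    have := edist_le_pathELength (E := E) (hγ.contMDiffOn (s := Set.Icc a b)) hab
    rw [hlen a b hab, edist_dist, ENNReal.ofReal_le_ofReal_iff
      (intervalIntegral.integral_nonneg hab fun t _ => hg0 t)] at this
    rw [intervalIntegral.integral_interval_sub_left (hgc.intervalIntegrable _ _)
      (hgc.intervalIntegrable _ _)]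
    exact this
  · rw [hlen 0 1 zero_le_one, ENNReal.ofReal_lt_ofReal_iff (by positivity)] at hlt
    simp only [intervalIntegral.integral_same, sub_zero]
    exact hlt.le

variable [IsRiemannianManifold 𝓘(ℝ, F) N]

/-- A `C^1` map whose derivative is bounded by `C` near a point is `C`-Lipschitz near it. -/
lemma exists_nhds_dist_le_of_mfderiv_le {h : M → N} {p : M} {C : ℝ} (hC : 0 ≤ C)
    (hh : ∀ᶠ q in 𝓝 p, ContMDiffAt 𝓘(ℝ, E) 𝓘(ℝ, F) 1 h q)
    (hb : ∀ᶠ q in 𝓝 p, ∀ v : TangentSpace 𝓘(ℝ, E) q, ‖mfderiv 𝓘(ℝ, E) 𝓘(ℝ, F) h q v‖ ≤ C * ‖v‖) :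
    ∃ O ∈ 𝓝 p, ∀ q ∈ O, ∀ q' ∈ O, dist (h q) (h q') ≤ C * dist q q' := by
  obtain ⟨r, hr, hball⟩ := Metric.eventually_nhds_iff_ball.1 (hh.and hb)
  -- Points of the quarter ball are joined by paths of length below `r / 2`, which stay in the ball
  -- of radius `r` where the derivative is bounded.
  refine ⟨Metric.ball p (r / 4), Metric.ball_mem_nhds _ (by positivity), fun q hq q' hq' => ?_⟩
  have hqq : dist q q' < r / 2 := by
    have := dist_triangle_right q q' p
    rw [Metric.mem_ball] at hq hq'
    linarith
  refine le_of_forall_pos_le_add fun ε hε => ?_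
  obtain ⟨η, hη0, hηr, hηC⟩ : ∃ η > 0, dist q q' + η ≤ r / 2 ∧ C * η ≤ ε := by
    refine ⟨min (r / 2 - dist q q') (ε / (C + 1)), lt_min (by linarith) (by positivity), ?_, ?_⟩
    · have := min_le_left (r / 2 - dist q q') (ε / (C + 1)); linarith
    · have := min_le_right (r / 2 - dist q q') (ε / (C + 1))
      calc C * min (r / 2 - dist q q') (ε / (C + 1)) ≤ (C + 1) * (ε / (C + 1)) := by
            gcongr; linarith
        _ = ε := by field_simp
  have hlt : edist q q' < ENNReal.ofReal (dist q q' + η) := by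
    rw [edist_dist]
    exact (ENNReal.ofReal_lt_ofReal_iff (by positivity)).2 (by linarith)
  obtain ⟨γ, h0, h1, hγ, hlen⟩ := exists_path_pathELength_lt (E := E) q q' hlt
  have hmem : ∀ t ∈ Set.Icc (0 : ℝ) 1, γ t ∈ Metric.ball p r := by
    intro t ht
    have h2 := edist_le_pathELength (E := E) (hγ.contMDiffOn (s := Set.Icc 0 t)) ht.1
    have h3 : edist (γ 0) (γ t) < ENNReal.ofReal (r / 2) :=
      (h2.trans (pathELength_mono le_rfl ht.2)).trans_lt
        (hlen.trans_le (ENNReal.ofReal_le_ofReal hηr))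
    rw [edist_dist, ENNReal.ofReal_lt_ofReal_iff (by positivity), h0] at h3
    have := dist_triangle_left (γ t) p q
    rw [Metric.mem_ball] at hq ⊢
    linarith
  have hc : ContMDiffOn 𝓘(ℝ, ℝ) 𝓘(ℝ, F) 1 (h ∘ γ) (Set.Icc 0 1) := fun t ht =>
    ((hball _ (hmem t ht)).1.comp t (hγ t)).contMDiffWithinAt
  have h2 := edist_le_pathELength (E := F) hc zero_le_one
  have h3 : pathELength 𝓘(ℝ, F) (h ∘ γ) 0 1 ≤ ENNReal.ofReal C * pathELength 𝓘(ℝ, E) γ 0 1 := by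
    rw [pathELength_eq_lintegral_mfderiv_Icc, pathELength_eq_lintegral_mfderiv_Icc,
      ← lintegral_const_mul' _ _ ENNReal.ofReal_ne_top]
    refine setLIntegral_mono' measurableSet_Icc fun t ht => ?_
    have h4 := mfderiv_comp_apply t ((hball _ (hmem t ht)).1.mdifferentiableAt one_ne_zero)
      ((hγ t).mdifferentiableAt one_ne_zero) (1 : ℝ)
    have h5 := (hball _ (hmem t ht)).2 (mfderiv 𝓘(ℝ, ℝ) 𝓘(ℝ, E) γ t (1 : ℝ))
    rw [← h4] at h5
    rw [← ofReal_norm, ← ofReal_norm, ← ENNReal.ofReal_mul hC]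
    exact ENNReal.ofReal_le_ofReal h5
  have h6 : edist (h q) (h q') ≤ ENNReal.ofReal (C * (dist q q' + η)) := by
    rw [ENNReal.ofReal_mul hC]
    rw [Function.comp_apply, Function.comp_apply, h0, h1] at h2
    exact h2.trans (h3.trans (mul_le_mul_right hlen.le _))
  rw [edist_dist, ENNReal.ofReal_le_ofReal_iff (by positivity)] at h6
  linarith

end

/-- The derivative of a map which is `C^1` at a point is bounded near it. -/
lemma exists_eventually_mfderiv_le {h : M → N} {p : M}
    (hh : ContMDiffAt 𝓘(ℝ, E) 𝓘(ℝ, F) 1 h p) :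
    ∃ C : ℝ, 0 < C ∧ ∀ᶠ q in 𝓝 p, ∀ v : TangentSpace 𝓘(ℝ, E) q,
      ‖mfderiv 𝓘(ℝ, E) 𝓘(ℝ, F) h q v‖ ≤ C * ‖v‖ := by
  obtain ⟨C₁, hC₁, h₁⟩ := eventually_norm_trivializationAt_lt E
    (fun x : M => TangentSpace 𝓘(ℝ, E) x) p
  obtain ⟨C₂, hC₂, h₂⟩ := eventually_norm_symmL_trivializationAt_lt F
    (fun x : N => TangentSpace 𝓘(ℝ, F) x) (h p)
  have hc : ContinuousAt (inTangentCoordinates 𝓘(ℝ, E) 𝓘(ℝ, F) id h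
      (mfderiv 𝓘(ℝ, E) 𝓘(ℝ, F) h) p) p :=
    (ContMDiffAt.mfderiv_const (m := 0) hh (by simp)).continuousAt
  obtain ⟨C₃, hC₃⟩ : ∃ C₃ : ℝ, ∀ᶠ q in 𝓝 p, ‖inTangentCoordinates 𝓘(ℝ, E) 𝓘(ℝ, F) id h
      (mfderiv 𝓘(ℝ, E) 𝓘(ℝ, F) h) p q‖ < C₃ :=
    ⟨_, hc.norm.eventually_lt_const (lt_add_one _)⟩
  have hs := (trivializationAt E (TangentSpace 𝓘(ℝ, E)) p).open_baseSet.mem_nhds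
    (FiberBundle.mem_baseSet_trivializationAt' p)
  have ht := hh.continuousAt.preimage_mem_nhds
    ((trivializationAt F (TangentSpace 𝓘(ℝ, F)) (h p)).open_baseSet.mem_nhds
    (FiberBundle.mem_baseSet_trivializationAt' (h p)))
  have hC₃0 : 0 ≤ C₃ := by
    obtain ⟨q, hq⟩ := hC₃.exists
    exact (norm_nonneg _).trans hq.le
  refine ⟨C₂ * ((C₃ + 1) * C₁), by positivity, ?_⟩
  filter_upwards [h₁, hh.continuousAt.eventually h₂, hC₃, hs, ht] with q h₁ h₂ h₃ hs ht v
  set e := trivializationAt E (TangentSpace 𝓘(ℝ, E)) p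
  set e' := trivializationAt F (TangentSpace 𝓘(ℝ, F)) (h p)
  have key : mfderiv 𝓘(ℝ, E) 𝓘(ℝ, F) h q v = e'.symmL ℝ (h q)
      (inTangentCoordinates 𝓘(ℝ, E) 𝓘(ℝ, F) id h (mfderiv 𝓘(ℝ, E) 𝓘(ℝ, F) h) p q
        (e.continuousLinearMapAt ℝ q v)) := by
    have : inTangentCoordinates 𝓘(ℝ, E) 𝓘(ℝ, F) id h (mfderiv 𝓘(ℝ, E) 𝓘(ℝ, F) h) p q
        (e.continuousLinearMapAt ℝ q v) = e'.continuousLinearMapAt ℝ (h q)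
          (mfderiv 𝓘(ℝ, E) 𝓘(ℝ, F) h q (e.symmL ℝ q (e.continuousLinearMapAt ℝ q v))) := rfl
    rw [this, e.symmL_continuousLinearMapAt hs, e'.symmL_continuousLinearMapAt ht]
  rw [key]
  calc _ ≤ C₂ * ‖inTangentCoordinates 𝓘(ℝ, E) 𝓘(ℝ, F) id h (mfderiv 𝓘(ℝ, E) 𝓘(ℝ, F) h) p q
        (e.continuousLinearMapAt ℝ q v)‖ := (e'.symmL ℝ (h q)).le_of_opNorm_le h₂.le _
    _ ≤ C₂ * (C₃ * ‖e.continuousLinearMapAt ℝ q v‖) := by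
        gcongr
        exact ContinuousLinearMap.le_of_opNorm_le _ h₃.le _
    _ ≤ C₂ * ((C₃ + 1) * (C₁ * ‖v‖)) := by
        gcongr
        · linarith
        · exact ContinuousLinearMap.le_of_opNorm_le _ h₁.le _
    _ = _ := by ring

/-- A map which is `C^1` near a point is Lipschitz near it. -/
lemma exists_nhds_dist_le [IsRiemannianManifold 𝓘(ℝ, E) M] [IsRiemannianManifold 𝓘(ℝ, F) N]
    {h : M → N} {p : M} (hh : ∀ᶠ q in 𝓝 p, ContMDiffAt 𝓘(ℝ, E) 𝓘(ℝ, F) 1 h q) :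
    ∃ C : ℝ, 0 < C ∧ ∃ O ∈ 𝓝 p, ∀ q ∈ O, ∀ q' ∈ O, dist (h q) (h q') ≤ C * dist q q' := by
  obtain ⟨C, hC, hb⟩ := exists_eventually_mfderiv_le hh.self_of_nhds
  exact ⟨C, hC, exists_nhds_dist_le_of_mfderiv_le hC.le hh hb⟩

end RiemannianLipschitz


/-! ### The inverse function theorem on manifolds. -/

section LocalInversion

variable {E : Type*} [NormedAddCommGroup E] [NormedSpace ℝ E]
  {M : Type*} [TopologicalSpace M] [ChartedSpace E M] [IsManifold 𝓘(ℝ, E) 1 M]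
  {F : Type*} [NormedAddCommGroup F] [NormedSpace ℝ F]
  {N : Type*} [TopologicalSpace N] [ChartedSpace F N] [IsManifold 𝓘(ℝ, F) 1 N]

lemma eventually_contMDiffAt {h : M → N} {x : M} (hh : ContMDiffAt 𝓘(ℝ, E) 𝓘(ℝ, F) 1 h x) :
    ∀ᶠ y in 𝓝 x, ContMDiffAt 𝓘(ℝ, E) 𝓘(ℝ, F) 1 h y :=
  (contMDiffAt_iff_contMDiffAt_nhds (by simp)).1 hh

/-- Being `C^1` at a point persists nearby, so after shrinking the source both directions are `C^1`
everywhere on their domains. -/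
lemma isLocalDiffeomorphAt_of_openPartialHomeomorph {f : M → N} {x : M}
    (e : OpenPartialHomeomorph M N) (hx : x ∈ e.source) (hfe : f =ᶠ[𝓝 x] e)
    (hf : ContMDiffAt 𝓘(ℝ, E) 𝓘(ℝ, F) 1 f x)
    (he : ContMDiffAt 𝓘(ℝ, F) 𝓘(ℝ, E) 1 e.symm (e x)) :
    IsLocalDiffeomorphAt 𝓘(ℝ, E) 𝓘(ℝ, F) 1 f x := by
  obtain ⟨W, hW, hWo, hxW⟩ := eventually_nhds_iff.1 (hfe.eventually_nhds.and
    ((eventually_contMDiffAt hf).and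
      ((e.continuousAt hx).eventually (eventually_contMDiffAt he))))
  let e' := e.restrOpen W hWo
  have hs : e'.source = e.source ∩ W := e.restrOpen_source W hWo
  refine ⟨⟨e'.toPartialEquiv, e'.open_source, e'.open_target, ?_, ?_⟩, ?_, ?_⟩
  · intro y hy
    have hy' : y ∈ e.source ∩ W := hs ▸ hy
    exact ((hW y hy'.2).2.1.congr_of_eventuallyEq
      (show f =ᶠ[𝓝 y] e from (hW y hy'.2).1).symm).contMDiffWithinAt
  · intro y hy
    have h1 : e'.symm y ∈ e.source ∩ W := hs ▸ e'.map_target hy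
    have h2 : e (e'.symm y) = y := e'.right_inv hy
    have h3 := (hW _ h1.2).2.2
    rw [h2] at h3
    exact h3.contMDiffWithinAt
  · change x ∈ e'.source
    rw [hs]; exact ⟨hx, hxW⟩
  · intro y hy
    have hy' : y ∈ e.source ∩ W := hs ▸ hy
    exact (hW y hy'.2).1.self_of_nhds

/-- The inverse function theorem on manifolds. -/
lemma isLocalDiffeomorphAt_of_mfderiv_injective [FiniteDimensional ℝ E]
    {N : Type*} [TopologicalSpace N] [ChartedSpace E N] [IsManifold 𝓘(ℝ, E) 1 N]
    {f : M → N} {x : M}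
    (hf : ContMDiffAt 𝓘(ℝ, E) 𝓘(ℝ, E) 1 f x)
    (hinj : ∀ v : TangentSpace 𝓘(ℝ, E) x, mfderiv 𝓘(ℝ, E) 𝓘(ℝ, E) f x v = 0 → v = 0) :
    IsLocalDiffeomorphAt 𝓘(ℝ, E) 𝓘(ℝ, E) 1 f x := by
  have : CompleteSpace E := FiniteDimensional.complete ℝ E
  set φ := extChartAt 𝓘(ℝ, E) x with hφ
  set ψ := extChartAt 𝓘(ℝ, E) (f x) with hψ
  set G : E → E := writtenInExtChartAt 𝓘(ℝ, E) 𝓘(ℝ, E) x f with hG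
  have hGc : ContDiffAt ℝ 1 G (φ x) := by
    have := (contMDiffAt_iff.1 hf).2
    rwa [ModelWithCorners.range_eq_univ, contDiffWithinAt_univ] at this
  have hGd : fderiv ℝ G (φ x) = mfderiv 𝓘(ℝ, E) 𝓘(ℝ, E) f x := by
    have := (hf.mdifferentiableAt one_ne_zero).mfderiv
    rw [ModelWithCorners.range_eq_univ, fderivWithin_univ] at this
    exact this.symm
  let A : E ≃L[ℝ] E := (LinearEquiv.ofInjectiveEndo (fderiv ℝ G (φ x) : E →ₗ[ℝ] E) (by
    rw [← LinearMap.ker_eq_bot, LinearMap.ker_eq_bot']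
    intro v hv
    apply hinj
    rw [← hGd]
    exact hv)).toContinuousLinearEquiv
  have hA : HasFDerivAt G (A : E →L[ℝ] E) (φ x) := by
    have h1 : (A : E →L[ℝ] E) = fderiv ℝ G (φ x) := by
      ext v; rfl
    rw [h1]
    exact (hGc.differentiableAt one_ne_zero).hasFDerivAt
  let g := hGc.toOpenPartialHomeomorph G hA one_ne_zero
  have hg : (g : E → E) = G := hGc.toOpenPartialHomeomorph_coe hA one_ne_zero
  have hgx : φ x ∈ g.source := hGc.mem_toOpenPartialHomeomorph_source hA one_ne_zero
  have hGx : G (φ x) = ψ (f x) := by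
    simp [hG, writtenInExtChartAt, hφ, hψ]
  let c := chartAt E x
  let d := chartAt E (f x)
  let e : OpenPartialHomeomorph M N := c.trans (g.trans d.symm)
  have hcx : (c x : E) = φ x := by simp [c, hφ]
  have hdx : (d (f x) : E) = ψ (f x) := by simp [d, hψ]
  have hgc : g (c x) = d (f x) := by rw [hcx, hg, hGx, hdx]
  have hxe : x ∈ e.source := by
    simp only [e, OpenPartialHomeomorph.trans_source, Set.mem_inter_iff, Set.mem_preimage,
      OpenPartialHomeomorph.symm_source]
    refine ⟨mem_chart_source E x, by rw [hcx]; exact hgx, ?_⟩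
    rw [hgc]
    exact d.map_source (mem_chart_source E (f x))
  have hex : e x = f x := by
    simp only [e, OpenPartialHomeomorph.coe_trans, Function.comp_apply, hgc]
    exact d.left_inv (mem_chart_source E (f x))
  refine isLocalDiffeomorphAt_of_openPartialHomeomorph e hxe ?_ hf ?_
  · filter_upwards [c.open_source.mem_nhds (mem_chart_source E x),
      hf.continuousAt.preimage_mem_nhds (d.open_source.mem_nhds (mem_chart_source E (f x)))]
      with y hy hy'
    simp only [e, OpenPartialHomeomorph.coe_trans, Function.comp_apply, hg, hG,
      writtenInExtChartAt]
    have h1 : (extChartAt 𝓘(ℝ, E) x).symm (c y) = y := by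
      simpa [c] using c.left_inv hy
    rw [h1]
    have h2 : extChartAt 𝓘(ℝ, E) (f x) (f y) = d (f y) := by simp [d]
    rw [h2, d.left_inv hy']
  · rw [hex]
    have h1 : ContMDiffAt 𝓘(ℝ, E) 𝓘(ℝ, E) 1 d (f x) :=
      contMDiffAt_of_mem_maximalAtlas (IsManifold.chart_mem_maximalAtlas (f x))
        (mem_chart_source E (f x))
    have h2 : ContMDiffAt 𝓘(ℝ, E) 𝓘(ℝ, E) 1 g.symm (d (f x)) := by
      have := hGc.to_localInverse hA one_ne_zero
      rw [hGx, ← hdx] at this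
      exact this.contMDiffAt
    have h3 : ContMDiffAt 𝓘(ℝ, E) 𝓘(ℝ, E) 1 c.symm (g.symm (d (f x))) := by
      have : g.symm (d (f x)) = c x := by
        rw [← hgc]; exact g.left_inv (by rw [hcx]; exact hgx)
      rw [this]
      exact contMDiffOn_symm_of_mem_maximalAtlas (IsManifold.chart_mem_maximalAtlas x)
        |>.contMDiffAt (c.open_target.mem_nhds (c.map_source (mem_chart_source E x)))
    exact (h3.comp _ h2).comp (f x) h1

end LocalInversion

/-! ### Local expansion from derivatives, and radial contraction of small balls. -/

section Riemannian

lemma isContinuousRiemannianBundle_of_contMDiff {E : Type*} [NormedAddCommGroup E]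
    [NormedSpace ℝ E] {M : Type*} [TopologicalSpace M] [ChartedSpace E M] [IsManifold 𝓘(ℝ, E) 1 M]
    [RiemannianBundle (fun x : M => TangentSpace 𝓘(ℝ, E) x)] {n : ℕ∞ω}
    [h : IsContMDiffRiemannianBundle 𝓘(ℝ, E) n E (fun x : M => TangentSpace 𝓘(ℝ, E) x)] :
    IsContinuousRiemannianBundle E (fun x : M => TangentSpace 𝓘(ℝ, E) x) := by
  obtain ⟨g, hg, hg'⟩ := h.exists_contMDiff
  exact ⟨g, hg.continuous, hg'⟩

/-- All tangent spaces unfold to `E`, but their norms depend on the base point, so an equality of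
base points has to be carried through the norm. -/
lemma norm_tangentSpace_congr {E : Type*} [NormedAddCommGroup E] [NormedSpace ℝ E]
    {M : Type*} [TopologicalSpace M] [ChartedSpace E M]
    [RiemannianBundle (fun x : M => TangentSpace 𝓘(ℝ, E) x)] {x y : M} (h : x = y) (v : E) :
    ‖(show TangentSpace 𝓘(ℝ, E) x from v)‖ = ‖(show TangentSpace 𝓘(ℝ, E) y from v)‖ := by
  subst h; rfl

variable {E : Type*} [NormedAddCommGroup E] [NormedSpace ℝ E] [FiniteDimensional ℝ E]
  {M : Type*} [MetricSpace M] [ChartedSpace E M] [IsManifold 𝓘(ℝ, E) 1 M]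
  [RiemannianBundle (fun x : M => TangentSpace 𝓘(ℝ, E) x)]
  [IsContinuousRiemannianBundle E (fun x : M => TangentSpace 𝓘(ℝ, E) x)]
  [IsRiemannianManifold 𝓘(ℝ, E) M]

/-- A `C^1` map whose derivative expands vectors by a factor `κ` near a point is a local
homeomorphism expanding distances by the factor `κ` near it. -/
lemma localHomeo_expandsNear_of_mfderiv_ge {g : M → M} (hg : ContMDiff 𝓘(ℝ, E) 𝓘(ℝ, E) 1 g)
    {κ : ℝ} (hκ : 0 < κ) {z : M}
    (hz : ∀ᶠ z' in 𝓝 z, ∀ v : TangentSpace 𝓘(ℝ, E) z', κ * ‖v‖ ≤ ‖D E g z' v‖) :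
    z ∈ localHomeoSet g ∧ ExpandsNear g κ z := by
  have hdiff : IsLocalDiffeomorphAt 𝓘(ℝ, E) 𝓘(ℝ, E) 1 g z := by
    refine isLocalDiffeomorphAt_of_mfderiv_injective hg.contMDiffAt fun v hv => ?_
    have := hz.self_of_nhds v
    rw [D, hv, norm_zero] at this
    exact norm_le_zero_iff.1 (nonpos_of_mul_nonpos_right this hκ)
  obtain ⟨Φ, hzΦ, hΦ⟩ := hdiff
  set e := Φ.toOpenPartialHomeomorph with he
  have hze : z ∈ e.source := hzΦ
  have hge : Set.EqOn g e e.source := hΦ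
  have hgz : g z = e z := hge hze
  have hgt : g z ∈ e.target := hgz ▸ e.map_source hze
  have hsymm : e.symm (g z) = z := by rw [hgz, e.left_inv hze]
  constructor
  -- `IsLocalHomeomorphOn.mk` adjusts the local inverse data so that the coercion equals `g`
  -- everywhere, as `localHomeoSet` demands.
  · have : IsLocalHomeomorphOn g {z} :=
      IsLocalHomeomorphOn.mk g {z} fun y hy => ⟨e, by rw [Set.mem_singleton_iff.1 hy]; exact hze, hge⟩
    obtain ⟨e', h1, h2⟩ := this z rfl
    exact ⟨e', h1, h2⟩
  · have hc : ∀ᶠ q in 𝓝 (g z), ContMDiffAt 𝓘(ℝ, E) 𝓘(ℝ, E) 1 e.symm q := by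
      filter_upwards [e.open_target.mem_nhds hgt] with q hq
      exact (Φ.contMDiffOn_invFun q hq).contMDiffAt (e.open_target.mem_nhds hq)
    have htend : Tendsto e.symm (𝓝 (g z)) (𝓝 z) := by
      have := e.symm.continuousAt (x := g z) hgt
      rwa [ContinuousAt, hsymm] at this
    -- Differentiating `g ∘ e.symm = id` bounds the derivative of the inverse by `κ⁻¹`, and a
    -- Lipschitz inverse means an expanding map.
    have hb : ∀ᶠ q in 𝓝 (g z), ∀ v : TangentSpace 𝓘(ℝ, E) q,
        ‖mfderiv 𝓘(ℝ, E) 𝓘(ℝ, E) e.symm q v‖ ≤ κ⁻¹ * ‖v‖ := by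
      filter_upwards [e.open_target.mem_nhds hgt, hc, htend.eventually hz] with q hq hcq hzq v
      have hgq : g (e.symm q) = q := by rw [hge (e.map_target hq), e.right_inv hq]
      have hev : g ∘ e.symm =ᶠ[𝓝 q] id := by
        filter_upwards [e.open_target.mem_nhds hq] with q' hq'
        simp only [Function.comp_apply, id]
        rw [hge (e.map_target hq'), e.right_inv hq']
      have h1 := mfderiv_comp_apply q (hg.mdifferentiableAt (x := e.symm q) one_ne_zero)
        (hcq.mdifferentiableAt one_ne_zero) v
      have h2 : mfderiv 𝓘(ℝ, E) 𝓘(ℝ, E) (g ∘ e.symm) q v = (show E from v) := by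
        rw [hev.mfderiv_eq, mfderiv_id]; rfl
      have h3 := hzq (mfderiv 𝓘(ℝ, E) 𝓘(ℝ, E) e.symm q v)
      have h4 : ‖D E g (e.symm q) (mfderiv 𝓘(ℝ, E) 𝓘(ℝ, E) e.symm q v)‖ = ‖v‖ := by
        rw [D, ← h1, h2]
        exact norm_tangentSpace_congr (E := E) hgq v
      rw [h4] at h3
      rwa [inv_mul_eq_div, le_div_iff₀ hκ, mul_comm]
    obtain ⟨O, hO, hlip⟩ := exists_nhds_dist_le_of_mfderiv_le (inv_nonneg.2 hκ.le) hc hb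
    refine ⟨g ⁻¹' O ∩ e.source, inter_mem (hg.continuous.continuousAt hO)
      (e.open_source.mem_nhds hze), fun z₁ h₁ z₂ h₂ => ?_⟩
    have := hlip _ h₁.1 _ h₂.1
    have e1 : ∀ y ∈ e.source, e.symm (g y) = y := fun y hy => by rw [hge hy, e.left_inv hy]
    rw [e1 _ h₁.2, e1 _ h₂.2, inv_mul_eq_div, le_div_iff₀ hκ, mul_comm] at this
    exact this

/-- Small balls contract radially, uniformly near each point. -/
lemma exists_hasRadialContraction (E : Type*) [NormedAddCommGroup E] [NormedSpace ℝ E]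
    [FiniteDimensional ℝ E] {M : Type*} [MetricSpace M] [ChartedSpace E M] [IsManifold 𝓘(ℝ, E) 1 M]
    [RiemannianBundle (fun x : M => TangentSpace 𝓘(ℝ, E) x)]
    [IsContinuousRiemannianBundle E (fun x : M => TangentSpace 𝓘(ℝ, E) x)]
    [IsRiemannianManifold 𝓘(ℝ, E) M] (x : M) : ∃ r : ℝ, 0 < r ∧ ∃ K : ℝ, 0 < K ∧
    ∀ᶠ p in 𝓝 x, HasRadialContraction p r K := by
  -- The norm of `E` need not come from an inner product. Passing to Euclidean coordinates makes the
  -- model space Riemannian, so chart and inverse chart are both Lipschitz, and straight segments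
  -- give the contraction.
  let ε := toEuclidean (E := E)
  let F := EuclideanSpace ℝ (Fin (Module.finrank ℝ E))
  have : IsContinuousRiemannianBundle F (fun x : F => TangentSpace 𝓘(ℝ, F) x) :=
    isContinuousRiemannianBundle_of_contMDiff (n := ω)
  set φ₀ := extChartAt 𝓘(ℝ, E) x with hφ₀
  let φ : M → F := ε ∘ φ₀
  let σ : F → M := φ₀.symm ∘ ε.symm
  have hσφ : ∀ y ∈ φ₀.source, σ (φ y) = y := fun y hy => by
    simp [σ, φ, φ₀.left_inv hy]
  have hφc : ∀ᶠ q in 𝓝 x, ContMDiffAt 𝓘(ℝ, E) 𝓘(ℝ, F) 1 φ q := by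
    filter_upwards [extChartAt_source_mem_nhds (I := 𝓘(ℝ, E)) x] with q hq
    refine ContMDiffAt.comp q (ε.contDiff.contMDiff.contMDiffAt) (contMDiffAt_extChartAt' ?_)
    rwa [extChartAt_source] at hq
  have hσc : ∀ᶠ u in 𝓝 (φ x), ContMDiffAt 𝓘(ℝ, F) 𝓘(ℝ, E) 1 σ u := by
    have h1 : φ₀.target ∈ 𝓝 (ε.symm (φ x)) := by
      simp only [φ, Function.comp_apply, ContinuousLinearEquiv.symm_apply_apply]
      exact extChartAt_target_mem_nhds (I := 𝓘(ℝ, E)) x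
    filter_upwards [ε.symm.continuous.continuousAt.eventually (eventually_mem_nhds_iff.2 h1)]
      with u hu
    exact ContMDiffAt.comp u ((contMDiffOn_extChartAt_symm x).contMDiffAt hu)
      (ε.symm.contDiff.contMDiff.contMDiffAt)
  obtain ⟨C₁, hC₁, O₁, hO₁, h₁⟩ := exists_nhds_dist_le hφc
  obtain ⟨C₂, hC₂, O₂, hO₂, h₂⟩ := exists_nhds_dist_le hσc
  obtain ⟨s, hs, hsO⟩ := Metric.mem_nhds_iff.1 (inter_mem hO₂ hσc)
  have hφx : Tendsto φ (𝓝 x) (𝓝 (φ x)) := hφc.self_of_nhds.continuousAt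
  obtain ⟨ρ, hρ, hρO⟩ := Metric.mem_nhds_iff.1 (inter_mem (inter_mem hO₁
    (extChartAt_source_mem_nhds (I := 𝓘(ℝ, E)) x)) (inter_mem
      (hφx (Metric.ball_mem_nhds _ hs)) hφc))
  refine ⟨ρ / 2, by positivity, C₂ * C₁, by positivity, ?_⟩
  filter_upwards [Metric.ball_mem_nhds x (half_pos hρ)] with p hp
  have hpρ : p ∈ Metric.ball x ρ := Metric.ball_subset_ball (by linarith) hp
  have hsub : ∀ q ∈ Metric.ball p (ρ / 2), q ∈ Metric.ball x ρ := by
    intro q hq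
    rw [Metric.mem_ball] at hp hq ⊢
    linarith [dist_triangle q p x]
  have hseg : ∀ q ∈ Metric.ball p (ρ / 2), ∀ a : unitInterval,
      AffineMap.lineMap (φ p) (φ q) (a : ℝ) ∈ Metric.ball (φ x) s := by
    intro q hq a
    exact (convex_ball (φ x) s).segment_subset (hρO hpρ).2.1 (hρO (hsub q hq)).2.1
      (segment_eq_image_lineMap ℝ (φ p) (φ q) ▸ ⟨a, a.2, rfl⟩)
  refine ⟨fun a => σ (AffineMap.lineMap (φ p) (φ a.2) (a.1 : ℝ)), ?_, ?_, ?_, ?_⟩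
  · have hσon : ContinuousOn σ (Metric.ball (φ x) s) := fun u hu =>
      (hsO hu).2.continuousAt.continuousWithinAt
    refine hσon.comp_continuous ?_ fun a => hseg a.2 a.2.2 a.1
    have hφon : Continuous fun q : Metric.ball p (ρ / 2) => φ q := by
      have : ContinuousOn φ (Metric.ball x ρ) := fun u hu =>
        (hρO hu).2.2.continuousAt.continuousWithinAt
      exact this.comp_continuous continuous_subtype_val fun q => hsub q q.2
    simp only [AffineMap.lineMap_apply_module]
    exact ((continuous_const.sub (continuous_subtype_val.comp continuous_fst)).smul
      continuous_const).add ((continuous_subtype_val.comp continuous_fst).smul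
      (hφon.comp continuous_snd))
  · intro q
    simp [hσφ p (hρO hpρ).1.2]
  · intro q
    simp [hσφ q (hρO (hsub q q.2)).1.2]
  · intro q a b
    have e1 := h₂ _ (hsO (hseg q q.2 a)).1 _ (hsO (hseg q q.2 b)).1
    have e2 := h₁ _ (hρO hpρ).1.1 _ (hρO (hsub q q.2)).1.1
    rw [dist_lineMap_lineMap, Real.dist_eq, abs_sub_comm] at e1
    calc _ ≤ C₂ * (|(b : ℝ) - a| * dist (φ p) (φ q)) := e1
      _ ≤ C₂ * (|(b : ℝ) - a| * (C₁ * dist p q)) := by gcongr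
      _ = _ := by ring

end Riemannian


/-! ### Compactness, countability and the support of the measure. -/

section Topological

/-- A connected, locally compact and paracompact space is `σ`-compact. -/
lemma sigmaCompactSpace_of_isPreconnected {X : Type*} [TopologicalSpace X] [T2Space X]
    [LocallyCompactSpace X] [ParacompactSpace X] (hX : IsPreconnected (Set.univ : Set X)) :
    SigmaCompactSpace X := by
  rcases isEmpty_or_nonempty X with hX' | ⟨⟨x₀⟩⟩
  · infer_instance
  choose V hVo hxV hVc using fun x : X => exists_isOpen_mem_isCompact_closure x
  obtain ⟨W, hWo, hWu, hWf, hWV⟩ := precise_refinement V hVo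
    (Set.iUnion_eq_univ_iff.2 fun x => ⟨x, hxV x⟩)
  have hcov : ∀ x, ∃ i, x ∈ W i := fun x => Set.iUnion_eq_univ_iff.1 hWu x
  -- In the graph of intersecting cover members each vertex has finitely many neighbours, so
  -- countably many are reachable from `i₀`. Their union is open, its complement is open, and
  -- connectedness makes it everything.
  let nb : X → Set X := fun i => {j | (W j ∩ W i).Nonempty}
  have hnb : ∀ i, (nb i).Finite := fun i =>
    (hWf.finite_nonempty_inter_compact (hVc i)).subset fun j ⟨y, hy⟩ =>
      ⟨y, hy.1, subset_closure (hWV i hy.2)⟩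
  obtain ⟨i₀, hi₀⟩ := hcov x₀
  let S : ℕ → Set X := fun n => Nat.rec {i₀} (fun _ s => ⋃ i ∈ s, nb i) n
  have hS : ∀ n, (S n).Countable := by
    intro n
    induction n with
    | zero => exact Set.countable_singleton _
    | succ n ih => exact ih.biUnion fun i _ => (hnb i).countable
  set U : Set X := ⋃ i ∈ ⋃ n, S n, W i with hU
  have hUo : IsOpen U := isOpen_biUnion fun i _ => hWo i
  have hUc : IsOpen Uᶜ := by
    rw [isOpen_iff_mem_nhds]
    intro y hy
    obtain ⟨j, hj⟩ := hcov y
    filter_upwards [(hWo j).mem_nhds hj] with z hz hzU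
    obtain ⟨i, hi, hzi⟩ := Set.mem_iUnion₂.1 hzU
    obtain ⟨n, hn⟩ := Set.mem_iUnion.1 hi
    refine hy (Set.mem_iUnion₂.2 ⟨j, Set.mem_iUnion.2 ⟨n + 1, ?_⟩, hj⟩)
    exact Set.mem_iUnion₂.2 ⟨i, hn, ⟨z, hz, hzi⟩⟩
  have huniv : U = Set.univ := by
    have : PreconnectedSpace X := ⟨hX⟩
    refine IsClopen.eq_univ ⟨⟨hUc⟩, hUo⟩ ⟨x₀, Set.mem_iUnion₂.2 ⟨i₀, ?_, hi₀⟩⟩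
    exact Set.mem_iUnion.2 ⟨0, rfl⟩
  rw [← isSigmaCompact_univ_iff]
  have hσ : IsSigmaCompact (⋃ i ∈ ⋃ n, S n, closure (V i)) :=
    isSigmaCompact_biUnion (Set.countable_iUnion hS) fun i _ => (hVc i).isSigmaCompact
  refine hσ.of_isClosed_subset isClosed_univ ?_
  rw [← huniv]
  exact Set.iUnion₂_mono fun i _ => (hWV i).trans subset_closure

/-- Uniformity over compact sets of a property which holds locally for small parameters. -/
lemma IsCompact.exists_pos_eventually {X : Type*} [TopologicalSpace X] {K : Set X}
    (hK : IsCompact K) {P : ℝ → X → Prop} (hP : ∀ c c' x, 0 < c → c ≤ c' → P c' x → P c x)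
    (h : ∀ x ∈ K, ∃ c > 0, ∀ᶠ y in 𝓝 x, P c y) : ∃ c > 0, ∀ x ∈ K, P c x := by
  refine hK.induction_on (p := fun s => ∃ c > 0, ∀ x ∈ s, P c x) ⟨1, one_pos, by simp⟩ ?_ ?_ ?_
  · rintro s t hst ⟨c, hc, h⟩
    exact ⟨c, hc, fun x hx => h x (hst hx)⟩
  · rintro s t ⟨c, hc, h⟩ ⟨c', hc', h'⟩
    refine ⟨min c c', lt_min hc hc', ?_⟩
    rintro x (hx | hx)
    · exact hP _ _ _ (lt_min hc hc') (min_le_left _ _) (h x hx)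
    · exact hP _ _ _ (lt_min hc hc') (min_le_right _ _) (h' x hx)
  · intro x hx
    obtain ⟨c, hc, h⟩ := h x hx
    exact ⟨_, mem_nhdsWithin_of_mem_nhds h, c, hc, fun y hy => hy⟩

lemma HasNearGeodesics.isPreconnected_univ {M : Type*} [MetricSpace M] (h : HasNearGeodesics M) :
    IsPreconnected (Set.univ : Set M) := by
  refine isPreconnected_of_forall_pair fun x _ y _ => ?_
  obtain ⟨γ, Λ, hγ, h0, h1, -⟩ := h x y 1 one_pos
  refine ⟨γ '' Set.Icc 0 1, Set.subset_univ _, ⟨0, by simp, h0⟩, ⟨1, by simp, h1⟩, ?_⟩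
  exact isPreconnected_Icc.image _ hγ.continuousOn_path

lemma mapsTo_support {M : Type*} [TopologicalSpace M] [MeasurableSpace M] [BorelSpace M]
    {μ : Measure M} {f : M → M} (hf : Continuous f) (hμ : MeasurePreserving f μ μ) :
    Set.MapsTo f μ.support μ.support := by
  intro x hx
  rw [Measure.mem_support_iff_forall] at hx ⊢
  intro U hU
  obtain ⟨O, hOU, hO, hxO⟩ := mem_nhds_iff.1 hU
  have h1 := hx (f ⁻¹' O) (hf.continuousAt.preimage_mem_nhds (hO.mem_nhds hxO))
  rw [hμ.measure_preimage hO.measurableSet.nullMeasurableSet] at h1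
  exact h1.trans_le (measure_mono hOU)

/-- Strong transitivity on the support forces it to be compact. -/
lemma isCompact_of_stronglyTransitiveOn {M : Type*} [TopologicalSpace M] [T2Space M]
    [LocallyCompactSpace M] {f : M → M} (hf : Continuous f) {X : Set M} (hX : IsClosed X)
    (h : StronglyTransitiveOn f X) : IsCompact X := by
  rcases X.eq_empty_or_nonempty with rfl | ⟨x, hx⟩
  · exact isCompact_empty
  obtain ⟨U, hU, hxU, hUc⟩ := exists_isOpen_mem_isCompact_closure x
  obtain ⟨n, hn⟩ := h U hU ⟨x, hxU, hx⟩
  have hK : IsCompact (⋃ j ∈ Finset.range (n + 1), f^[j] '' closure U) :=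
    (Finset.range (n + 1)).isCompact_biUnion fun j _ => hUc.image (hf.iterate j)
  refine hK.of_isClosed_subset hX (hn.trans fun y hy => ?_)
  obtain ⟨j, hj, hy⟩ := Set.mem_iUnion₂.1 hy
  exact Set.mem_iUnion₂.2 ⟨j, Finset.mem_range.2 (Nat.lt_succ_of_le hj),
    Set.image_mono subset_closure hy⟩

end Topological

/-! ### Comparison of the expansion of derivatives at nearby points. -/

section DerivExpands

variable {E : Type*} [NormedAddCommGroup E] [NormedSpace ℝ E]
  {M : Type*} [MetricSpace M] [ChartedSpace E M]
  [RiemannianBundle (fun x : M => TangentSpace 𝓘(ℝ, E) x)]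

variable (E) in
/-- The derivative of `g` at `x` expands all vectors by a factor at least `κ`. -/
def DerivExpands (g : M → M) (κ : ℝ) (x : M) : Prop :=
  ∀ v : TangentSpace 𝓘(ℝ, E) x, κ * ‖v‖ ≤ ‖D E g x v‖

lemma DerivExpands.anti {g : M → M} {κ κ' : ℝ} (hκ : κ' ≤ κ) {x : M}
    (h : DerivExpands E g κ x) : DerivExpands E g κ' x := fun v =>
  (mul_le_mul_of_nonneg_right hκ (norm_nonneg v)).trans (h v)

end DerivExpands

section Comparison

variable {E : Type*} [NormedAddCommGroup E] [NormedSpace ℝ E] [FiniteDimensional ℝ E]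
  {M : Type*} [MetricSpace M] [ChartedSpace E M] [IsManifold 𝓘(ℝ, E) 1 M]
  [RiemannianBundle (fun x : M => TangentSpace 𝓘(ℝ, E) x)]
  [IsContinuousRiemannianBundle E (fun x : M => TangentSpace 𝓘(ℝ, E) x)]

lemma exists_derivExpands_of_injective {g : M → M} {x : M}
    (hx : ∀ v : TangentSpace 𝓘(ℝ, E) x, D E g x v = 0 → v = 0) :
    ∃ m : ℝ, 0 < m ∧ DerivExpands E g m x := by
  have : FiniteDimensional ℝ (TangentSpace 𝓘(ℝ, E) x) := inferInstanceAs (FiniteDimensional ℝ E)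
  have hker : LinearMap.ker (D E g x).toLinearMap = ⊥ := LinearMap.ker_eq_bot'.2 hx
  obtain ⟨K, hK, h⟩ := (D E g x).toLinearMap.exists_antilipschitzWith hker
  refine ⟨(K : ℝ)⁻¹, by positivity, fun v => ?_⟩
  have := h.le_mul_dist v 0
  rw [inv_mul_eq_div, div_le_iff₀ (by positivity), mul_comm]
  simpa using this

/-- A cross-multiplied comparison of the ratios `N / n` at two nearby points: strict on the diagonal
because `a < 1`, hence true nearby, uniformly over the compact set `S`. -/
lemma eventually_forall_mul_lt_mul {X Y : Type*} [TopologicalSpace X] [TopologicalSpace Y] {S : Set Y}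
    (hS : IsCompact S) {n N : X × Y → ℝ} {x : X} (hn : ∀ v ∈ S, ContinuousAt n (x, v))
    (hN : ∀ v ∈ S, ContinuousAt N (x, v)) (hn0 : ∀ v ∈ S, 0 < n (x, v))
    (hN0 : ∀ v ∈ S, 0 < N (x, v)) {a : ℝ} (ha : a < 1) :
    ∀ᶠ q : X × X in 𝓝 (x, x), ∀ v ∈ S,
      a * N (q.1, v) * n (q.2, v) < N (q.2, v) * n (q.1, v) ∧ 0 < n (q.1, v) := by
  refine hS.eventually_forall_of_forall_eventually (P := fun (q : X × X) v =>
    a * N (q.1, v) * n (q.2, v) < N (q.2, v) * n (q.1, v) ∧ 0 < n (q.1, v)) fun v hv => ?_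
  have c1 : ContinuousAt (fun z : (X × X) × Y => (z.1.1, z.2)) ((x, x), v) := by fun_prop
  have c2 : ContinuousAt (fun z : (X × X) × Y => (z.1.2, z.2)) ((x, x), v) := by fun_prop
  have n1 : ContinuousAt (fun z : (X × X) × Y => n (z.1.1, z.2)) ((x, x), v) :=
    ContinuousAt.comp (g := n) (hn v hv) c1
  have n2 : ContinuousAt (fun z : (X × X) × Y => n (z.1.2, z.2)) ((x, x), v) :=
    ContinuousAt.comp (g := n) (hn v hv) c2
  have N1 : ContinuousAt (fun z : (X × X) × Y => N (z.1.1, z.2)) ((x, x), v) :=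
    ContinuousAt.comp (g := N) (hN v hv) c1
  have N2 : ContinuousAt (fun z : (X × X) × Y => N (z.1.2, z.2)) ((x, x), v) :=
    ContinuousAt.comp (g := N) (hN v hv) c2
  refine ((((continuousAt_const.mul N1).mul n2).eventually_lt (N2.mul n1) ?_).and
    (n1.eventually_const_lt (hn0 v hv)))
  change a * N (x, v) * n (x, v) < N (x, v) * n (x, v)
  rw [mul_assoc]
  exact mul_lt_of_lt_one_left (mul_pos (hN0 v hv) (hn0 v hv)) ha

section
variable (e : Trivialization E (TotalSpace.proj : TangentBundle 𝓘(ℝ, E) M → M))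
  [MemTrivializationAtlas e]

lemma continuousAt_mk_symmL {x : M} (hx : x ∈ e.baseSet) (v : E) :
    ContinuousAt (fun z : M × E =>
      (⟨z.1, e.symmL ℝ z.1 z.2⟩ : TangentBundle 𝓘(ℝ, E) M)) (x, v) := by
  have h : ContinuousAt (fun z : M × E => (TotalSpace.mk' E z.1 (e.symm z.1 z.2) :
      TangentBundle 𝓘(ℝ, E) M)) (x, v) :=
    e.continuousOn_symm.continuousAt ((e.open_baseSet.prod isOpen_univ).mem_nhds ⟨hx, trivial⟩)
  refine h.congr ?_
  filter_upwards [continuousAt_fst.preimage_mem_nhds (e.open_baseSet.mem_nhds hx)] with z hz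
  rw [e.symmL_apply (R := ℝ) hz]

lemma continuousAt_norm_symmL {x : M} (hx : x ∈ e.baseSet) (v : E) :
    ContinuousAt (fun z : M × E => ‖e.symmL ℝ z.1 z.2‖) (x, v) :=
  ContinuousAt.comp (g := fun p : TangentBundle 𝓘(ℝ, E) M => ‖p.2‖)
    (f := fun z : M × E => (⟨z.1, e.symmL ℝ z.1 z.2⟩ : TangentBundle 𝓘(ℝ, E) M))
    continuous_norm_tangentBundle.continuousAt (continuousAt_mk_symmL e hx v)

lemma continuousAt_norm_deriv_symmL {g : M → M} (hg : ContMDiff 𝓘(ℝ, E) 𝓘(ℝ, E) 1 g) {x : M}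
    (hx : x ∈ e.baseSet) (v : E) :
    ContinuousAt (fun z : M × E => ‖D E g z.1 (e.symmL ℝ z.1 z.2)‖) (x, v) :=
  ContinuousAt.comp
    (g := fun p : TangentBundle 𝓘(ℝ, E) M => ‖(tangentMap 𝓘(ℝ, E) 𝓘(ℝ, E) g p).2‖)
    (f := fun z : M × E => (⟨z.1, e.symmL ℝ z.1 z.2⟩ : TangentBundle 𝓘(ℝ, E) M))
    (continuous_norm_tangentBundle.comp (hg.continuous_tangentMap le_rfl)).continuousAt
    (continuousAt_mk_symmL e hx v)

end

/-- In a trivialization, the stretching of a fixed coordinate vector varies continuously and is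
positive at `x`, so near `x` it changes by less than a factor `e`, uniformly on the unit sphere. -/
lemma eventually_derivExpands {g : M → M} (hg : ContMDiff 𝓘(ℝ, E) 𝓘(ℝ, E) 1 g) {x : M}
    (hx : ∀ v : TangentSpace 𝓘(ℝ, E) x, D E g x v = 0 → v = 0) :
    ∀ᶠ q : M × M in 𝓝 (x, x), ∀ κ, DerivExpands E g κ q.1 →
      DerivExpands E g (Real.exp (-1) * κ) q.2 := by
  set e := trivializationAt E (TangentSpace 𝓘(ℝ, E)) x with he
  have hxe : x ∈ e.baseSet := FiberBundle.mem_baseSet_trivializationAt' x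
  have hS : IsCompact (Metric.sphere (0 : E) 1) := by
    have : ProperSpace E := FiniteDimensional.proper ℝ E
    exact isCompact_sphere 0 1
  have hsv : ∀ v ∈ Metric.sphere (0 : E) 1, e.symmL ℝ x v ≠ 0 := by
    intro v hv h
    have := e.continuousLinearMapAt_symmL (R := ℝ) hxe v
    rw [h, map_zero] at this
    rw [← this] at hv
    simp at hv
  obtain ⟨n, hn⟩ : ∃ n : M × E → ℝ, ∀ q v, n (q, v) = ‖e.symmL ℝ q v‖ :=
    ⟨fun z => ‖e.symmL ℝ z.1 z.2‖, fun _ _ => rfl⟩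
  obtain ⟨N, hN⟩ : ∃ N : M × E → ℝ, ∀ q v, N (q, v) = ‖D E g q (e.symmL ℝ q v)‖ :=
    ⟨fun z => ‖D E g z.1 (e.symmL ℝ z.1 z.2)‖, fun _ _ => rfl⟩
  have hkey : ∀ᶠ q : M × M in 𝓝 (x, x), ∀ v ∈ Metric.sphere (0 : E) 1,
      Real.exp (-1) * N (q.1, v) * n (q.2, v) < N (q.2, v) * n (q.1, v) ∧ 0 < n (q.1, v) := by
    refine eventually_forall_mul_lt_mul hS (fun v _ => ?_) (fun v _ => ?_) (fun v hv => ?_)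
      (fun v hv => ?_) (by rw [Real.exp_lt_one_iff]; norm_num)
    · exact (continuousAt_norm_symmL e hxe v).congr (Eventually.of_forall fun z => (hn _ _).symm)
    · exact (continuousAt_norm_deriv_symmL e hg hxe v).congr
        (Eventually.of_forall fun z => (hN _ _).symm)
    · rw [hn]
      exact norm_pos_iff.2 (hsv v hv)
    · rw [hN]
      exact norm_pos_iff.2 fun h => hsv v hv (hx _ h)
  have hb : ∀ᶠ q : M × M in 𝓝 (x, x), q.1 ∈ e.baseSet ∧ q.2 ∈ e.baseSet :=
    (continuousAt_fst.eventually (e.open_baseSet.mem_nhds hxe)).and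
      (continuousAt_snd.eventually (e.open_baseSet.mem_nhds hxe))
  filter_upwards [hkey, hb] with q hq hqb κ hκ v
  set w := e.continuousLinearMapAt ℝ q.2 v with hw
  have hvw : e.symmL ℝ q.2 w = v := e.symmL_continuousLinearMapAt hqb.2 v
  rcases eq_or_ne w 0 with h0 | h0
  · rw [h0, map_zero] at hvw
    simp [← hvw]
  have hw0 : 0 < ‖w‖ := norm_pos_iff.2 h0
  set u := ‖w‖⁻¹ • w with hu
  have hwu : w = ‖w‖ • u := by rw [hu, smul_smul, mul_inv_cancel₀ hw0.ne', one_smul]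
  have hus : u ∈ Metric.sphere (0 : E) 1 := by
    rw [mem_sphere_zero_iff_norm, hu, norm_smul, norm_inv, norm_norm, inv_mul_cancel₀ hw0.ne']
  obtain ⟨h1, h2⟩ := hq u hus
  have h3 : κ * n (q.1, u) ≤ N (q.1, u) := by rw [hn, hN]; exact hκ _
  have h4 : Real.exp (-1) * κ * n (q.2, u) ≤ N (q.2, u) := by
    have h5 : (Real.exp (-1) * κ * n (q.2, u)) * n (q.1, u) ≤ N (q.2, u) * n (q.1, u) := by
      refine le_trans ?_ h1.le
      have h6 : 0 ≤ Real.exp (-1) * n (q.2, u) := mul_nonneg (Real.exp_pos _).le (by rw [hn]; exact norm_nonneg _)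
      calc _ = Real.exp (-1) * n (q.2, u) * (κ * n (q.1, u)) := by ring
        _ ≤ Real.exp (-1) * n (q.2, u) * N (q.1, u) := mul_le_mul_of_nonneg_left h3 h6
        _ = _ := by ring
    exact le_of_mul_le_mul_right h5 h2
  have e1 : ‖v‖ = ‖w‖ * n (q.2, u) := by
    rw [← hvw, hwu, map_smul, norm_smul, norm_norm, ← hwu, hn]
  have e2 : ‖D E g q.2 v‖ = ‖w‖ * N (q.2, u) := by
    rw [← hvw, hwu, map_smul, map_smul, norm_smul, norm_norm, ← hwu, hN]
  rw [e1, e2]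
  calc _ = ‖w‖ * (Real.exp (-1) * κ * n (q.2, u)) := by ring
    _ ≤ _ := mul_le_mul_of_nonneg_left h4 hw0.le

/-- Uniform comparison of the expansion of derivatives at nearby points. -/
lemma exists_ball_derivExpands {g : M → M} (hg : ContMDiff 𝓘(ℝ, E) 𝓘(ℝ, E) 1 g) {K : Set M}
    (hK : IsCompact K) (hx : ∀ x ∈ K, ∀ v : TangentSpace 𝓘(ℝ, E) x, D E g x v = 0 → v = 0) :
    ∃ ρ > 0, ∀ x ∈ K, ∀ z ∈ Metric.ball x ρ, ∀ κ, DerivExpands E g κ x →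
      DerivExpands E g (Real.exp (-1) * κ) z := by
  have h : ∀ x : K, ∃ U : Set M, IsOpen U ∧ (x : M) ∈ U ∧ ∀ y ∈ U, ∀ z ∈ U, ∀ κ,
      DerivExpands E g κ y → DerivExpands E g (Real.exp (-1) * κ) z := by
    intro x
    have := eventually_derivExpands hg (hx x x.2)
    rw [nhds_prod_eq] at this
    obtain ⟨t, ht, h⟩ := Filter.mem_prod_self_iff.1 this
    obtain ⟨U, hUt, hU, hxU⟩ := mem_nhds_iff.1 ht
    exact ⟨U, hU, hxU, fun y hy z hz => h (Set.mk_mem_prod (hUt hy) (hUt hz))⟩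
  choose U hU hxU h using h
  obtain ⟨ρ, hρ, hρU⟩ := lebesgue_number_lemma_of_metric hK hU
    fun x hx => Set.mem_iUnion.2 ⟨⟨x, hx⟩, hxU _⟩
  refine ⟨ρ, hρ, fun x hx z hz κ hκ => ?_⟩
  obtain ⟨i, hi⟩ := hρU x hx
  exact h i x (hi (Metric.mem_ball_self hρ)) z (hi hz) κ hκ

lemma exists_derivExpands_of_isCompact {g : M → M} (hg : ContMDiff 𝓘(ℝ, E) 𝓘(ℝ, E) 1 g)
    {K : Set M} (hK : IsCompact K)
    (hx : ∀ x ∈ K, ∀ v : TangentSpace 𝓘(ℝ, E) x, D E g x v = 0 → v = 0) :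
    ∃ m > 0, ∀ x ∈ K, DerivExpands E g m x := by
  refine IsCompact.exists_pos_eventually hK (fun c c' x _ hc h => h.anti hc) fun x hxK => ?_
  obtain ⟨m, hm, h⟩ := exists_derivExpands_of_injective (hx x hxK)
  refine ⟨Real.exp (-1) * m, by positivity, ?_⟩
  have := eventually_derivExpands hg (hx x hxK)
  have h2 : Tendsto (fun z : M => (x, z)) (𝓝 x) (𝓝 (x, x)) :=
    (Continuous.prodMk_right x).continuousAt
  filter_upwards [h2.eventually this] with z hz
  exact hz m h

end Comparison


/-! ### Determinants read in bounded frames. -/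

section Determinant

variable {V W : Type*} [NormedAddCommGroup V] [InnerProductSpace ℝ V] [FiniteDimensional ℝ V]
  [NormedAddCommGroup W] [InnerProductSpace ℝ W] [FiniteDimensional ℝ W]

lemma absDet_eq_abs_det_toMatrix {n : Type*} [Fintype n] [DecidableEq n] (b : OrthonormalBasis n ℝ V)
    (b' : OrthonormalBasis n ℝ W) (S : V →L[ℝ] W) :
    absDet S = |(LinearMap.toMatrix b.toBasis b'.toBasis S.toLinearMap).det| := by
  rw [absDet, ← LinearMap.det_toMatrix b.toBasis,
    LinearMap.toMatrix_comp b.toBasis b'.toBasis b.toBasis, LinearMap.toMatrix_adjoint,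
    Matrix.det_mul, Matrix.det_conjTranspose, star_trivial, Real.sqrt_mul_self_eq_abs]

/-- The determinant of a linear map, read in bounded frames, is controlled by `absDet`. -/
lemma exists_abs_det_le_mul_absDet (E : Type*) [NormedAddCommGroup E] [NormedSpace ℝ E]
    [FiniteDimensional ℝ E] (c : ℝ) : ∃ B : ℝ, 0 < B ∧
    ∀ {V W : Type*} [NormedAddCommGroup V] [InnerProductSpace ℝ V] [FiniteDimensional ℝ V]
      [NormedAddCommGroup W] [InnerProductSpace ℝ W] [FiniteDimensional ℝ W]
      (Φ : E ≃L[ℝ] V) (Ψ : E ≃L[ℝ] W) (S : V →L[ℝ] W) (A : E →L[ℝ] E),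
      (∀ v, ‖Φ v‖ ≤ c * ‖v‖) → (∀ v, ‖v‖ ≤ c * ‖Ψ v‖) → (∀ v, Ψ (A v) = S (Φ v)) →
      |LinearMap.det A.toLinearMap| ≤ B * absDet S := by
  set d := Module.finrank ℝ E with hd
  let β := Module.finBasis ℝ E
  obtain ⟨R, hR0, hR1, hR2⟩ : ∃ R : ℝ, 0 < R ∧ (∀ i, c * ‖β i‖ ≤ R) ∧
      ∀ i, ‖(β.coord i).toContinuousLinearMap‖ * c ≤ R := by
    refine ⟨1 + ∑ i, |c * ‖β i‖| + ∑ i, |‖(β.coord i).toContinuousLinearMap‖ * c|, ?_, ?_, ?_⟩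
    · positivity
    · intro i
      have h1 : |c * ‖β i‖| ≤ ∑ i, |c * ‖β i‖| := Finset.single_le_sum
        (f := fun i => |c * ‖β i‖|) (fun j _ => abs_nonneg _) (Finset.mem_univ i)
      have h2 : 0 ≤ ∑ i, |‖(β.coord i).toContinuousLinearMap‖ * c| :=
        Finset.sum_nonneg fun j _ => abs_nonneg _
      have h3 := le_abs_self (c * ‖β i‖)
      linarith
    · intro i
      have h1 : |‖(β.coord i).toContinuousLinearMap‖ * c| ≤
          ∑ i, |‖(β.coord i).toContinuousLinearMap‖ * c| := Finset.single_le_sum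
        (f := fun i => |‖(β.coord i).toContinuousLinearMap‖ * c|)
        (fun j _ => abs_nonneg _) (Finset.mem_univ i)
      have h2 : 0 ≤ ∑ i, |c * ‖β i‖| := Finset.sum_nonneg fun j _ => abs_nonneg _
      have h3 := le_abs_self (‖(β.coord i).toContinuousLinearMap‖ * c)
      linarith
  -- The changes of frame have matrix entries at most `R` in orthonormal bases, hence determinants
  -- at most `d! * R ^ d`; one such factor comes from each side.
  set B₀ : ℝ := (d.factorial : ℝ) * R ^ d with hB₀
  have hB₀0 : 0 < B₀ := by positivity
  have hdet : ∀ m : Matrix (Fin d) (Fin d) ℝ, (∀ i j, |m i j| ≤ R) → |m.det| ≤ B₀ := by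
    intro m hm
    have := Matrix.det_le (abv := AbsoluteValue.abs) (A := m) (x := R) hm
    simpa [hB₀, nsmul_eq_mul] using this
  refine ⟨B₀ * B₀, by positivity, ?_⟩
  intro V W _ _ _ _ _ _ Φ Ψ S A hΦ hΨ hA
  have hV : Module.finrank ℝ V = d := Φ.toLinearEquiv.finrank_eq.symm
  have hW : Module.finrank ℝ W = d := Ψ.toLinearEquiv.finrank_eq.symm
  let b := (stdOrthonormalBasis ℝ V).reindex (finCongr hV)
  let b' := (stdOrthonormalBasis ℝ W).reindex (finCongr hW)
  have hΦm : |(LinearMap.toMatrix β b.toBasis Φ.toLinearEquiv.toLinearMap).det| ≤ B₀ := by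
    refine hdet _ fun i j => ?_
    rw [LinearMap.toMatrix_apply]
    change |b.repr (Φ (β j)) i| ≤ R
    rw [OrthonormalBasis.repr_apply_apply]
    refine (abs_real_inner_le_norm _ _).trans ?_
    rw [b.norm_eq_one, one_mul]
    exact (hΦ _).trans (hR1 j)
  have hΨm : |(LinearMap.toMatrix b'.toBasis β Ψ.symm.toLinearEquiv.toLinearMap).det| ≤ B₀ := by
    refine hdet _ fun i j => ?_
    rw [LinearMap.toMatrix_apply]
    have h1 := (β.coord i).toContinuousLinearMap.le_opNorm (Ψ.symm (b' j))
    have h2 := hΨ (Ψ.symm (b' j))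
    rw [Ψ.apply_symm_apply, b'.norm_eq_one, mul_one] at h2
    have h3 : |β.repr (Ψ.symm (b' j)) i| ≤ ‖(β.coord i).toContinuousLinearMap‖ * c :=
      h1.trans (mul_le_mul_of_nonneg_left h2 (norm_nonneg _))
    have h4 := h3.trans (hR2 i)
    simpa using h4
  have hcomp : A.toLinearMap = Ψ.symm.toLinearEquiv.toLinearMap ∘ₗ (S.toLinearMap ∘ₗ
      Φ.toLinearEquiv.toLinearMap) := by
    ext v
    change A v = Ψ.symm (S (Φ v))
    rw [← hA, Ψ.symm_apply_apply]
  rw [← LinearMap.det_toMatrix β, hcomp, LinearMap.toMatrix_comp β b'.toBasis β,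
    LinearMap.toMatrix_comp β b.toBasis b'.toBasis, Matrix.det_mul, Matrix.det_mul, abs_mul,
    abs_mul, ← absDet_eq_abs_det_toMatrix]
  have h0 : 0 ≤ absDet S := Real.sqrt_nonneg _
  calc _ ≤ B₀ * (absDet S * B₀) := by gcongr
    _ = _ := by ring

end Determinant

/-! ### The derivative as a bounded measurable cocycle. -/

section Frame

variable {E : Type*} [NormedAddCommGroup E] [NormedSpace ℝ E]
  {M : Type*} [MetricSpace M] [ChartedSpace E M]
  [RiemannianBundle (fun x : M => TangentSpace 𝓘(ℝ, E) x)] [MeasurableSpace M]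

/-- A family of linear coordinates on the tangent spaces in which the derivative of `f` is a
bounded measurable cocycle, with uniform constants on `K`. -/
structure BoundedFrame (E : Type*) [NormedAddCommGroup E] [NormedSpace ℝ E]
    {M : Type*} [MetricSpace M] [ChartedSpace E M] [MeasurableSpace M]
    [RiemannianBundle (fun x : M => TangentSpace 𝓘(ℝ, E) x)] (f : M → M) (K : Set M) where
  /-- The coordinates. -/
  frame : ∀ x : M, E ≃L[ℝ] TangentSpace 𝓘(ℝ, E) x
  /-- The derivative in coordinates. -/
  deriv : M → E →L[ℝ] E
  /-- The distortion of the coordinates. -/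
  const : ℝ
  one_le_const : 1 ≤ const
  norm_frame_le : ∀ x ∈ K, ∀ v, ‖frame x v‖ ≤ const * ‖v‖
  norm_le_frame : ∀ x ∈ K, ∀ v, ‖v‖ ≤ const * ‖frame x v‖
  measurable_deriv : Measurable deriv
  exists_norm_deriv_le : ∃ C, 1 ≤ C ∧ ∀ x, ‖deriv x‖ ≤ C
  frame_deriv : ∀ x ∈ K, ∀ v, frame (f x) (deriv x v) = D E f x (frame x v)

lemma BoundedFrame.frame_cocycle {f : M → M} {K : Set M} (Φ : BoundedFrame E f K)
    (hf : ContMDiff 𝓘(ℝ, E) 𝓘(ℝ, E) 1 f) (hfK : Set.MapsTo f K K)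
    (n : ℕ) {x : M} (hx : x ∈ K) (v : E) :
    Φ.frame (f^[n] x) (cocycle Φ.deriv f n x v) = D E f^[n] x (Φ.frame x v) := by
  induction n generalizing x v with
  | zero =>
    change Φ.frame x v = mfderiv 𝓘(ℝ, E) 𝓘(ℝ, E) id x (Φ.frame x v)
    rw [mfderiv_id]; rfl
  | succ n ih =>
    have h1 := ih (hfK hx) (Φ.deriv x v)
    rw [Φ.frame_deriv x hx] at h1
    have h2 := mfderiv_comp_apply x
      ((hf.iterate n).mdifferentiableAt (x := f x) one_ne_zero)
      (hf.mdifferentiableAt (x := x) one_ne_zero) (Φ.frame x v)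
    exact h1.trans h2.symm

/-- Positivity of all the Lyapunov exponents, in coordinates. -/
lemma BoundedFrame.growsExponentially {f : M → M} {K : Set M} (Φ : BoundedFrame E f K)
    (hf : ContMDiff 𝓘(ℝ, E) 𝓘(ℝ, E) 1 f)
    (hfK : Set.MapsTo f K K) {x : M} (hx : x ∈ K)
    (h : ∀ v : TangentSpace 𝓘(ℝ, E) x, v ≠ 0 → 0 < lyapunovExponent f x v) :
    GrowsExponentially Φ.deriv f x := by
  intro v hv
  have hv' : Φ.frame x v ≠ 0 := fun h => hv (by
    rw [← (Φ.frame x).symm_apply_apply v, h, map_zero])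
  have h1 := h _ hv'
  obtain ⟨a, ha0, ha⟩ := EReal.lt_iff_exists_real_btwn.1 h1
  have ha0 : 0 < a := by exact_mod_cast ha0
  -- Half of the exponential rate absorbs the bounded distortion of the frame.
  refine ⟨a / 2, by positivity, ?_⟩
  have hfr := Filter.frequently_lt_of_lt_limsup (by isBoundedDefault) ha
  have hbig : ∀ᶠ n : ℕ in atTop, Φ.const < Real.exp (a / 2 * n) :=
    (Real.tendsto_exp_atTop.comp (tendsto_natCast_atTop_atTop.const_mul_atTop
      (half_pos ha0))).eventually_gt_atTop _
  refine (hfr.and_eventually (hbig.and (eventually_gt_atTop 0))).mono ?_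
  rintro n ⟨h2, h3, h4⟩
  have hn : (0 : ℝ) < n := by exact_mod_cast h4
  have h5 : Real.exp (a * n) < ‖D E f^[n] x (Φ.frame x v)‖ := by
    by_contra! hcon
    have h6 : ENNReal.log ‖D E f^[n] x (Φ.frame x v)‖ₑ ≤ ((a * n : ℝ) : EReal) := by
      rw [← Real.log_exp (a * n), ← ENNReal.log_ofReal_of_pos (Real.exp_pos _),
        ← ofReal_norm]
      exact ENNReal.log_le_log (ENNReal.ofReal_le_ofReal hcon)
    rw [EReal.lt_div_iff (by exact_mod_cast h4) (EReal.natCast_ne_top n)] at h2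
    refine h2.not_ge (h6.trans ?_)
    push_cast
    exact le_rfl
  rw [← Φ.frame_cocycle hf hfK n hx] at h5
  have hmem : f^[n] x ∈ K := hfK.iterate n hx
  have h7 := Φ.norm_frame_le _ hmem (cocycle Φ.deriv f n x v)
  have hc : 0 < Φ.const := one_pos.trans_le Φ.one_le_const
  have h8 : Real.exp (a * n) = Real.exp (a / 2 * n) * Real.exp (a / 2 * n) := by
    rw [← Real.exp_add]; congr 1; ring
  rw [h8] at h5
  have h9 : Φ.const * Real.exp (a / 2 * n) < Φ.const * ‖cocycle Φ.deriv f n x v‖ :=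
    (mul_lt_mul_of_pos_right h3 (Real.exp_pos _)).trans (h5.trans_le h7)
  exact lt_of_mul_lt_mul_left h9 hc.le

end Frame

section ExistsFrame

variable {E : Type*} [NormedAddCommGroup E] [NormedSpace ℝ E] [FiniteDimensional ℝ E]
  {M : Type*} [MetricSpace M] [ChartedSpace E M] [IsManifold 𝓘(ℝ, E) 1 M]
  [RiemannianBundle (fun x : M => TangentSpace 𝓘(ℝ, E) x)]
  [IsContinuousRiemannianBundle E (fun x : M => TangentSpace 𝓘(ℝ, E) x)]

lemma continuousOn_deriv_trivialization {f : M → M} (hf : ContMDiff 𝓘(ℝ, E) 𝓘(ℝ, E) 1 f)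
    (e e' : Trivialization E (TotalSpace.proj : TangentBundle 𝓘(ℝ, E) M → M))
    [MemTrivializationAtlas e] [MemTrivializationAtlas e'] :
    ContinuousOn (fun x => ((e'.continuousLinearMapAt ℝ (f x)).comp
      ((D E f x).comp (e.symmL ℝ x)) : E →L[ℝ] E)) (e.baseSet ∩ f ⁻¹' e'.baseSet) := by
  rw [continuousOn_clm_apply]
  intro v x hx
  apply ContinuousAt.continuousWithinAt
  have h1 : ContinuousAt (fun z : M => (⟨z, e.symmL ℝ z v⟩ : TangentBundle 𝓘(ℝ, E) M)) x :=
    ContinuousAt.comp (f := fun z : M => (z, v))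
      (g := fun z : M × E => (⟨z.1, e.symmL ℝ z.1 z.2⟩ : TangentBundle 𝓘(ℝ, E) M))
      (continuousAt_mk_symmL e hx.1 v) (by fun_prop)
  have h2 : ContinuousAt (fun z : M => tangentMap 𝓘(ℝ, E) 𝓘(ℝ, E) f
      (⟨z, e.symmL ℝ z v⟩ : TangentBundle 𝓘(ℝ, E) M)) x :=
    (hf.continuous_tangentMap le_rfl).continuousAt.comp h1
  have h3 : ContinuousAt (fun z : M => (e' (tangentMap 𝓘(ℝ, E) 𝓘(ℝ, E) f
      (⟨z, e.symmL ℝ z v⟩ : TangentBundle 𝓘(ℝ, E) M))).2) x := by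
    refine continuousAt_snd.comp (ContinuousAt.comp (g := e') ?_ h2)
    exact e'.continuousOn.continuousAt (e'.open_source.mem_nhds (e'.mem_source.2 hx.2))
  refine h3.congr ?_
  filter_upwards [hf.continuous.continuousAt.preimage_mem_nhds
    (e'.open_baseSet.mem_nhds hx.2)] with z hz
  exact (e'.continuousLinearMapAt_apply_of_mem (R := ℝ) hz _).symm

-- A measurable choice among finitely many cover members, with a prescribed fallback off the cover.
-- It selects the trivialization used at each point.
open Classical in
lemma exists_measurable_index {X I : Type*} [MeasurableSpace X] {U : I → Set X}
    (hU : ∀ i, MeasurableSet (U i)) (t : Finset I) (i₀ : X → I) :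
    ∃ ι : X → I, (∀ x ∈ ⋃ i ∈ t, U i, ι x ∈ t ∧ x ∈ U (ι x)) ∧
      (∀ x ∉ ⋃ i ∈ t, U i, ι x = i₀ x) ∧
      ∀ i ∈ t, MeasurableSet ((⋃ i ∈ t, U i) ∩ {x | ι x = i}) := by
  induction t using Finset.induction_on with
  | empty => exact ⟨i₀, by simp, by simp, by simp⟩
  | insert p s hp ih =>
    obtain ⟨ι, h1, -, h3⟩ := ih
    rw [Finset.set_biUnion_insert]
    have hT : MeasurableSet (⋃ i ∈ s, U i) := s.measurableSet_biUnion fun i _ => hU i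
    set T := ⋃ i ∈ s, U i
    refine ⟨fun x => if x ∈ T then ι x else if x ∈ U p then p else i₀ x, ?_, ?_, ?_⟩
    · intro x hx
      by_cases hxT : x ∈ T
      · simp only [hxT, if_true]
        exact ⟨Finset.mem_insert_of_mem (h1 x hxT).1, (h1 x hxT).2⟩
      · have hxp := hx.resolve_right hxT
        beta_reduce
        rw [if_neg hxT, if_pos hxp]
        exact ⟨Finset.mem_insert_self _ _, hxp⟩
    · intro x hx
      rw [Set.mem_union, not_or] at hx
      simp [hx.1, hx.2]
    · intro q hq
      rcases Finset.mem_insert.1 hq with rfl | hq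
      · have : (U q ∪ T) ∩ {x | (if x ∈ T then ι x else if x ∈ U q then q else i₀ x) = q} =
            U q \ T := by
          ext x
          by_cases hxT : x ∈ T
          · have : ι x ≠ q := fun h => hp (h ▸ (h1 x hxT).1)
            simp [hxT, this]
          · by_cases hxq : x ∈ U q <;> simp [hxT, hxq]
        rw [this]
        exact (hU q).diff hT
      · have : (U p ∪ T) ∩ {x | (if x ∈ T then ι x else if x ∈ U p then p else i₀ x) = q} =
            T ∩ {x | ι x = q} := by
          ext x
          have hpq : p ≠ q := fun h => hp (h ▸ hq)
          by_cases hxT : x ∈ T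
          · simp [hxT]
          · by_cases hxp : x ∈ U p <;> simp [hxT, hxp, hpq]
        rw [this]
        exact h3 q hq

-- Finitely many trivializations with bounded distortion cover the compact set; a measurable
-- selection among them gives the frame, which need not be continuous. The coordinate derivative is
-- set to zero off `K` so that it is bounded everywhere.
open Classical in
lemma exists_boundedFrame [MeasurableSpace M] [BorelSpace M] {f : M → M}
    (hf : ContMDiff 𝓘(ℝ, E) 𝓘(ℝ, E) 1 f) {K : Set M} (hK : IsCompact K) (hfK : Set.MapsTo f K K) :
    Nonempty (BoundedFrame E f K) := by
  let e : M → Trivialization E (TotalSpace.proj : TangentBundle 𝓘(ℝ, E) M → M) :=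
    fun p => trivializationAt E (TangentSpace 𝓘(ℝ, E)) p
  have hU : ∀ p : M, ∃ U : Set M, IsOpen U ∧ p ∈ U ∧ U ⊆ (e p).baseSet ∧ ∃ c : ℝ,
      ∀ x ∈ U, (∀ v, ‖(e p).symmL ℝ x v‖ ≤ c * ‖v‖) ∧
        ∀ v, ‖(e p).continuousLinearMapAt ℝ x v‖ ≤ c * ‖v‖ := by
    intro p
    obtain ⟨C₁, hC₁, h₁⟩ := eventually_norm_trivializationAt_lt E
      (fun x : M => TangentSpace 𝓘(ℝ, E) x) p
    obtain ⟨C₂, hC₂, h₂⟩ := eventually_norm_symmL_trivializationAt_lt E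
      (fun x : M => TangentSpace 𝓘(ℝ, E) x) p
    obtain ⟨U, hU, hUo, hpU⟩ := eventually_nhds_iff.1 (h₁.and (h₂.and
      ((e p).open_baseSet.mem_nhds (FiberBundle.mem_baseSet_trivializationAt' p))))
    refine ⟨U, hUo, hpU, fun x hx => (hU x hx).2.2, C₁ + C₂, fun x hx => ⟨fun v => ?_, fun v => ?_⟩⟩
    · refine (ContinuousLinearMap.le_of_opNorm_le _ (hU x hx).2.1.le v).trans ?_
      gcongr; linarith
    · refine (ContinuousLinearMap.le_of_opNorm_le _ (hU x hx).1.le v).trans ?_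
      gcongr; linarith
  choose U hUo hpU hUe c hc using hU
  obtain ⟨t, -, htK⟩ := hK.elim_nhds_subcover U fun p _ => (hUo p).mem_nhds (hpU p)
  obtain ⟨ι, hι, hι', hιm⟩ := exists_measurable_index (fun p => (hUo p).measurableSet) t
    (id : M → M)
  have hbase : ∀ x, x ∈ (e (ι x)).baseSet := by
    intro x
    by_cases hx : x ∈ ⋃ p ∈ t, U p
    · exact hUe _ (hι x hx).2
    · rw [hι' x hx]
      exact FiberBundle.mem_baseSet_trivializationAt' x
  obtain ⟨c₀, hc₀1, hc₀⟩ : ∃ c₀ : ℝ, 1 ≤ c₀ ∧ ∀ p ∈ t, c p ≤ c₀ := by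
    refine ⟨1 + ∑ p ∈ t, |c p|, by
      have : 0 ≤ ∑ p ∈ t, |c p| := Finset.sum_nonneg fun _ _ => abs_nonneg _
      linarith, fun p hp => ?_⟩
    have h1 : |c p| ≤ ∑ p ∈ t, |c p| :=
      Finset.single_le_sum (f := fun p => |c p|) (fun _ _ => abs_nonneg _) hp
    linarith [le_abs_self (c p)]
  have hcK : ∀ x ∈ K, (∀ v, ‖(e (ι x)).symmL ℝ x v‖ ≤ c₀ * ‖v‖) ∧
        ∀ v, ‖(e (ι x)).continuousLinearMapAt ℝ x v‖ ≤ c₀ * ‖v‖ := by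
    intro x hx
    obtain ⟨h1, h2⟩ := hι x (htK hx)
    obtain ⟨h3, h4⟩ := hc _ x h2
    exact ⟨fun v => (h3 v).trans (mul_le_mul_of_nonneg_right (hc₀ _ h1) (norm_nonneg _)),
      fun v => (h4 v).trans (mul_le_mul_of_nonneg_right (hc₀ _ h1) (norm_nonneg _))⟩
  let G : M → M → M → E →L[ℝ] E := fun p q x => ((e q).continuousLinearMapAt ℝ (f x)).comp
      ((D E f x).comp ((e p).symmL ℝ x))
  let S : M → M → Set M := fun p q => (K ∩ {x | ι x = p}) ∩ f ⁻¹' (K ∩ {x | ι x = q})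
  have hKm : ∀ p ∈ t, MeasurableSet (K ∩ {x | ι x = p}) := by
    intro p hp
    have : K ∩ {x | ι x = p} = K ∩ ((⋃ p ∈ t, U p) ∩ {x | ι x = p}) := by
      rw [← Set.inter_assoc, Set.inter_eq_left.2 htK]
    rw [this]
    exact hK.measurableSet.inter (hιm p hp)
  -- At most one summand is nonzero at each point; as a finite sum of continuous pieces on
  -- measurable sets, `A` is measurable.
  let A : M → E →L[ℝ] E := fun x => ∑ p ∈ t, ∑ q ∈ t, (S p q).piecewise (G p q) (fun _ => 0) x
  have hAK : ∀ x ∈ K, A x = G (ι x) (ι (f x)) x := by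
    intro x hx
    have h1 := (hι x (htK hx)).1
    have h2 := (hι (f x) (htK (hfK hx))).1
    change ∑ p ∈ t, ∑ q ∈ t, (S p q).piecewise (G p q) (fun _ => 0) x = _
    rw [Finset.sum_eq_single_of_mem _ h1, Finset.sum_eq_single_of_mem _ h2]
    · exact Set.piecewise_eq_of_mem _ _ _ ⟨⟨hx, rfl⟩, hfK hx, rfl⟩
    · exact fun q _ hq => Set.piecewise_eq_of_notMem _ _ _ fun h => hq h.2.2.symm
    · exact fun p _ hp => Finset.sum_eq_zero fun q _ =>
        Set.piecewise_eq_of_notMem _ _ _ fun h => hp h.1.2.symm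
  have hA0 : ∀ x ∉ K, A x = 0 := fun x hx => Finset.sum_eq_zero fun p _ =>
    Finset.sum_eq_zero fun q _ => Set.piecewise_eq_of_notMem _ _ _ fun h => hx h.1.1
  have hAm : Measurable A := by
    refine Finset.measurable_fun_sum _ fun p hp => Finset.measurable_fun_sum _ fun q hq => ?_
    refine ContinuousOn.measurable_piecewise ?_ continuousOn_const
      ((hKm p hp).inter (hf.continuous.measurable (hKm q hq)))
    refine (continuousOn_deriv_trivialization hf (e p) (e q)).mono fun x hx => ⟨?_, ?_⟩
    · have := hbase x
      rwa [hx.1.2] at this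
    · have := hbase (f x)
      rwa [hx.2.2] at this
  obtain ⟨m, hm, hmK⟩ : ∃ m > 0, ∀ x ∈ K, ∀ v : TangentSpace 𝓘(ℝ, E) x,
      ‖D E f x v‖ ≤ m⁻¹ * ‖v‖ := by
    refine IsCompact.exists_pos_eventually hK (fun c c' x hc hcc h v => (h v).trans ?_)
      fun x _ => ?_
    · gcongr
    · obtain ⟨C, hC, h⟩ := exists_eventually_mfderiv_le (hf.contMDiffAt (x := x))
      exact ⟨C⁻¹, inv_pos.2 hC, by simpa only [inv_inv] using h⟩
  refine ⟨⟨fun x => ((e (ι x)).continuousLinearEquivAt ℝ x (hbase x)).symm, A, c₀, hc₀1,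
    fun x hx v => ?_, fun x hx v => ?_, hAm, ⟨1 + c₀ * (m⁻¹ * c₀), ?_, fun x => ?_⟩,
    fun x hx v => ?_⟩⟩
  · rw [(e (ι x)).symm_continuousLinearEquivAt_eq]
    exact (hcK x hx).1 v
  · have := (hcK x hx).2 (((e (ι x)).continuousLinearEquivAt ℝ x (hbase x)).symm v)
    rwa [← (e (ι x)).coe_continuousLinearEquivAt_eq (hbase x),
      ContinuousLinearEquiv.apply_symm_apply] at this
  · have : 0 ≤ c₀ * (m⁻¹ * c₀) := by positivity
    linarith
  · by_cases hx : x ∈ K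
    · rw [hAK x hx]
      refine ContinuousLinearMap.opNorm_le_bound _ (by positivity) fun v => ?_
      change ‖(e (ι (f x))).continuousLinearMapAt ℝ (f x) (D E f x ((e (ι x)).symmL ℝ x v))‖ ≤ _
      calc _ ≤ c₀ * ‖D E f x ((e (ι x)).symmL ℝ x v)‖ := (hcK _ (hfK hx)).2 _
        _ ≤ c₀ * (m⁻¹ * (c₀ * ‖v‖)) := by
            gcongr
            refine (hmK x hx _).trans ?_
            gcongr
            exact (hcK x hx).1 v
        _ = (c₀ * (m⁻¹ * c₀)) * ‖v‖ := by ring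
        _ ≤ _ := by gcongr; linarith
    · rw [hA0 x hx, norm_zero]; positivity
  · rw [hAK x hx, (e (ι (f x))).symm_continuousLinearEquivAt_eq,
      (e (ι x)).symm_continuousLinearEquivAt_eq]
    exact (e (ι (f x))).symmL_continuousLinearMapAt (hbase (f x)) _

end ExistsFrame


/-- The best expansion factor of an isomorphism is the reciprocal of the norm of its inverse.
Nontriviality of `V` rules out a zero norm, where `Real.log` takes the default value `0`. -/
lemma mul_norm_le_of_abs_log_sub_le {V W V' W' : Type*} [NormedAddCommGroup V] [NormedSpace ℝ V]
    [NormedAddCommGroup W] [NormedSpace ℝ W] [NormedAddCommGroup V'] [NormedSpace ℝ V']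
    [NormedAddCommGroup W'] [NormedSpace ℝ W'] (S : V ≃L[ℝ] W) (S' : V' ≃L[ℝ] W')
    (hV : Nontrivial V)
    (h : |Real.log ‖(S : V →L[ℝ] W).inverse‖ - Real.log ‖(S' : V' →L[ℝ] W').inverse‖| ≤ 1)
    {κ : ℝ} (hκ : ∀ v, κ * ‖v‖ ≤ ‖S v‖) (v : V') : Real.exp (-1) * κ * ‖v‖ ≤ ‖S' v‖ := by
  rcases le_or_gt κ 0 with hκ0 | hκ0
  · have : Real.exp (-1) * κ * ‖v‖ ≤ 0 := mul_nonpos_of_nonpos_of_nonneg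
      (mul_nonpos_of_nonneg_of_nonpos (Real.exp_pos _).le hκ0) (norm_nonneg _)
    exact this.trans (norm_nonneg _)
  rcases eq_or_ne v 0 with rfl | hv
  · simp
  rw [ContinuousLinearMap.inverse_equiv, ContinuousLinearMap.inverse_equiv] at h
  have h1 : ∀ w : V, ‖w‖ ≤ ‖(S.symm : W →L[ℝ] V)‖ * ‖S w‖ := fun w => by
    simpa using (S.symm : W →L[ℝ] V).le_opNorm (S w)
  have h2 : ∀ w : V', ‖w‖ ≤ ‖(S'.symm : W' →L[ℝ] V')‖ * ‖S' w‖ := fun w => by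
    simpa using (S'.symm : W' →L[ℝ] V').le_opNorm (S' w)
  have p1 : 0 < ‖(S.symm : W →L[ℝ] V)‖ := by
    obtain ⟨w, hw⟩ := exists_ne (0 : V)
    by_contra! hcon
    have := (h1 w).trans (mul_nonpos_of_nonpos_of_nonneg hcon (norm_nonneg _))
    exact hw (norm_le_zero_iff.1 this)
  have p2 : 0 < ‖(S'.symm : W' →L[ℝ] V')‖ := by
    by_contra! hcon
    have := (h2 v).trans (mul_nonpos_of_nonpos_of_nonneg hcon (norm_nonneg _))
    exact hv (norm_le_zero_iff.1 this)
  have h3 : ‖(S.symm : W →L[ℝ] V)‖ ≤ κ⁻¹ := by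
    refine ContinuousLinearMap.opNorm_le_bound _ (by positivity) fun w => ?_
    rw [inv_mul_eq_div, le_div_iff₀ hκ0, mul_comm]
    simpa using hκ (S.symm w)
  have h4 : ‖(S'.symm : W' →L[ℝ] V')‖ ≤ Real.exp 1 * κ⁻¹ := by
    rw [abs_le] at h
    rw [← Real.log_le_log_iff p2 (by positivity), Real.log_mul (by positivity) (by positivity),
      Real.log_exp]
    have := Real.log_le_log p1 h3
    linarith
  have h5 := (h2 v).trans (mul_le_mul_of_nonneg_right h4 (norm_nonneg (S' v)))
  calc Real.exp (-1) * κ * ‖v‖ ≤ Real.exp (-1) * κ * (Real.exp 1 * κ⁻¹ * ‖S' v‖) := by gcongr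
    _ = Real.exp (-1) * Real.exp 1 * (κ * κ⁻¹) * ‖S' v‖ := by ring
    _ = ‖S' v‖ := by
      rw [← Real.exp_add, mul_inv_cancel₀ hκ0.ne']; simp

lemma exp_neg_abs_log_le {d : ℝ} (hd : 0 < d) : Real.exp (-|Real.log d|) ≤ d := by
  conv_rhs => rw [← Real.exp_log hd]
  exact Real.exp_le_exp.2 (neg_abs_le _)

section Critical

variable {E : Type*} [NormedAddCommGroup E] [NormedSpace ℝ E] [FiniteDimensional ℝ E]
  {M : Type*} [MetricSpace M] [ChartedSpace E M] [IsManifold 𝓘(ℝ, E) 1 M]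

lemma mem_compl_criticalSet_of_injective {f : M → M} (hf : ContMDiff 𝓘(ℝ, E) 𝓘(ℝ, E) 1 f) {x : M}
    (hx : ∀ v : TangentSpace 𝓘(ℝ, E) x, D E f x v = 0 → v = 0) : x ∉ criticalSet E f :=
  not_not.2 (isLocalDiffeomorphAt_of_mfderiv_injective hf.contMDiffAt hx)

end Critical

section Frame

variable {E : Type*} [NormedAddCommGroup E] [NormedSpace ℝ E]
  {M : Type*} [MetricSpace M] [ChartedSpace E M] [MeasurableSpace M]
  [RiemannianBundle (fun x : M => TangentSpace 𝓘(ℝ, E) x)]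

lemma BoundedFrame.injective_mfderiv {f : M → M} {X : Set M} (Φ : BoundedFrame E f X) {x : M}
    (hx : x ∈ X) (h : Function.Injective (Φ.deriv x)) (v : TangentSpace 𝓘(ℝ, E) x)
    (hv : D E f x v = 0) : v = 0 := by
  obtain ⟨w, rfl⟩ := (Φ.frame x).surjective v
  rw [← Φ.frame_deriv x hx] at hv
  have h1 : Φ.deriv x w = 0 := (Φ.frame (f x)).injective (hv.trans (map_zero _).symm)
  have h2 : w = 0 := h (h1.trans (map_zero _).symm)
  rw [h2, map_zero]

end Frame

/-! ### Integrability of the distance to the critical set and of the regularity scales. -/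

section Regularity

variable {E : Type*} [NormedAddCommGroup E] [NormedSpace ℝ E] [FiniteDimensional ℝ E]
  {M : Type*} [MetricSpace M] [ChartedSpace E M]
  [RiemannianBundle (fun x : M => TangentSpace 𝓘(ℝ, E) x)]

/-- Outside the critical set, the derivative expands vectors, and up to a constant factor the
expansion is locally constant, on a scale which is a power of the distance to the critical set. -/
lemma IsNonDegenerateCriticalSet.derivExpands {f : M → M} {β : ℝ}
    (h : IsNonDegenerateCriticalSet (E := E) f (criticalSet E f) β) (hβ : 0 < β) :
    ∃ a : ℝ, 0 ≤ a ∧ ∀ x ∉ criticalSet E f, 0 < Metric.infDist x (criticalSet E f) ∧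
      DerivExpands E f
        (Real.exp (-(a + β * |Real.log (Metric.infDist x (criticalSet E f))|))) x ∧
      ∀ z ∈ Metric.ball x
          (Real.exp (-(a + (β + 1) * |Real.log (Metric.infDist x (criticalSet E f))|))),
        ∀ κ, DerivExpands E f κ x → DerivExpands E f (Real.exp (-1) * κ) z := by
  obtain ⟨B, hB, h1, h2⟩ := h.exists_bound
  obtain ⟨K, hK, h3⟩ := h.exists_det_lt
  refine ⟨|Real.log B| + Real.log 2, by positivity, fun x hx => ?_⟩
  -- At distance zero the strict determinant bound would put a nonnegative number below `0`.
  have hd : 0 < Metric.infDist x (criticalSet E f) := by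
    have h4 := (Real.sqrt_nonneg _).trans_lt (h3 x hx)
    rcases (Metric.infDist_nonneg (x := x) (s := criticalSet E f)).eq_or_lt' with h5 | h5
    · rw [h5, Real.zero_rpow hβ.ne', mul_zero] at h4
      exact absurd h4 (lt_irrefl _)
    · exact h5
  set d := Metric.infDist x (criticalSet E f) with hd_def
  have hlog2 : 0 < Real.log 2 := Real.log_pos one_lt_two
  have hexp1 : Real.exp (-(|Real.log B| + β * |Real.log d|)) ≤ 1 / B * d ^ β := by
    have : 1 / B * d ^ β = Real.exp (-Real.log B + Real.log d * β) := by
      rw [Real.exp_add, Real.exp_neg, Real.exp_log hB, Real.rpow_def_of_pos hd, one_div]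
    rw [this]
    refine Real.exp_le_exp.2 ?_
    have := le_abs_self (Real.log B)
    have := mul_le_mul_of_nonneg_left (neg_abs_le (Real.log d)) hβ.le
    linarith
  refine ⟨hd, fun v => ?_, fun z hz κ hκ => ?_⟩
  · rcases eq_or_ne v 0 with rfl | hv
    · rw [norm_zero, mul_zero]; exact norm_nonneg _
    have h4 := (h1 x hx v hv).1
    rw [le_div_iff₀ (norm_pos_iff.2 hv)] at h4
    refine le_trans (mul_le_mul_of_nonneg_right (le_trans (Real.exp_le_exp.2 ?_) hexp1)
      (norm_nonneg _)) h4
    linarith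
  -- The extra `|log d|` and `log 2` in the exponent bring the radius below `d / 2`; the remaining
  -- `|log B| + β * |log d|` makes the variation of `log ‖Df⁻¹‖` at most `1`.
  · have hz1 : dist x z < d / 2 := by
      rw [dist_comm]
      refine (Metric.mem_ball.1 hz).trans_le ?_
      calc _ ≤ Real.exp (-Real.log 2 + -|Real.log d|) := Real.exp_le_exp.2 (by
            have : 0 ≤ β * |Real.log d| := by positivity
            have := abs_nonneg (Real.log B)
            linarith)
        _ = 2⁻¹ * Real.exp (-|Real.log d|) := by
          rw [Real.exp_add, Real.exp_neg, Real.exp_log two_pos]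
        _ ≤ 2⁻¹ * d := by gcongr; exact exp_neg_abs_log_le hd
        _ = d / 2 := by ring
    have hz2 : z ∉ criticalSet E f := fun hzC => by
      have := Metric.infDist_le_dist_of_mem (x := x) hzC
      linarith
    have hz3 : B / d ^ β * dist x z ≤ 1 := by
      have h5 : dist x z ≤ 1 / B * d ^ β := by
        rw [dist_comm]
        refine (Metric.mem_ball.1 hz).le.trans (le_trans (Real.exp_le_exp.2 ?_) hexp1)
        have : 0 ≤ |Real.log d| := abs_nonneg _
        linarith
      have hdβ : 0 < d ^ β := Real.rpow_pos_of_pos hd _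
      calc _ ≤ B / d ^ β * (1 / B * d ^ β) := by gcongr
        _ = 1 := by field_simp
    have hx' : IsLocalDiffeomorphAt 𝓘(ℝ, E) 𝓘(ℝ, E) 1 f x := not_not.1 hx
    have hz' : IsLocalDiffeomorphAt 𝓘(ℝ, E) 𝓘(ℝ, E) 1 f z := not_not.1 hz2
    rcases subsingleton_or_nontrivial (TangentSpace 𝓘(ℝ, E) x) with hs | hn
    · intro v
      have : Subsingleton (TangentSpace 𝓘(ℝ, E) z) := hs
      rw [Subsingleton.elim v 0, norm_zero, mul_zero]
      exact norm_nonneg _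
    · exact mul_norm_le_of_abs_log_sub_le (hx'.mfderivToContinuousLinearEquiv one_ne_zero)
        (hz'.mfderivToContinuousLinearEquiv one_ne_zero) hn ((h2 x hx z hz2 hz1).trans hz3) hκ

variable [IsManifold 𝓘(ℝ, E) ∞ M] [MeasurableSpace M] [BorelSpace M]

/-- The distance to the critical set has an integrable logarithm. -/
lemma integrable_log_infDist_criticalSet {f : M → M} {X : Set M} (hX : IsCompact X)
    (hfX : Set.MapsTo f X X) (Φ : BoundedFrame E f X) {μ : Measure M} [IsProbabilityMeasure μ]
    (hf : ContMDiff 𝓘(ℝ, E) 𝓘(ℝ, E) 1 f) (hT : Ergodic f μ) (hμX : ∀ᵐ x ∂μ, x ∈ X)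
    (hexp : ∀ᵐ x ∂μ, GrowsExponentially Φ.deriv f x) {β : ℝ} (hβ : 0 < β)
    (h : IsNonDegenerateCriticalSet (E := E) f (criticalSet E f) β) :
    Integrable (fun x => Real.log (Metric.infDist x (criticalSet E f))) μ := by
  obtain ⟨C, hC1, hC⟩ := Φ.exists_norm_deriv_le
  have hdet := integrable_log_abs_det hT Φ.measurable_deriv hC1 hC hexp
  obtain ⟨K, hK, h3⟩ := h.exists_det_lt
  obtain ⟨a, -, ha⟩ := h.derivExpands hβ
  obtain ⟨B, hB, hBdet⟩ := exists_abs_det_le_mul_absDet E Φ.const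
  obtain ⟨R, hR⟩ : ∃ R : ℝ, ∀ x ∈ X, Metric.infDist x (criticalSet E f) ≤ R :=
    (hX.bddAbove_image (Metric.continuous_infDist_pt _).continuousOn).imp
      fun R hR x hx => hR ⟨x, hx, rfl⟩
  have hdm : Measurable fun x => Real.log (Metric.infDist x (criticalSet E f)) :=
    Real.measurable_log.comp (Metric.continuous_infDist_pt _).measurable
  -- The determinant bound turns integrability of `log |det|` into a lower bound for the logarithm
  -- of the distance; the upper bound `R` comes from compactness.
  have hbound : Integrable (fun x => β⁻¹ * (|(Real.log |LinearMap.det (Φ.deriv x : E →ₗ[ℝ] E)|)| +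
      |Real.log (B * K)|) + |Real.log R|) μ :=
    ((hdet.abs.add (integrable_const _)).const_mul _).add (integrable_const _)
  refine hbound.mono' hdm.aestronglyMeasurable ?_
  filter_upwards [hμX, hexp] with x hxX hx
  have hinj : Function.Injective (Φ.deriv x) := hx.injective
  have hxC := mem_compl_criticalSet_of_injective hf (Φ.injective_mfderiv hxX hinj)
  have hd := (ha x hxC).1
  have hlt := h3 x hxC
  have : FiniteDimensional ℝ (TangentSpace 𝓘(ℝ, E) x) := inferInstanceAs (FiniteDimensional ℝ E)
  have : FiniteDimensional ℝ (TangentSpace 𝓘(ℝ, E) (f x)) :=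
    inferInstanceAs (FiniteDimensional ℝ E)
  have hle := hBdet (Φ.frame x) (Φ.frame (f x)) (D E f x) (Φ.deriv x) (Φ.norm_frame_le x hxX)
    (Φ.norm_le_frame _ (hfX hxX)) (Φ.frame_deriv x hxX)
  set d := Metric.infDist x (criticalSet E f) with hd_def
  have hdet0 : 0 < |LinearMap.det (Φ.deriv x : E →ₗ[ℝ] E)| := by
    rw [abs_pos]
    intro h0
    have h1 := LinearMap.bot_lt_ker_of_det_eq_zero h0
    rw [LinearMap.ker_eq_bot.2 hinj] at h1
    exact lt_irrefl _ h1
  have hle2 : |LinearMap.det (Φ.deriv x : E →ₗ[ℝ] E)| ≤ B * K * d ^ β := by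
    refine hle.trans ?_
    rw [mul_assoc]
    exact mul_le_mul_of_nonneg_left hlt.le hB.le
  have hlog := Real.log_le_log hdet0 hle2
  rw [Real.log_mul (by positivity) (Real.rpow_pos_of_pos hd _).ne', Real.log_rpow hd] at hlog
  have hup := Real.log_le_log hd (hR x hxX)
  have e1 := neg_abs_le (Real.log |LinearMap.det (Φ.deriv x : E →ₗ[ℝ] E)|)
  have e2 := le_abs_self (Real.log (B * K))
  have e3 := le_abs_self (Real.log R)
  set q := |(Real.log |LinearMap.det (Φ.deriv x : E →ₗ[ℝ] E)|)| with hq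
  have hq0 : 0 ≤ q := abs_nonneg _
  have hlow : -(β⁻¹ * (q + |Real.log (B * K)|)) ≤ Real.log d := by
    rw [← mul_neg, inv_mul_eq_div, div_le_iff₀ hβ]
    linarith
  have : 0 ≤ β⁻¹ * (q + |Real.log (B * K)|) := by positivity
  have := abs_nonneg (Real.log R)
  rw [Real.norm_eq_abs, abs_le]
  constructor <;> linarith

/-- Integrability of the logarithms of the expansion of the derivative at a point, and of the size
of the neighbourhood on which it is controlled. -/
theorem exists_integrable_regularity
    [IsContinuousRiemannianBundle E (fun x : M => TangentSpace 𝓘(ℝ, E) x)] {f : M → M} {X : Set M} (hX : IsCompact X)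
    (hfX : Set.MapsTo f X X) (Φ : BoundedFrame E f X) {μ : Measure M} [IsProbabilityMeasure μ]
    (hf : ContMDiff 𝓘(ℝ, E) 𝓘(ℝ, E) 1 f) (hT : Ergodic f μ) (hμX : ∀ᵐ x ∂μ, x ∈ X)
    (hexp : ∀ᵐ x ∂μ, GrowsExponentially Φ.deriv f x) (hflat : IsNonFlat E f) :
    ∃ L τ : M → ℝ, Measurable L ∧ Integrable L μ ∧ (∀ x, 0 ≤ L x) ∧
      Measurable τ ∧ Integrable τ μ ∧ (∀ x, 0 ≤ τ x) ∧
      ∀ᵐ x ∂μ, DerivExpands E f (Real.exp (-L x)) x ∧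
        ∀ z ∈ Metric.ball x (Real.exp (-τ x)), ∀ κ, DerivExpands E f κ x →
          DerivExpands E f (Real.exp (-1) * κ) z := by
  rcases (criticalSet E f).eq_empty_or_nonempty with hC | hC
  · have hinj : ∀ x ∈ X, ∀ v : TangentSpace 𝓘(ℝ, E) x, D E f x v = 0 → v = 0 := by
      intro x _ v hv
      have hx : x ∉ criticalSet E f := by rw [hC]; exact Set.notMem_empty x
      have hx' : IsLocalDiffeomorphAt 𝓘(ℝ, E) 𝓘(ℝ, E) 1 f x := not_not.1 hx
      exact (hx'.mfderivToContinuousLinearEquiv one_ne_zero).map_eq_zero_iff.1 hv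
    obtain ⟨m, hm, h1⟩ := exists_derivExpands_of_isCompact hf hX hinj
    obtain ⟨ρ, hρ, h2⟩ := exists_ball_derivExpands hf hX hinj
    refine ⟨fun _ => |Real.log m|, fun _ => |Real.log ρ|, measurable_const, integrable_const _,
      fun _ => abs_nonneg _, measurable_const, integrable_const _, fun _ => abs_nonneg _, ?_⟩
    filter_upwards [hμX] with x hx
    exact ⟨(h1 x hx).anti (exp_neg_abs_log_le hm),
      fun z hz => h2 x hx z (Metric.ball_subset_ball (exp_neg_abs_log_le hρ) hz)⟩
  · obtain ⟨β, hβ, h⟩ := hflat hC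
    have hi := (integrable_log_infDist_criticalSet hX hfX Φ hf hT hμX hexp hβ h).abs
    have hm : Measurable fun x => |Real.log (Metric.infDist x (criticalSet E f))| :=
      measurable_abs.comp (Real.measurable_log.comp (Metric.continuous_infDist_pt _).measurable)
    obtain ⟨a, ha, h1⟩ := h.derivExpands hβ
    refine ⟨fun x => a + β * |Real.log (Metric.infDist x (criticalSet E f))|,
      fun x => a + (β + 1) * |Real.log (Metric.infDist x (criticalSet E f))|,
      (hm.const_mul _).const_add _, (integrable_const _).add (hi.const_mul _),
      fun x => by positivity, (hm.const_mul _).const_add _,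
      (integrable_const _).add (hi.const_mul _), fun x => by positivity, ?_⟩
    filter_upwards [hμX, hexp] with x hxX hx
    exact (h1 x (mem_compl_criticalSet_of_injective hf
      (Φ.injective_mfderiv hxX hx.injective))).2

end Regularity


/-! ### Following an orbit through a block, and uniform constants on compact sets. -/

section Metric

variable {M : Type*} [MetricSpace M]

lemma HasRadialContraction.mono {p : M} {r K K' : ℝ} (hK : K ≤ K')
    (h : HasRadialContraction p r K) : HasRadialContraction p r K' := by
  obtain ⟨H, h1, h2, h3, h4⟩ := h
  refine ⟨H, h1, h2, h3, fun q a b => (h4 q a b).trans ?_⟩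
  gcongr

/-- Each of the first `i` steps sets aside `a`, to be spent on the Lipschitz factor `exp a`; the
full term at time `i` remains as a radius. -/
lemma add_mul_le_birkhoffSum {X : Type*} {f : X → X} {h : X → ℝ} {a : ℝ} (ha : 0 ≤ a)
    (hh : ∀ x, a ≤ h x) {i ℓ : ℕ} (hi : i < ℓ) (x : X) :
    h (f^[i] x) + i * a ≤ birkhoffSum f h ℓ x := by
  have h1 : birkhoffSum f h (i + 1) x ≤ birkhoffSum f h ℓ x :=
    Finset.sum_le_sum_of_subset_of_nonneg (Finset.range_subset_range.2 hi)
      fun j _ _ => ha.trans (hh _)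
  have h2 : (i : ℝ) * a ≤ birkhoffSum f h i x := by
    have := Finset.card_nsmul_le_sum (Finset.range i) (fun k => h (f^[k] x)) a fun k _ => hh _
    simpa [birkhoffSum] using this
  rw [birkhoffSum_succ] at h1
  linarith

/-- Points that start close enough to `y` follow the orbit of `y`. -/
lemma dist_iterate_le_of_dist_le {f : M → M} {h : M → ℝ} {a : ℝ} (ha : 0 ≤ a)
    (hh : ∀ x, a ≤ h x) {ℓ : ℕ} {y z : M}
    (hlip : ∀ i < ℓ, ∀ w, dist w (f^[i] y) ≤ Real.exp (-h (f^[i] y)) →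
      dist (f w) (f (f^[i] y)) ≤ Real.exp a * dist w (f^[i] y))
    (hz : dist z y ≤ Real.exp (-birkhoffSum f h ℓ y)) {i : ℕ} (hi : i < ℓ) :
    dist (f^[i] z) (f^[i] y) ≤ Real.exp (-h (f^[i] y)) := by
  have key : ∀ i < ℓ, dist (f^[i] z) (f^[i] y) ≤
      Real.exp (i * a - birkhoffSum f h ℓ y) := by
    intro i
    induction i with
    | zero => intro _; simpa using hz
    | succ i ih =>
      intro hi
      have hi' : i < ℓ := i.lt_succ_self.trans hi
      have h1 := ih hi'
      have h2 : dist (f^[i] z) (f^[i] y) ≤ Real.exp (-h (f^[i] y)) := by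
        refine h1.trans (Real.exp_le_exp.2 ?_)
        linarith [add_mul_le_birkhoffSum ha hh hi' (f := f) y]
      rw [Function.iterate_succ_apply', Function.iterate_succ_apply']
      refine (hlip i hi' _ h2).trans ?_
      calc _ ≤ Real.exp a * Real.exp (i * a - birkhoffSum f h ℓ y) := by gcongr
        _ = _ := by rw [← Real.exp_add]; congr 1; push_cast; ring
  refine (key i hi).trans (Real.exp_le_exp.2 ?_)
  linarith [add_mul_le_birkhoffSum ha hh hi (f := f) y]

lemma exists_isCompact_closedBall_of_isCompact [LocallyCompactSpace M] {X : Set M}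
    (hX : IsCompact X) : ∃ c > 0, ∀ x ∈ X, IsCompact (Metric.closedBall x c) := by
  refine IsCompact.exists_pos_eventually hX (fun c c' x _ hcc h =>
    h.of_isClosed_subset Metric.isClosed_closedBall (Metric.closedBall_subset_closedBall hcc))
    fun x _ => ?_
  obtain ⟨r, hr, h⟩ := Metric.exists_isCompact_closedBall x
  refine ⟨r / 2, half_pos hr, ?_⟩
  filter_upwards [Metric.ball_mem_nhds x (half_pos hr)] with y hy
  refine h.of_isClosed_subset Metric.isClosed_closedBall
    (Metric.closedBall_subset_closedBall' ?_)
  rw [Metric.mem_ball] at hy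
  linarith

end Metric

section Chain

variable {E : Type*} [NormedAddCommGroup E] [NormedSpace ℝ E]
  {M : Type*} [MetricSpace M] [ChartedSpace E M]
  [RiemannianBundle (fun x : M => TangentSpace 𝓘(ℝ, E) x)]

lemma derivExpands_iterate {f : M → M} (hf : ContMDiff 𝓘(ℝ, E) 𝓘(ℝ, E) 1 f) {b : ℕ → ℝ} {n : ℕ}
    {z : M} (h : ∀ i < n, DerivExpands E f (Real.exp (-b i)) (f^[i] z)) :
    DerivExpands E f^[n] (Real.exp (-∑ i ∈ Finset.range n, b i)) z := by
  induction n with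
  | zero =>
    intro v
    have h1 : D E f^[0] z v = v := by
      change mfderiv 𝓘(ℝ, E) 𝓘(ℝ, E) id z v = v
      rw [mfderiv_id]; rfl
    rw [Finset.sum_range_zero, neg_zero, Real.exp_zero, one_mul]
    exact (congrArg norm h1).ge
  | succ n ih =>
    intro v
    have h1 := ih (fun i hi => h i (hi.trans n.lt_succ_self)) v
    have h2 := h n n.lt_succ_self (D E f^[n] z v)
    have h3 : ‖D E f^[n + 1] z v‖ = ‖D E f (f^[n] z) (D E f^[n] z v)‖ := by
      rw [Function.iterate_succ']
      exact congrArg norm (mfderiv_comp_apply z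
        (hf.mdifferentiableAt (x := f^[n] z) one_ne_zero)
        ((hf.iterate n).mdifferentiableAt (x := z) one_ne_zero) v)
    rw [h3, Finset.sum_range_succ]
    refine le_trans ?_ h2
    calc _ = Real.exp (-b n) * (Real.exp (-∑ i ∈ Finset.range n, b i) * ‖v‖) := by
          rw [← mul_assoc, ← Real.exp_add]; congr 2; ring
      _ ≤ _ := by gcongr

lemma BoundedFrame.expands_of_derivExpands [MeasurableSpace M] {f : M → M} {X : Set M}
    (Φ : BoundedFrame E f X) (hfX : Set.MapsTo f X X) {x : M} (hx : x ∈ X) {κ : ℝ}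
    (h : DerivExpands E f (Real.exp κ) x) (v : E) :
    Real.exp (κ - 2 * Real.log Φ.const) * ‖v‖ ≤ ‖Φ.deriv x v‖ := by
  have hc : 0 < Φ.const := one_pos.trans_le Φ.one_le_const
  have h1 := h (Φ.frame x v)
  rw [← Φ.frame_deriv x hx] at h1
  have h2 := Φ.norm_frame_le _ (hfX hx) (Φ.deriv x v)
  have h3 := Φ.norm_le_frame x hx v
  have h4 : Real.exp (κ - 2 * Real.log Φ.const) = Real.exp κ / (Φ.const * Φ.const) := by
    rw [Real.exp_sub, two_mul, Real.exp_add, Real.exp_log hc]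
  rw [h4, div_mul_eq_mul_div, div_le_iff₀ (by positivity)]
  calc _ ≤ Real.exp κ * (Φ.const * ‖Φ.frame x v‖) := by gcongr
    _ = Φ.const * (Real.exp κ * ‖Φ.frame x v‖) := by ring
    _ ≤ Φ.const * (Φ.const * ‖Φ.deriv x v‖) :=
      mul_le_mul_of_nonneg_left (h1.trans h2) hc.le
    _ = _ := by ring

lemma BoundedFrame.derivExpands_iterate_of_cocycle [MeasurableSpace M] {f : M → M} {X : Set M}
    (Φ : BoundedFrame E f X) (hf : ContMDiff 𝓘(ℝ, E) 𝓘(ℝ, E) 1 f) (hfX : Set.MapsTo f X X)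
    {x : M} (hx : x ∈ X) {κ : ℝ} {n : ℕ}
    (h : ∀ v, Real.exp κ * ‖v‖ ≤ ‖cocycle Φ.deriv f n x v‖) :
    DerivExpands E f^[n] (Real.exp (κ - 2 * Real.log Φ.const)) x := by
  intro u
  obtain ⟨v, rfl⟩ := (Φ.frame x).surjective u
  have hc : 0 < Φ.const := one_pos.trans_le Φ.one_le_const
  have h1 := h v
  have h2 := Φ.norm_frame_le x hx v
  have h3 := Φ.norm_le_frame _ (hfX.iterate n hx) (cocycle Φ.deriv f n x v)
  rw [Φ.frame_cocycle hf hfX n hx] at h3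
  have h4 : Real.exp (κ - 2 * Real.log Φ.const) = Real.exp κ / (Φ.const * Φ.const) := by
    rw [Real.exp_sub, two_mul, Real.exp_add, Real.exp_log hc]
  rw [h4, div_mul_eq_mul_div, div_le_iff₀ (by positivity)]
  calc _ ≤ Real.exp κ * (Φ.const * ‖v‖) := mul_le_mul_of_nonneg_left h2 (Real.exp_pos _).le
    _ = Φ.const * (Real.exp κ * ‖v‖) := by ring
    _ ≤ Φ.const * (Φ.const * ‖D E f^[n] x (Φ.frame x v)‖) :=
      mul_le_mul_of_nonneg_left (h1.trans h3) hc.le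
    _ = _ := by ring

end Chain

section Uniform

variable {E : Type*} [NormedAddCommGroup E] [NormedSpace ℝ E]
  {M : Type*} [MetricSpace M] [ChartedSpace E M] [IsManifold 𝓘(ℝ, E) 1 M]
  [RiemannianBundle (fun x : M => TangentSpace 𝓘(ℝ, E) x)]
  [IsContinuousRiemannianBundle E (fun x : M => TangentSpace 𝓘(ℝ, E) x)]

lemma isOpen_injective_mfderiv [FiniteDimensional ℝ E] {g : M → M}
    (hg : ContMDiff 𝓘(ℝ, E) 𝓘(ℝ, E) 1 g) :
    IsOpen {x : M | ∀ v : TangentSpace 𝓘(ℝ, E) x, D E g x v = 0 → v = 0} := by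
  refine isOpen_iff_mem_nhds.2 fun x hx => ?_
  obtain ⟨m, hm, h⟩ := exists_derivExpands_of_injective hx
  have h2 : Tendsto (fun z : M => (x, z)) (𝓝 x) (𝓝 (x, x)) :=
    Continuous.tendsto (by fun_prop) x
  filter_upwards [h2.eventually (eventually_derivExpands hg hx)] with z hz v hv
  have h3 := hz m h v
  rw [hv, norm_zero] at h3
  exact norm_le_zero_iff.1 (nonpos_of_mul_nonpos_right h3 (by positivity))

variable [IsRiemannianManifold 𝓘(ℝ, E) M]

/-- One parameter serves both as radius and as inverse Lipschitz constant, so the property is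
monotone in it and passes from local to uniform on compact sets. -/
lemma exists_uniform_dist_le {f : M → M} (hf : ContMDiff 𝓘(ℝ, E) 𝓘(ℝ, E) 1 f) {X : Set M}
    (hX : IsCompact X) :
    ∃ c > 0, ∀ x ∈ X, ∀ w ∈ Metric.ball x c, dist (f w) (f x) ≤ c⁻¹ * dist w x := by
  refine IsCompact.exists_pos_eventually hX (fun c c' x hc hcc h w hw =>
    (h w (Metric.ball_subset_ball hcc hw)).trans ?_) fun x _ => ?_
  · gcongr
  · obtain ⟨C, hC, O, hO, h⟩ := exists_nhds_dist_le (E := E) (F := E) (h := f) (p := x)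
      (Eventually.of_forall fun q => hf.contMDiffAt)
    obtain ⟨s, hs, hsO⟩ := Metric.mem_nhds_iff.1 hO
    refine ⟨min (s / 2) C⁻¹, by positivity, ?_⟩
    filter_upwards [Metric.ball_mem_nhds x (half_pos hs)] with y hy w hw
    rw [Metric.mem_ball] at hy hw
    have hyO : y ∈ O := hsO (Metric.mem_ball.2 (by linarith))
    have hwO : w ∈ O := hsO (Metric.mem_ball.2 (by
      have := dist_triangle w y x
      have := hw.trans_le (min_le_left _ _)
      linarith))
    refine (h w hwO y hyO).trans ?_
    gcongr
    rw [le_inv_comm₀ hC (by positivity)]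
    exact min_le_right _ _

lemma exists_uniform_hasRadialContraction [FiniteDimensional ℝ E] {X : Set M} (hX : IsCompact X) :
    ∃ c > 0, ∀ x ∈ X, HasRadialContraction x c c⁻¹ := by
  refine IsCompact.exists_pos_eventually hX (fun c c' x hc hcc h => (h.anti hcc).mono ?_)
    fun x _ => ?_
  · gcongr
  · obtain ⟨r, hr, K, hK, h⟩ := exists_hasRadialContraction E x
    refine ⟨min r K⁻¹, by positivity, h.mono fun p hp => (hp.anti (min_le_left _ _)).mono ?_⟩
    rw [le_inv_comm₀ hK (by positivity)]
    exact min_le_right _ _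

end Uniform


/-- Finite distances are realized by paths, so the manifold is connected, hence σ-compact and second
countable; then the complement of the support is null. -/
lemma ae_mem_support (E : Type*) [NormedAddCommGroup E] [NormedSpace ℝ E] [FiniteDimensional ℝ E]
    {M : Type*} [MetricSpace M] [ChartedSpace E M] [IsManifold 𝓘(ℝ, E) 1 M]
    [RiemannianBundle (fun x : M => TangentSpace 𝓘(ℝ, E) x)]
    [IsContinuousRiemannianBundle E (fun x : M => TangentSpace 𝓘(ℝ, E) x)]
    [IsRiemannianManifold 𝓘(ℝ, E) M] [MeasurableSpace M]
    (μ : Measure M) : ∀ᵐ x ∂μ, x ∈ μ.support := by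
  have : LocallyCompactSpace M := Manifold.locallyCompact_of_finiteDimensional 𝓘(ℝ, E)
  have : SigmaCompactSpace M := sigmaCompactSpace_of_isPreconnected
    (hasNearGeodesics E M).isPreconnected_univ
  have : SecondCountableTopology M := EMetric.secondCountable_of_sigmaCompact M
  exact Measure.support_mem_ae

/-! ### Block expansion on neighbourhoods and conclusion. -/

section Expanding

variable {E : Type*} [NormedAddCommGroup E] [NormedSpace ℝ E] [FiniteDimensional ℝ E]
  {M : Type*} [MetricSpace M] [ChartedSpace E M] [IsManifold 𝓘(ℝ, E) ∞ M]
  [RiemannianBundle (fun x : M => TangentSpace 𝓘(ℝ, E) x)]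
  [IsContinuousRiemannianBundle E (fun x : M => TangentSpace 𝓘(ℝ, E) x)]
  [MeasurableSpace M] [BorelSpace M]

/-- Over blocks of a suitable length `ℓ`, the derivative of `f^ℓ` expands, with Birkhoff sums of
a function of small integral as errors, on neighbourhoods of definite size except for a small set
of blocks. -/
lemma exists_block_derivExpands {f : M → M} {X : Set M} (hX : IsCompact X)
    (hfX : Set.MapsTo f X X) (Φ : BoundedFrame E f X) {μ : Measure M} [IsProbabilityMeasure μ]
    (hf : ContMDiff 𝓘(ℝ, E) 𝓘(ℝ, E) 1 f) (hT : Ergodic f μ) (hμX : ∀ᵐ x ∂μ, x ∈ X)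
    (hexp : ∀ᵐ x ∂μ, GrowsExponentially Φ.deriv f x) {L : M → ℝ} (hLm : Measurable L)
    (hLi : Integrable L μ) (hL0 : ∀ x, 0 ≤ L x)
    (hL : ∀ᵐ x ∂μ, DerivExpands E f (Real.exp (-L x)) x) :
    ∃ ℓ : ℕ, 1 ≤ ℓ ∧ ∃ (p : M → ℝ) (b ρ : ℝ), Measurable p ∧ Integrable p μ ∧ (∀ x, 0 ≤ p x) ∧
      ℓ * ∫ x, p x ∂μ < b ∧ 0 < ρ ∧ ∀ᵐ x ∂μ,
        (∀ z ∈ Metric.ball x ρ, DerivExpands E f^[ℓ] (Real.exp (b - birkhoffSum f p ℓ x)) z) ∨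
          b - birkhoffSum f p ℓ x ≤ -birkhoffSum f (fun x => L x + 1) ℓ x := by
  have hc : 0 ≤ 2 * Real.log Φ.const := by
    have := Real.log_nonneg Φ.one_le_const
    positivity
  -- The margin `2 * log Φ.const + 1` pays for returning from the frame to the Riemannian norms and
  -- for the factor `exp (-1)` lost at nearby points.
  obtain ⟨ℓ, hℓ, p, b, hpm, hpi, hp0, hb, hblock⟩ := exists_block_expansion hT Φ.measurable_deriv
    hexp (L := fun x => L x + 2 * Real.log Φ.const) (hLm.add_const _)
    (hLi.add (integrable_const _)) (fun x => add_nonneg (hL0 x) hc) (by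
      filter_upwards [hμX, hL] with x hxX hx v
      have := Φ.expands_of_derivExpands hfX hxX hx v
      rwa [← neg_add'] at this) (2 * Real.log Φ.const + 1)
  have hℓ0 : (0 : ℝ) < ℓ := by exact_mod_cast hℓ
  have hblock' : ∀ᵐ x ∂μ, x ∈ X ∧
      DerivExpands E f^[ℓ] (Real.exp (b + 1 - birkhoffSum f p ℓ x)) x := by
    filter_upwards [hμX, hblock] with x hxX hx
    refine ⟨hxX, ?_⟩
    have := Φ.derivExpands_iterate_of_cocycle hf hfX hxX hx
    convert this using 2
    ring
  -- Added to `p` on the exceptional set, this penalty lowers the claimed expansion of a block to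
  -- the one guaranteed step by step by `L`.
  set bad : M → ℝ := fun x => |b| + birkhoffSum f (fun x => L x + 1) ℓ x with hbad
  have hS0 : ∀ x, 0 ≤ birkhoffSum f (fun x => L x + 1) ℓ x := fun x =>
    Finset.sum_nonneg fun k _ => add_nonneg (hL0 _) one_pos.le
  have hbad0 : ∀ x, 0 ≤ bad x := fun x => add_nonneg (abs_nonneg _) (hS0 x)
  have hbadm : Measurable bad :=
    (measurable_birkhoffSum hf.continuous.measurable (hLm.add_const _) ℓ).const_add _
  have hbadi : Integrable bad μ := (integrable_const _).add
    (integrable_birkhoffSum hT.toMeasurePreserving (hLi.add (integrable_const _)) ℓ)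
  obtain ⟨F, hFc, hFU, hUF, hFm⟩ :=
    (isOpen_injective_mfderiv (hf.iterate ℓ)).exists_iUnion_isClosed
  have hGc : ∀ N, IsCompact (X ∩ F N) := fun N => hX.inter_right (hFc N)
  -- The penalty over a block then costs less than `1` on average, which is the slack left in `hb`.
  obtain ⟨N, hN⟩ := ((tendsto_integral_compl_indicator hbadi (G := fun N => X ∩ F N)
    (fun N => (hGc N).measurableSet)
    (fun a c hac => Set.inter_subset_inter_right _ (hFm hac)) (by
      filter_upwards [hblock'] with x hx
      have : x ∈ ⋃ n, F n := by
        rw [hUF]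
        intro v hv
        have h1 := hx.2 v
        rw [hv, norm_zero] at h1
        exact norm_le_zero_iff.1 (nonpos_of_mul_nonpos_right h1 (Real.exp_pos _))
      obtain ⟨N, hN⟩ := Set.mem_iUnion.1 this
      exact ⟨N, hx.1, hN⟩)).eventually_lt_const (u := (ℓ : ℝ)⁻¹) (by positivity)).exists
  obtain ⟨ρ, hρ, hball⟩ := exists_ball_derivExpands (hf.iterate ℓ) (hGc N)
    fun x hx => hFU N hx.2
  have hGm : MeasurableSet (X ∩ F N) := (hGc N).measurableSet
  have hindi : Integrable ((X ∩ F N)ᶜ.indicator bad) μ := hbadi.indicator hGm.compl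
  have hind0 : ∀ x, 0 ≤ (X ∩ F N)ᶜ.indicator bad x := fun x =>
    Set.indicator_nonneg (fun x _ => hbad0 x) x
  refine ⟨ℓ, hℓ, fun x => p x + (X ∩ F N)ᶜ.indicator bad x, b, ρ,
    hpm.add (hbadm.indicator hGm.compl), hpi.add hindi, fun x => add_nonneg (hp0 x) (hind0 x),
    ?_, hρ, ?_⟩
  · rw [integral_add hpi hindi, mul_add]
    have := mul_lt_mul_of_pos_left hN hℓ0
    rw [mul_inv_cancel₀ hℓ0.ne'] at this
    linarith
  · filter_upwards [hblock'] with x hx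
    by_cases hxG : x ∈ X ∩ F N
    · left
      intro z hz
      refine (hball x hxG z hz _ hx.2).anti ?_
      rw [← Real.exp_add]
      refine Real.exp_le_exp.2 ?_
      have : birkhoffSum f p ℓ x ≤
          birkhoffSum f (fun x => p x + (X ∩ F N)ᶜ.indicator bad x) ℓ x :=
        Finset.sum_le_sum fun k _ => le_add_of_nonneg_right (hind0 _)
      linarith
    · right
      have h1 := add_mul_le_birkhoffSum (f := f) le_rfl
        (fun x => add_nonneg (hp0 x) (hind0 x)) (Nat.zero_lt_of_lt hℓ) x
      simp only [Function.iterate_zero, id, mul_zero, add_zero] at h1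
      rw [Set.indicator_of_mem (show x ∈ (X ∩ F N)ᶜ from hxG)] at h1
      have h2 := hp0 x
      have h3 := le_abs_self b
      simp only [hbad] at h1
      linarith

/-- Almost every point has a positive frequency of hyperbolic times for some iterate of `f`. -/
theorem exists_freqHypTimeSet_ae_of_isExpandingMeasure [IsRiemannianManifold 𝓘(ℝ, E) M] {f : M → M}
    (hf : ContMDiff 𝓘(ℝ, E) 𝓘(ℝ, E) 1 f) (hflat : IsNonFlat E f) {μ : Measure M}
    (hμ : IsExpandingMeasure E f μ) :
    ∃ (ℓ : ℕ) (c θ δ : ℝ), 1 ≤ ℓ ∧ 0 < c ∧ 0 < θ ∧ θ < 1 ∧ 0 < δ ∧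
      ∀ᵐ x ∂μ, x ∈ freqHypTimeSet θ c δ f^[ℓ] := by
  have := hμ.isProbabilityMeasure
  have : LocallyCompactSpace M := Manifold.locallyCompact_of_finiteDimensional 𝓘(ℝ, E)
  have hT := hμ.ergodic
  have hmp := hT.toMeasurePreserving
  set X := μ.support with hXdef
  have hX : IsCompact X := isCompact_of_stronglyTransitiveOn hf.continuous
    (Measure.isClosed_support) hμ.stronglyTransitive
  have hfX : Set.MapsTo f X X := mapsTo_support hf.continuous hmp
  have hμX : ∀ᵐ x ∂μ, x ∈ X := ae_mem_support E μ
  obtain ⟨Φ⟩ := exists_boundedFrame hf hX hfX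
  have hexp : ∀ᵐ x ∂μ, GrowsExponentially Φ.deriv f x := by
    filter_upwards [hμX, hμ.lyapunov_pos] with x hxX hx
    exact Φ.growsExponentially hf hfX hxX hx
  obtain ⟨L, τ, hLm, hLi, hL0, hτm, hτi, hτ0, hreg⟩ :=
    exists_integrable_regularity hX hfX Φ hf hT hμX hexp hflat
  obtain ⟨ℓ, hℓ, p, b, ρ, hpm, hpi, hp0, hb, hρ, hblock⟩ := exists_block_derivExpands hX hfX Φ hf hT
    hμX hexp hLm hLi hL0 (hreg.mono fun x hx => hx.1)
  obtain ⟨s, hs, hlip⟩ := exists_uniform_dist_le hf hX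
  obtain ⟨r, hr, hrad⟩ := exists_uniform_hasRadialContraction (E := E) hX
  obtain ⟨t, ht, hcomp⟩ := exists_isCompact_closedBall_of_isCompact hX
  -- Large enough that `exp (-a)` lies below all three uniform radii and `exp a` dominates the
  -- Lipschitz constant `s⁻¹`.
  set a : ℝ := |Real.log s| + |Real.log ρ| + |Real.log t| + 1 with ha
  have hs0 := abs_nonneg (Real.log s)
  have hρ0 := abs_nonneg (Real.log ρ)
  have ht0 := abs_nonneg (Real.log t)
  have ha0 : 0 < a := by positivity
  have has : Real.exp (-a) < s :=
    (Real.exp_lt_exp.2 (by linarith)).trans_le (exp_neg_abs_log_le hs)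
  have haρ : Real.exp (-a) < ρ :=
    (Real.exp_lt_exp.2 (by linarith)).trans_le (exp_neg_abs_log_le hρ)
  have hat : Real.exp (-a) < t :=
    (Real.exp_lt_exp.2 (by linarith)).trans_le (exp_neg_abs_log_le ht)
  have has' : s⁻¹ ≤ Real.exp a := by
    rw [inv_le_comm₀ hs (Real.exp_pos _), ← Real.exp_neg]
    exact has.le
  set h : M → ℝ := fun x => τ x + a with hh
  have hah : ∀ x, a ≤ h x := fun x => le_add_of_nonneg_left (hτ0 x)
  have hsum : ∀ x, Real.exp (-birkhoffSum f h ℓ x) ≤ Real.exp (-a) := fun x => by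
    have h1 := add_mul_le_birkhoffSum (f := f) ha0.le hah (Nat.zero_lt_of_lt hℓ) x
    rw [Function.iterate_zero_apply, Nat.cast_zero, zero_mul, add_zero] at h1
    exact Real.exp_le_exp.2 (neg_le_neg ((hah x).trans h1))
  obtain ⟨c, θ, δ, hc, hθ, hθ1, hδ, hfreq⟩ := exists_freqHypTimeSet_ae (hasNearGeodesics E M)
    hf.continuous hT hℓ hpm hpi hp0 (h := h) (hτm.add_const _) (hτi.add (integrable_const _))
    (fun x => ha0.le.trans (hah x)) hb hr (inv_pos.2 hr) (hμX.mono hrad)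
    (by
      filter_upwards [hμX] with x hx
      exact (hcomp x hx).of_isClosed_subset Metric.isClosed_closedBall
        (Metric.closedBall_subset_closedBall ((hsum x).trans hat.le)))
    (by
      filter_upwards [hblock, ae_forall_iterate hmp hμX, ae_forall_iterate hmp hreg]
        with y hy hyX hyreg z hz
      rw [Metric.mem_closedBall] at hz
      refine localHomeo_expandsNear_of_mfderiv_ge (hf.iterate ℓ) (Real.exp_pos _) ?_
      -- In a good block the derivative of `f^[ℓ]` is controlled on the whole `ρ`-ball. In a bad one
      -- the orbit of `z` follows that of `y` within the scales `exp (-τ)`, and the one-step bounds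
      -- multiply.
      rcases hy with hy | hy
      · have hzρ : z ∈ Metric.ball y ρ := Metric.mem_ball.2
          ((hz.trans (hsum y)).trans_lt haρ)
        filter_upwards [Metric.isOpen_ball.mem_nhds hzρ] with z' hz'
        exact hy z' hz'
      · have hclose : ∀ i < ℓ, f^[i] z ∈ Metric.ball (f^[i] y) (Real.exp (-τ (f^[i] y))) := by
          intro i hi
          refine Metric.mem_ball.2 ((dist_iterate_le_of_dist_le ha0.le hah
            (fun j _ w hw => ?_) hz hi).trans_lt (Real.exp_lt_exp.2 ?_))
          · have hw' : w ∈ Metric.ball (f^[j] y) s := Metric.mem_ball.2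
              ((hw.trans (Real.exp_le_exp.2 (neg_le_neg (hah _)))).trans_lt has)
            refine (hlip _ (hyX j) w hw').trans ?_
            gcongr
          · simp only [hh]
            linarith
        have hnear : ∀ᶠ z' in 𝓝 z, ∀ i ∈ Finset.range ℓ,
            f^[i] z' ∈ Metric.ball (f^[i] y) (Real.exp (-τ (f^[i] y))) := by
          rw [Filter.eventually_all_finset]
          intro i hi
          exact (hf.continuous.iterate i).continuousAt.preimage_mem_nhds
            (Metric.isOpen_ball.mem_nhds (hclose i (Finset.mem_range.1 hi)))
        filter_upwards [hnear] with z' hz'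
        have hstep : ∀ i < ℓ, DerivExpands E f (Real.exp (-(L (f^[i] y) + 1))) (f^[i] z') := by
          intro i hi
          have := (hyreg i).2 _ (hz' i (Finset.mem_range.2 hi)) _ (hyreg i).1
          rwa [← Real.exp_add, ← neg_add_rev] at this
        exact (derivExpands_iterate hf hstep).anti (Real.exp_le_exp.2 hy))
  exact ⟨ℓ, c, θ, δ, hℓ, hc, hθ, hθ1, hδ, hfreq⟩

end Expanding

end HyperbolicTimes

theorem lemma3p5
    {E : Type*} [NormedAddCommGroup E] [NormedSpace ℝ E] [FiniteDimensional ℝ E]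
    {M : Type*} [MetricSpace M] [ChartedSpace E M] [IsManifold 𝓘(ℝ, E) ∞ M]
    [RiemannianBundle (fun x : M => TangentSpace 𝓘(ℝ, E) x)]
    [IsContMDiffRiemannianBundle 𝓘(ℝ, E) ∞ E (fun x : M => TangentSpace 𝓘(ℝ, E) x)]
    [IsRiemannianManifold 𝓘(ℝ, E) M]
    [MeasurableSpace M] [BorelSpace M]
    (f : M → M) (hf : ContMDiff 𝓘(ℝ, E) 𝓘(ℝ, E) 1 f) (hflat : HyperbolicTimes.IsNonFlat E f)
    (μ : Measure M) (hμ : HyperbolicTimes.IsExpandingMeasure E f μ) :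
    ∃ (ℓ : ℕ) (c θ δ : ℝ), 1 ≤ ℓ ∧ 0 < c ∧ 0 < θ ∧ θ < 1 ∧ 0 < δ ∧
      (∀ᵐ x ∂μ, x ∈ HyperbolicTimes.freqHypTimeSet θ c δ (f^[ℓ])) ∧
      μ (HyperbolicTimes.freqHypTimeSet θ c δ (f^[ℓ])) = 1 := by
  have : IsContinuousRiemannianBundle E (fun x : M => TangentSpace 𝓘(ℝ, E) x) :=
    HyperbolicTimes.isContinuousRiemannianBundle_of_contMDiff (n := ∞)
  have := hμ.isProbabilityMeasure
  obtain ⟨ℓ, c, θ, δ, hℓ, hc, hθ, hθ1, hδ, h⟩ :=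
    HyperbolicTimes.exists_freqHypTimeSet_ae_of_isExpandingMeasure hf hflat hμ
  refine ⟨ℓ, c, θ, δ, hℓ, hc, hθ, hθ1, hδ, h, ?_⟩
  have h1 : HyperbolicTimes.freqHypTimeSet θ c δ f^[ℓ] =ᵐ[μ] (Set.univ : Set M) := eventuallyEq_univ.2 h
  rw [measure_congr h1, measure_univ]
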